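/- Let $R$ be a commutative ring; all categories and functors below are $R$-linear. A \emph{tensor category} is a symmetric monoidal closed category (with $R$-bilinear tensor product and unit object $\mathbb{1}$) that has all small colimits. A \emph{tensor functor} is an $R$-linear symmetric strong monoidal functor that has a right adjoint. In a tensor category $\mathcal{C}$, the external tensor product $C \odot M$ of an object $C$ and an $R$-module $M$ is the object with $\mathcal{C}(C\odot M,-)\cong \mathrm{Hom}_R(M,\mathcal{C}(C,-))$. A commutative algebra $A$ in $\mathcal{C}$ is \emph{faithfully flat} if $A\otimes -$ preserves all finite limits that exist in $\mathcal{C}$ and reflects isomorphisms. Let $H$ be a commutative Hopf algebra over $R$ with comultiplication $\delta$ and counit $\varepsilon$, and let $\mathrm{Comod}(H)$ be the symmetric monoidal category of $H$-comodules $M \to H\otimes_R M$. Suppose that $H$ is an \emph{Adams Hopf algebra}, that is, $H$ is flat over $R$ and $\mathrm{Comod}(H)$ is generated by its objects with duals. Write $\underline{H}=(H,\delta)$ for the regular comodule, a commutative algebra in $\mathrm{Comod}(H)$; the comultiplication is a morphism of comodules $\delta\colon\underline{H}\to\underline{H}\odot H$. An \emph{$H$-torsor} in a tensor category $\mathcal{C}$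 is a faithfully flat commutative algebra $(A,\mu,\eta)$ in $\mathcal{C}$ together with a morphism of algebras $\tau\colon A\to A\odot H$ such that $(\tau\odot H)\tau=(A\odot\delta)\tau$ and $(A\odot\varepsilon)\tau=\mathrm{id}_A$, and such that the composite $$A\otimes A\xrightarrow{\,A\otimes\tau\,}A\otimes A\odot H\xrightarrow{\,\mu\odot H\,}A\odot H$$ is an isomorphism. A morphism of $H$-torsors $(A,\tau)\to(A',\tau')$ is a morphism of algebras $\varphi\colon A\to A'$ with $(\varphi\odot H)\tau=\tau'\varphi$. The resulting category is denoted $\mathrm{Tors}_H(\mathcal{C})$. \textbf{Theorem.} Let $H$ be an Adams Hopf algebra over $R$, and let $\mathcal{C}$ be a tensor category that has equalizers and in which filtered colimits are exact, that is, commute with finite limits. Then for every tensor functor $F\colon\mathrm{Comod}(H)\to\mathcal{C}$ the algebra $F\underline{H}$ with the morphism $F\underline{H}\xrightarrow{F\delta}F(\underline{H}\odot H)\cong F\underline{H}\odot H$ is an $H$-torsor in $\mathcal{C}$, and $F\mapsto F\underline{H}$ defines an equivalence from the category of tensor functors $\mathrm{Comod}(H)\to\mathcal{C}$ and symmetric monoidal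 natural transformations to the category $\mathrm{Tors}_H(\mathcal{C})$. Consequently, $\mathrm{Tors}_H(\mathcal{C})$ is a groupoid. -/

import Mathlib

set_option linter.unusedSectionVars false
set_option linter.unusedSimpArgs false
open CategoryTheory MonoidalCategory Limits
open scoped TensorProduct

universe w u

namespace UnivTorsor

noncomputable section External

variable (R : Type u) [CommRing R] (C : Type w) [Category.{u} C] [Preadditive C] [Linear R C]
  [MonoidalCategory C] [HasColimits C]

/-- The object `𝟙 ⊙ M` is presented by one generator `𝟙` for each `m : M`, subject to the relations
`[m + n] = [m] + [n]` and `[r • m] = r • [m]`. This morphism gives the left-hand sides. -/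
def scalarRelLeft (M : ModuleCat.{u} R) :
    (∐ fun _ : (M × M) ⊕ (R × M) => 𝟙_ C) ⟶ ∐ fun _ : M => 𝟙_ C :=
  Sigma.desc (Sum.elim (fun p => Sigma.ι (fun _ : M => 𝟙_ C) (p.1 + p.2))
    (fun p => Sigma.ι (fun _ : M => 𝟙_ C) (p.1 • p.2)))

/-- The right-hand sides of the relations presenting `𝟙 ⊙ M`. -/
def scalarRelRight (M : ModuleCat.{u} R) :
    (∐ fun _ : (M × M) ⊕ (R × M) => 𝟙_ C) ⟶ ∐ fun _ : M => 𝟙_ C :=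
  Sigma.desc (Sum.elim
    (fun p => Sigma.ι (fun _ : M => 𝟙_ C) p.1 + Sigma.ι (fun _ : M => 𝟙_ C) p.2)
    (fun p => p.1 • Sigma.ι (fun _ : M => 𝟙_ C) p.2))

/-- The external tensor product `𝟙 ⊙ M` of the unit object with the `R`-module `M`. -/
def scalarObj (M : ModuleCat.{u} R) : C :=
  coequalizer (scalarRelLeft R C M) (scalarRelRight R C M)

/-- The morphism `𝟙 ⟶ 𝟙 ⊙ M` given by an element of `M`. -/
def scalarObjEl (M : ModuleCat.{u} R) : M →ₗ[R] (𝟙_ C ⟶ scalarObj R C M) where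
  toFun m := Sigma.ι (fun _ : M => 𝟙_ C) m ≫ coequalizer.π _ _
  map_add' m n := by
    have := Sigma.ι (fun _ : (M × M) ⊕ (R × M) => 𝟙_ C) (Sum.inl (m, n)) ≫=
      coequalizer.condition (scalarRelLeft R C M) (scalarRelRight R C M)
    simp only [scalarRelLeft, scalarRelRight, colimit.ι_desc_assoc, Cofan.mk_ι_app,
      Sum.elim_inl, Preadditive.add_comp] at this
    exact this
  map_smul' r m := by
    have := Sigma.ι (fun _ : (M × M) ⊕ (R × M) => 𝟙_ C) (Sum.inr (r, m)) ≫=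
      coequalizer.condition (scalarRelLeft R C M) (scalarRelRight R C M)
    simp only [scalarRelLeft, scalarRelRight, colimit.ι_desc_assoc, Cofan.mk_ι_app,
      Sum.elim_inr, Linear.smul_comp] at this
    exact this

/-- The morphism `𝟙 ⊙ M ⟶ X` given by a linear map `M → Hom(𝟙, X)`. -/
def scalarObjDesc {M : ModuleCat.{u} R} {X : C} (φ : M →ₗ[R] (𝟙_ C ⟶ X)) :
    scalarObj R C M ⟶ X :=
  coequalizer.desc (Sigma.desc fun m : M => φ m) (by
    apply Sigma.hom_ext
    rintro (⟨m, n⟩ | ⟨r, m⟩) <;>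
      simp [scalarRelLeft, scalarRelRight, Preadditive.add_comp, Linear.smul_comp])

lemma scalarObjEl_desc {M : ModuleCat.{u} R} {X : C} (φ : M →ₗ[R] (𝟙_ C ⟶ X)) (m : M) :
    scalarObjEl R C M m ≫ scalarObjDesc R C φ = φ m := by
  change (Sigma.ι (fun _ : M => 𝟙_ C) m ≫ coequalizer.π _ _) ≫ _ = _
  simp [scalarObjDesc, Category.assoc]

lemma scalarObj_ext {M : ModuleCat.{u} R} {X : C} {f g : scalarObj R C M ⟶ X}
    (h : ∀ m : M, scalarObjEl R C M m ≫ f = scalarObjEl R C M m ≫ g) : f = g := by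
  apply coequalizer.hom_ext
  apply Sigma.hom_ext
  intro m
  have : (Sigma.ι (fun _ : M => 𝟙_ C) m ≫ coequalizer.π _ _) ≫ f =
    (Sigma.ι (fun _ : M => 𝟙_ C) m ≫ coequalizer.π _ _) ≫ g := h m
  exact (Category.assoc _ _ _).symm.trans (this.trans (Category.assoc _ _ _))

/-- The functor `M ↦ 𝟙 ⊙ M` from `R`-modules to `C`. In a tensor category the external tensor
product `Y ⊙ M`, characterized by `Hom(Y ⊙ M, X) ≅ Hom_R(M, Hom(Y, X))`, is `Y ⊗ (𝟙 ⊙ M)`;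
see `externalHomEquiv`. -/
def scalar : ModuleCat.{u} R ⥤ C where
  obj M := scalarObj R C M
  map {_ N} f := scalarObjDesc R C (scalarObjEl R C N ∘ₗ f.hom)
  map_id M := scalarObj_ext R C fun m => by rw [scalarObjEl_desc]; simp
  map_comp f g := scalarObj_ext R C fun m => by
    rw [← Category.assoc]
    simp only [scalarObjEl_desc, LinearMap.comp_apply, ModuleCat.hom_comp]

variable {R}

/-- The morphism `𝟙 ⟶ 𝟙 ⊙ M` given by an element of `M`. -/
def el {M : ModuleCat.{u} R} : M →ₗ[R] (𝟙_ C ⟶ (scalar R C).obj M) := scalarObjEl R C M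

variable {C}

lemma scalar_ext {M : ModuleCat.{u} R} {X : C} {f g : (scalar R C).obj M ⟶ X}
    (h : ∀ m : M, el C m ≫ f = el C m ≫ g) : f = g := scalarObj_ext R C h

/-- The universal property of `𝟙 ⊙ M`. -/
def scalarDesc {M : ModuleCat.{u} R} {X : C} (φ : M →ₗ[R] (𝟙_ C ⟶ X)) :
    (scalar R C).obj M ⟶ X := scalarObjDesc R C φ

@[simp]
lemma el_scalarDesc {M : ModuleCat.{u} R} {X : C} (φ : M →ₗ[R] (𝟙_ C ⟶ X)) (m : M) :
    el C m ≫ scalarDesc φ = φ m := scalarObjEl_desc R C φ m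

@[simp]
lemma el_scalarDesc_assoc {M : ModuleCat.{u} R} {X : C} (φ : M →ₗ[R] (𝟙_ C ⟶ X)) (m : M) {Z : C} (k : X ⟶ Z) :
    el C m ≫ scalarDesc φ ≫ k = φ m ≫ k := by
  rw [← Category.assoc, el_scalarDesc]

@[simp]
lemma el_scalar_map {M N : ModuleCat.{u} R} (f : M ⟶ N) (m : M) :
    el C m ≫ (scalar R C).map f = el C (f.hom m) := scalarObjEl_desc R C _ m

@[simp]
lemma el_scalar_map_assoc {M N : ModuleCat.{u} R} (f : M ⟶ N) (m : M) {Z : C} (k : (scalar R C).obj N ⟶ Z) :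
    el C m ≫ (scalar R C).map f ≫ k = el C (f.hom m) ≫ k := by
  rw [← Category.assoc, el_scalar_map]

variable [MonoidalPreadditive C] [MonoidalLinear R C] [MonoidalClosed C]

variable (R) in
/-- `Hom(𝟙, [Y, X]) ≅ Hom(Y, X)`, linearly. -/
def uncurryLinear (Y X : C) : (𝟙_ C ⟶ (ihom Y).obj X) ≃ₗ[R] (Y ⟶ X) where
  toFun g := (ρ_ Y).inv ≫ MonoidalClosed.uncurry g
  invFun f := MonoidalClosed.curry ((ρ_ Y).hom ≫ f)
  map_add' f g := by simp [MonoidalClosed.uncurry_eq, Preadditive.add_comp, Preadditive.comp_add]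
  map_smul' r f := by simp [MonoidalClosed.uncurry_eq, Linear.smul_comp, Linear.comp_smul]
  left_inv g := by simp
  right_inv f := by simp

/-- The morphism `Y ⊗ (𝟙 ⊙ M) ⟶ X` given by a linear map `M → Hom(Y, X)`. -/
def externalDesc {M : ModuleCat.{u} R} {Y X : C} (φ : M →ₗ[R] (Y ⟶ X)) :
    Y ⊗ (scalar R C).obj M ⟶ X :=
  MonoidalClosed.uncurry (scalarDesc ((uncurryLinear R Y X).symm.toLinearMap ∘ₗ φ))

@[simp]
lemma el_externalDesc {M : ModuleCat.{u} R} {Y X : C} (φ : M →ₗ[R] (Y ⟶ X)) (m : M) :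
    Y ◁ el C m ≫ externalDesc φ = (ρ_ Y).hom ≫ φ m := by
  rw [externalDesc, ← MonoidalClosed.uncurry_natural_left, el_scalarDesc]
  simp [uncurryLinear]

@[simp]
lemma el_externalDesc_assoc {M : ModuleCat.{u} R} {Y X : C} (φ : M →ₗ[R] (Y ⟶ X)) (m : M) {Z : C} (k : X ⟶ Z) :
    Y ◁ el C m ≫ externalDesc φ ≫ k = (ρ_ Y).hom ≫ φ m ≫ k := by
  rw [← Category.assoc, el_externalDesc]; simp only [Category.assoc]

lemma external_ext {M : ModuleCat.{u} R} {Y X : C} {f g : Y ⊗ (scalar R C).obj M ⟶ X}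
    (h : ∀ m : M, Y ◁ el C m ≫ f = Y ◁ el C m ≫ g) : f = g := by
  apply MonoidalClosed.curry_injective
  apply scalar_ext
  intro m
  rw [← MonoidalClosed.curry_natural_left, ← MonoidalClosed.curry_natural_left, h]

/-- `Y ⊗ (𝟙 ⊙ M)` has the universal property of the external tensor product `Y ⊙ M`. -/
def externalHomEquiv (M : ModuleCat.{u} R) (Y X : C) :
    (Y ⊗ (scalar R C).obj M ⟶ X) ≃ₗ[R] (M →ₗ[R] (Y ⟶ X)) where
  toFun f :=
    { toFun := fun m => (ρ_ Y).inv ≫ Y ◁ el C m ≫ f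
      map_add' := by simp [Preadditive.add_comp, Preadditive.comp_add]
      map_smul' := by simp [Linear.smul_comp, Linear.comp_smul] }
  map_add' f g := by ext; simp [Preadditive.add_comp, Preadditive.comp_add]
  map_smul' r f := by ext; simp [Linear.smul_comp, Linear.comp_smul]
  invFun φ := externalDesc φ
  left_inv f := external_ext fun m => by simp
  right_inv φ := by ext m; simp

variable [SymmetricCategory C]

lemma external_ext' {M : ModuleCat.{u} R} {Y X : C} {f g : (scalar R C).obj M ⊗ Y ⟶ X}
    (h : ∀ m : M, el C m ▷ Y ≫ f = el C m ▷ Y ≫ g) : f = g := by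
  rw [← cancel_epi (β_ _ _).hom]
  apply external_ext
  intro m
  simp [h m]

/-- `(𝟙 ⊙ M) ⊗ (𝟙 ⊙ N) ⟶ 𝟙 ⊙ (M ⊗ N)`, the morphism with `[m] ⊗ [n] ↦ [m ⊗ n]`. -/
def scalarMu (M N : ModuleCat.{u} R) :
    (scalar R C).obj M ⊗ (scalar R C).obj N ⟶ (scalar R C).obj (M ⊗ N) :=
  externalDesc
    { toFun := fun n => (scalar R C).map (ModuleCat.ofHom ((TensorProduct.mk R M N).flip n))
      map_add' := fun n n' => scalar_ext fun m => by
        simp only [el_scalar_map, ModuleCat.hom_ofHom, Preadditive.comp_add, map_add,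
          LinearMap.add_apply]
      map_smul' := fun r n => scalar_ext fun m => by
        simp only [el_scalar_map, ModuleCat.hom_ofHom, Linear.comp_smul, map_smul,
          LinearMap.smul_apply, RingHom.id_apply] }

@[simp]
lemma el_scalarMu {M N : ModuleCat.{u} R} (m : M) (n : N) :
    (el C m ⊗ₘ el C n) ≫ scalarMu M N = (λ_ (𝟙_ C)).hom ≫ el C (M := M ⊗ N) (m ⊗ₜ[R] n) := by
  rw [MonoidalCategory.tensorHom_def, Category.assoc, scalarMu, el_externalDesc]
  simp [unitors_equal]

@[simp]
lemma el_scalarMu_assoc {M N : ModuleCat.{u} R} (m : M) (n : N) {Z : C} (k : (scalar R C).obj (M ⊗ N) ⟶ Z) :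
    (el C m ⊗ₘ el C n) ≫ scalarMu M N ≫ k = (λ_ (𝟙_ C)).hom ≫ el C (M := M ⊗ N) (m ⊗ₜ[R] n) ≫ k := by
  rw [← Category.assoc, el_scalarMu]; simp only [Category.assoc]

lemma scalarTensor_ext {M N : ModuleCat.{u} R} {X : C}
    {f g : (scalar R C).obj M ⊗ (scalar R C).obj N ⟶ X}
    (h : ∀ (m : M) (n : N), (el C m ⊗ₘ el C n) ≫ f = (el C m ⊗ₘ el C n) ≫ g) : f = g :=
  external_ext fun n => by
    rw [← cancel_epi (ρ_ _).inv]
    refine scalar_ext fun m => ?_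
    have := (ρ_ (𝟙_ C)).inv ≫= h m n
    simpa only [MonoidalCategory.tensorHom_def, Category.assoc,
      ← rightUnitor_inv_naturality_assoc] using this

lemma scalarTensor_ext₃ {M N P : ModuleCat.{u} R} {X : C}
    {f g : ((scalar R C).obj M ⊗ (scalar R C).obj N) ⊗ (scalar R C).obj P ⟶ X}
    (h : ∀ (m : M) (n : N) (p : P),
      ((el C m ⊗ₘ el C n) ⊗ₘ el C p) ≫ f = ((el C m ⊗ₘ el C n) ⊗ₘ el C p) ≫ g) : f = g :=
  external_ext fun p => by
    rw [← cancel_epi (ρ_ _).inv]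
    refine scalarTensor_ext fun m n => ?_
    have := (ρ_ (𝟙_ C ⊗ 𝟙_ C)).inv ≫= h m n p
    simpa only [MonoidalCategory.tensorHom_def (el C m ⊗ₘ el C n), Category.assoc,
      ← rightUnitor_inv_naturality_assoc] using this

/-- `𝟙 ⊙ (M ⊗ N) ⟶ (𝟙 ⊙ M) ⊗ (𝟙 ⊙ N)`, the morphism with `[m ⊗ n] ↦ [m] ⊗ [n]`. -/
def scalarDelta (M N : ModuleCat.{u} R) :
    (scalar R C).obj (M ⊗ N) ⟶ (scalar R C).obj M ⊗ (scalar R C).obj N :=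
  scalarDesc (TensorProduct.lift
    (LinearMap.mk₂ R (fun m n => (λ_ (𝟙_ C)).inv ≫ (el C m ⊗ₘ el C n))
      (by simp [MonoidalCategory.tensorHom_def, Preadditive.add_comp, Preadditive.comp_add])
      (by simp [MonoidalCategory.tensorHom_def, Linear.smul_comp, Linear.comp_smul])
      (by simp [MonoidalCategory.tensorHom_def, Preadditive.add_comp, Preadditive.comp_add])
      (by simp [MonoidalCategory.tensorHom_def, Linear.smul_comp, Linear.comp_smul])))

@[simp]
lemma el_scalarDelta {M N : ModuleCat.{u} R} (m : M) (n : N) :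
    el C (M := M ⊗ N) (m ⊗ₜ[R] n) ≫ scalarDelta M N =
      (λ_ (𝟙_ C)).inv ≫ (el C m ⊗ₘ el C n) := by
  rw [scalarDelta, el_scalarDesc]
  rfl

@[simp]
lemma el_scalarDelta_assoc {M N : ModuleCat.{u} R} (m : M) (n : N) {Z : C} (k : (scalar R C).obj M ⊗ (scalar R C).obj N ⟶ Z) :
    el C (M := M ⊗ N) (m ⊗ₜ[R] n) ≫ scalarDelta M N ≫ k = (λ_ (𝟙_ C)).inv ≫ (el C m ⊗ₘ el C n) ≫ k := by
  rw [← Category.assoc, el_scalarDelta]; simp only [Category.assoc]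

lemma scalar_tensor_ext {M N : ModuleCat.{u} R} {X : C} {f g : (scalar R C).obj (M ⊗ N) ⟶ X}
    (h : ∀ (m : M) (n : N), el C (M := M ⊗ N) (m ⊗ₜ[R] n) ≫ f =
      el C (M := M ⊗ N) (m ⊗ₜ[R] n) ≫ g) : f = g := by
  have : Linear.rightComp R _ f ∘ₗ el C = Linear.rightComp R _ g ∘ₗ el C :=
    TensorProduct.ext' h
  exact scalar_ext fun t => LinearMap.congr_fun this t

/-- The tensorator of `M ↦ 𝟙 ⊙ M`. -/
def scalarMuIso (M N : ModuleCat.{u} R) :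
    (scalar R C).obj M ⊗ (scalar R C).obj N ≅ (scalar R C).obj (M ⊗ N) where
  hom := scalarMu M N
  inv := scalarDelta M N
  hom_inv_id := scalarTensor_ext fun m n => by simp
  inv_hom_id := scalar_tensor_ext fun m n => by simp

variable (R C) in
/-- The unit isomorphism `𝟙 ≅ 𝟙 ⊙ R`. -/
def scalarEpsIso : 𝟙_ C ≅ (scalar R C).obj (𝟙_ (ModuleCat.{u} R)) where
  hom := el C (M := 𝟙_ (ModuleCat.{u} R)) (1 : R)
  inv := scalarDesc (LinearMap.toSpanSingleton R (𝟙_ C ⟶ 𝟙_ C) (𝟙 _))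
  hom_inv_id := by
    rw [el_scalarDesc]
    exact LinearMap.toSpanSingleton_apply_one ..
  inv_hom_id := scalar_ext fun r => by
    rw [el_scalarDesc_assoc]
    have : (LinearMap.toSpanSingleton R (𝟙_ C ⟶ 𝟙_ C) (𝟙 _)) r = (show R from r) • 𝟙 _ := rfl
    rw [this, Linear.smul_comp, Category.id_comp, Category.comp_id, ← map_smul]
    congr 1
    exact mul_one (show R from r)

variable (R C) in
/-- The functor `M ↦ 𝟙 ⊙ M` is strong monoidal. -/
def scalarCore : (scalar R C).CoreMonoidal where
  εIso := scalarEpsIso R C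
  μIso := scalarMuIso
  μIso_hom_natural_left {M M'} f N := scalarTensor_ext fun m n => by
    rw [scalarMuIso, scalarMuIso, tensorHom_comp_whiskerRight_assoc, el_scalar_map,
      el_scalarMu, el_scalarMu_assoc, el_scalar_map]
    rfl
  μIso_hom_natural_right {N N'} M f := scalarTensor_ext fun m n => by
    rw [scalarMuIso, scalarMuIso, tensorHom_comp_whiskerLeft_assoc, el_scalar_map,
      el_scalarMu, el_scalarMu_assoc, el_scalar_map]
    rfl
  associativity M N P := scalarTensor_ext₃ fun m n p => by
    simp only [scalarMuIso, tensorHom_comp_whiskerRight_assoc, associator_naturality_assoc,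
      tensorHom_comp_whiskerLeft_assoc, el_scalarMu]
    rw [← whiskerRight_comp_tensorHom_assoc, ← whiskerLeft_comp_tensorHom_assoc,
      el_scalarMu, el_scalarMu_assoc, el_scalar_map]
    have : (λ_ (𝟙_ C)).hom ▷ 𝟙_ C = (α_ (𝟙_ C) (𝟙_ C) (𝟙_ C)).hom ≫ 𝟙_ C ◁ (λ_ (𝟙_ C)).hom := by
      rw [MonoidalCategory.triangle, unitors_equal]
    rw [this, Category.assoc]
    rfl
  left_unitality M := external_ext fun m => by
    rw [← cancel_epi (λ_ (𝟙_ C)).inv, scalarMuIso, scalarEpsIso]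
    simp only [← MonoidalCategory.tensorHom_def'_assoc, ← MonoidalCategory.tensorHom_def_assoc]
    rw [el_scalarMu_assoc, el_scalar_map, leftUnitor_naturality]
    simp
  right_unitality M := external_ext' fun m => by
    rw [← cancel_epi (λ_ (𝟙_ C)).inv, scalarMuIso, scalarEpsIso]
    rw [← MonoidalCategory.tensorHom_def_assoc]
    rw [el_scalarMu_assoc, el_scalar_map, rightUnitor_naturality]
    simp [unitors_equal]

end External

noncomputable section Comodules

variable (R H : Type u) [CommRing R] [CommRing H] [HopfAlgebra R H]

/-- A comodule over `H`: an `R`-module with a counital and coassociative coaction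
`X → H ⊗ X`. -/
structure Comod where
  X : ModuleCat.{u} R
  coact : X →ₗ[R] H ⊗[R] X
  counit_coact : TensorProduct.lid R X ∘ₗ (Coalgebra.counit (R := R) (A := H)).rTensor X ∘ₗ coact
    = LinearMap.id
  coassoc : TensorProduct.assoc R H H X ∘ₗ (Coalgebra.comul (R := R) (A := H)).rTensor X ∘ₗ coact
    = coact.lTensor H ∘ₗ coact

namespace Comod
variable {R H}

/-- Morphisms of comodules. -/
@[ext]
structure Hom (M N : Comod R H) where
  hom : M.X →ₗ[R] N.X
  comm : N.coact ∘ₗ hom = hom.lTensor H ∘ₗ M.coact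

instance : Category (Comod R H) where
  Hom := Hom
  id M := ⟨LinearMap.id, by simp⟩
  comp f g := ⟨g.hom ∘ₗ f.hom, by
    rw [← LinearMap.comp_assoc, g.comm, LinearMap.comp_assoc, f.comm, ← LinearMap.comp_assoc,
      ← LinearMap.lTensor_comp]⟩

@[ext]
lemma hom_ext {M N : Comod R H} {f g : M ⟶ N} (h : f.hom = g.hom) : f = g := Hom.ext h

@[simp] lemma id_hom (M : Comod R H) : Hom.hom (𝟙 M) = LinearMap.id := rfl
@[simp] lemma comp_hom {M N P : Comod R H} (f : M ⟶ N) (g : N ⟶ P) :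
    Hom.hom (f ≫ g) = g.hom ∘ₗ f.hom := rfl

/-- The comodule morphisms form a submodule of the linear maps. -/
def homSubmodule (M N : Comod R H) : Submodule R (M.X →ₗ[R] N.X) where
  carrier := {f | N.coact ∘ₗ f = f.lTensor H ∘ₗ M.coact}
  zero_mem' := by simp
  add_mem' {f g} hf hg := by
    change _ = _ at hf hg; change _ = _
    rw [LinearMap.comp_add, hf, hg, LinearMap.lTensor_add, LinearMap.add_comp]
  smul_mem' r f hf := by
    change _ = _ at hf; change _ = _
    rw [LinearMap.comp_smul, hf, LinearMap.lTensor_smul, LinearMap.smul_comp]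

/-- Comodule morphisms as elements of `homSubmodule`. -/
def homEquiv (M N : Comod R H) : (M ⟶ N) ≃ homSubmodule M N where
  toFun f := ⟨f.hom, f.comm⟩
  invFun f := ⟨f.1, f.2⟩
  left_inv _ := rfl
  right_inv _ := rfl

instance (M N : Comod R H) : AddCommGroup (M ⟶ N) := (homEquiv M N).addCommGroup
instance (M N : Comod R H) : Module R (M ⟶ N) := (homEquiv M N).module R

@[simp] lemma add_hom {M N : Comod R H} (f g : M ⟶ N) : (f + g).hom = f.hom + g.hom := rfl
@[simp] lemma smul_hom {M N : Comod R H} (r : R) (f : M ⟶ N) : (r • f).hom = r • f.hom := rfl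

instance : Preadditive (Comod R H) where
  add_comp _ _ _ f f' g := by ext1; simp [LinearMap.comp_add]
  comp_add _ _ _ f g g' := by ext1; simp [LinearMap.add_comp]

instance : Linear R (Comod R H) where
  smul_comp _ _ _ r f g := by ext1; simp [LinearMap.comp_smul]
  comp_smul _ _ _ f r g := by ext1; simp [LinearMap.smul_comp]

/-- The forgetful functor from comodules to modules. -/
def forget : Comod R H ⥤ ModuleCat.{u} R where
  obj M := M.X
  map f := ModuleCat.ofHom f.hom

instance : (forget (R := R) (H := H)).Faithful where
  map_injective h := hom_ext (ModuleCat.hom_ext_iff.mp h)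

/-- `(h ⊗ m) ⊗ (k ⊗ n) ↦ h k ⊗ (m ⊗ n)` -/
def mulMiddle (A : Type u) [CommRing A] [Algebra R A] (M N : Type u) [AddCommGroup M] [Module R M]
    [AddCommGroup N] [Module R N] :
    (A ⊗[R] M) ⊗[R] (A ⊗[R] N) →ₗ[R] A ⊗[R] (M ⊗[R] N) :=
  (LinearMap.mul' R A).rTensor (M ⊗[R] N) ∘ₗ
    (TensorProduct.tensorTensorTensorComm R A M A N).toLinearMap

@[simp] lemma mulMiddle_tmul (A : Type u) [CommRing A] [Algebra R A] (M N : Type u)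
    [AddCommGroup M] [Module R M] [AddCommGroup N] [Module R N] (h k : A) (m : M) (n : N) :
    mulMiddle (R := R) A M N ((h ⊗ₜ m) ⊗ₜ (k ⊗ₜ n)) = (h * k) ⊗ₜ (m ⊗ₜ n) := rfl

/-- The coaction `m ⊗ n ↦ m₍₋₁₎ n₍₋₁₎ ⊗ (m₍₀₎ ⊗ n₍₀₎)` on a tensor product. -/
def tensorCoact (M N : Comod R H) : M.X ⊗[R] N.X →ₗ[R] H ⊗[R] (M.X ⊗[R] N.X) :=
  mulMiddle H M.X N.X ∘ₗ TensorProduct.map M.coact N.coact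

@[simp] lemma tensorCoact_tmul (M N : Comod R H) (m : M.X) (n : N.X) :
   tensorCoact M N (m ⊗ₜ n) = mulMiddle H M.X N.X (M.coact m ⊗ₜ N.coact n) := rfl

lemma mulMiddle_counit (M N : Type u) [AddCommGroup M] [Module R M] [AddCommGroup N] [Module R N] :
    (TensorProduct.lid R (M ⊗[R] N)).toLinearMap ∘ₗ
      (Coalgebra.counit (R := R) (A := H)).rTensor _ ∘ₗ mulMiddle H M N =
    TensorProduct.map
      ((TensorProduct.lid R M).toLinearMap ∘ₗ (Coalgebra.counit (R := R) (A := H)).rTensor M)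
      ((TensorProduct.lid R N).toLinearMap ∘ₗ (Coalgebra.counit (R := R) (A := H)).rTensor N) := by
  ext h m k n
  simp [TensorProduct.smul_tmul', TensorProduct.tmul_smul, mul_smul]
  rw [smul_comm]

lemma mulMiddle_comul (M N : Type u) [AddCommGroup M] [Module R M] [AddCommGroup N] [Module R N] :
    (Coalgebra.comul (R := R) (A := H)).rTensor _ ∘ₗ mulMiddle H M N =
    mulMiddle (H ⊗[R] H) M N ∘ₗ
      TensorProduct.map ((Coalgebra.comul (R := R) (A := H)).rTensor M)
        ((Coalgebra.comul (R := R) (A := H)).rTensor N) := by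
  ext h m k n
  simp

lemma mulMiddle_assoc (M N : Type u) [AddCommGroup M] [Module R M] [AddCommGroup N] [Module R N] :
    (TensorProduct.assoc R H H (M ⊗[R] N)).toLinearMap ∘ₗ mulMiddle (H ⊗[R] H) M N =
    (mulMiddle H M N).lTensor H ∘ₗ mulMiddle H (H ⊗[R] M) (H ⊗[R] N) ∘ₗ
      TensorProduct.map (TensorProduct.assoc R H H M).toLinearMap
        (TensorProduct.assoc R H H N).toLinearMap := by
  ext h h' m k k' n
  simp

lemma mulMiddle_natural {M N M' N' : Type u} [AddCommGroup M] [Module R M] [AddCommGroup N]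
    [Module R N] [AddCommGroup M'] [Module R M'] [AddCommGroup N'] [Module R N']
    (f : M →ₗ[R] M') (g : N →ₗ[R] N') :
    (TensorProduct.map f g).lTensor H ∘ₗ mulMiddle H M N =
      mulMiddle H M' N' ∘ₗ TensorProduct.map (f.lTensor H) (g.lTensor H) := by
  ext h m k n
  simp

/-- The tensor product of comodules. -/
def tensor (M N : Comod R H) : Comod R H where
  X := M.X ⊗ N.X
  coact := tensorCoact M N
  counit_coact := by
    have h := mulMiddle_counit (R := R) (H := H) M.X N.X
    refine (congrArg (· ∘ₗ TensorProduct.map M.coact N.coact) h).trans ?_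
    rw [← TensorProduct.map_comp, LinearMap.comp_assoc, LinearMap.comp_assoc, M.counit_coact,
      N.counit_coact]
    exact TensorProduct.map_id
  coassoc := by
    have h1 := mulMiddle_comul (R := R) (H := H) M.X N.X
    have h2 := mulMiddle_assoc (R := R) (H := H) M.X N.X
    have h3 := mulMiddle_natural (H := H) M.coact N.coact
    change (TensorProduct.assoc R H H (M.X ⊗[R] N.X)).toLinearMap ∘ₗ
      ((Coalgebra.comul (R := R) (A := H)).rTensor _ ∘ₗ mulMiddle H M.X N.X) ∘ₗ
        TensorProduct.map M.coact N.coact =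
      (mulMiddle H M.X N.X ∘ₗ TensorProduct.map M.coact N.coact).lTensor H ∘ₗ
        mulMiddle H M.X N.X ∘ₗ TensorProduct.map M.coact N.coact
    rw [h1, LinearMap.comp_assoc, ← LinearMap.comp_assoc _ _ (TensorProduct.assoc ..).toLinearMap,
      h2, LinearMap.lTensor_comp, LinearMap.comp_assoc, LinearMap.comp_assoc,
      LinearMap.comp_assoc, ← LinearMap.comp_assoc _ (mulMiddle H M.X N.X), h3,
      LinearMap.comp_assoc]
    simp only [← TensorProduct.map_comp]
    rw [M.coassoc, N.coassoc]

/-- The trivial comodule `m ↦ 1 ⊗ m` on a module. -/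
def trivialObj (M : ModuleCat.{u} R) : Comod R H where
  X := M
  coact := TensorProduct.mk R H M 1
  counit_coact := by ext; simp
  coassoc := by ext; simp [Algebra.TensorProduct.one_def]

/-- The trivial comodule functor. In comodules, `𝟙 ⊙ M` is the trivial comodule on `M`;
see `trivialDesc` and `trivial_ext`. -/
def trivial : ModuleCat.{u} R ⥤ Comod R H where
  obj := trivialObj
  map f := ⟨f.hom, rfl⟩

/-- A colinear linear equivalence is an isomorphism of comodules. -/
def mkIso {M N : Comod R H} (e : M.X ≃ₗ[R] N.X)
    (h : N.coact ∘ₗ e.toLinearMap = e.toLinearMap.lTensor H ∘ₗ M.coact) : M ≅ N where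
  hom := ⟨e, h⟩
  inv := ⟨e.symm, by
    have h1 : e.symm.toLinearMap.lTensor H ∘ₗ e.toLinearMap.lTensor H = LinearMap.id := by
      rw [← LinearMap.lTensor_comp]; simp
    have h2 : e.toLinearMap ∘ₗ e.symm.toLinearMap = LinearMap.id := by simp
    calc M.coact ∘ₗ e.symm.toLinearMap
        = e.symm.toLinearMap.lTensor H ∘ₗ (e.toLinearMap.lTensor H ∘ₗ M.coact) ∘ₗ
          e.symm.toLinearMap := by
          simp only [← LinearMap.comp_assoc]; rw [h1, LinearMap.id_comp]
      _ = _ := by rw [← h, LinearMap.comp_assoc, h2, LinearMap.comp_id]⟩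
  hom_inv_id := by ext1; simp
  inv_hom_id := by ext1; simp

lemma assoc_comm (M N P : Comod R H) :
    (M.tensor (N.tensor P)).coact ∘ₗ (TensorProduct.assoc R M.X N.X P.X).toLinearMap =
      (TensorProduct.assoc R M.X N.X P.X).toLinearMap.lTensor H ∘ₗ
        ((M.tensor N).tensor P).coact := by
  have h : mulMiddle (R := R) H M.X (N.X ⊗[R] P.X) ∘ₗ (mulMiddle H N.X P.X).lTensor _ ∘ₗ
      (TensorProduct.assoc R (H ⊗[R] M.X) (H ⊗[R] N.X) (H ⊗[R] P.X)).toLinearMap =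
      (TensorProduct.assoc R M.X N.X P.X).toLinearMap.lTensor H ∘ₗ
        mulMiddle H (M.X ⊗[R] N.X) P.X ∘ₗ (mulMiddle H M.X N.X).rTensor _ := by
    ext h m k n l p
    simp [mul_assoc]
  refine TensorProduct.ext_threefold fun m n p => ?_
  exact LinearMap.congr_fun h ((M.coact m ⊗ₜ N.coact n) ⊗ₜ P.coact p)

lemma lid_comm (M : Comod R H) :
    M.coact ∘ₗ (TensorProduct.lid R M.X).toLinearMap =
      (TensorProduct.lid R M.X).toLinearMap.lTensor H ∘ₗ
        ((trivialObj (𝟙_ (ModuleCat.{u} R))).tensor M).coact := by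
  have h : (TensorProduct.lid R M.X).toLinearMap.lTensor H ∘ₗ
      mulMiddle (R := R) H R M.X ∘ₗ (TensorProduct.mk R H R 1).rTensor _ =
      (TensorProduct.lid R (H ⊗[R] M.X)).toLinearMap := by
    ext h m
    simp
  refine TensorProduct.ext' fun r m => ?_
  exact (M.coact.map_smul r m).trans (LinearMap.congr_fun h (r ⊗ₜ M.coact m)).symm

lemma rid_comm (M : Comod R H) :
    M.coact ∘ₗ (TensorProduct.rid R M.X).toLinearMap =
      (TensorProduct.rid R M.X).toLinearMap.lTensor H ∘ₗ
        (M.tensor (trivialObj (𝟙_ (ModuleCat.{u} R)))).coact := by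
  have h : (TensorProduct.rid R M.X).toLinearMap.lTensor H ∘ₗ
      mulMiddle (R := R) H M.X R ∘ₗ (TensorProduct.mk R H R 1).lTensor _ =
      (TensorProduct.rid R (H ⊗[R] M.X)).toLinearMap := by
    ext h m
    simp
  refine TensorProduct.ext' fun m r => ?_
  exact (M.coact.map_smul r m).trans (LinearMap.congr_fun h (M.coact m ⊗ₜ r)).symm

lemma comm_comm (M N : Comod R H) :
    (N.tensor M).coact ∘ₗ (TensorProduct.comm R M.X N.X).toLinearMap =
      (TensorProduct.comm R M.X N.X).toLinearMap.lTensor H ∘ₗ (M.tensor N).coact := by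
  have h : (TensorProduct.comm R M.X N.X).toLinearMap.lTensor H ∘ₗ mulMiddle (R := R) H M.X N.X =
      mulMiddle (R := R) H N.X M.X ∘ₗ
        (TensorProduct.comm R (H ⊗[R] M.X) (H ⊗[R] N.X)).toLinearMap := by
    ext h m k n
    simp [mul_comm]
  refine TensorProduct.ext' fun m n => ?_
  exact (LinearMap.congr_fun h (M.coact m ⊗ₜ N.coact n)).symm

lemma map_comm {M N M' N' : Comod R H} (f : M ⟶ M') (g : N ⟶ N') :
    (M'.tensor N').coact ∘ₗ TensorProduct.map f.hom g.hom =
      (TensorProduct.map f.hom g.hom).lTensor H ∘ₗ (M.tensor N).coact := by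
  have h := mulMiddle_natural (H := H) f.hom g.hom
  change (mulMiddle H M'.X N'.X ∘ₗ TensorProduct.map M'.coact N'.coact) ∘ₗ
    TensorProduct.map f.hom g.hom = _ ∘ₗ mulMiddle H M.X N.X ∘ₗ
      TensorProduct.map M.coact N.coact
  rw [← LinearMap.comp_assoc, h, LinearMap.comp_assoc, LinearMap.comp_assoc,
    ← TensorProduct.map_comp, ← TensorProduct.map_comp, f.comm, g.comm]

instance : MonoidalCategoryStruct (Comod R H) where
  tensorObj := tensor
  tensorUnit := trivialObj (𝟙_ _)
  tensorHom f g := ⟨TensorProduct.map f.hom g.hom, map_comm f g⟩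
  whiskerLeft M _ _ f := ⟨f.hom.lTensor M.X, map_comm (𝟙 M) f⟩
  whiskerRight f M := ⟨f.hom.rTensor M.X, map_comm f (𝟙 M)⟩
  associator M N P := mkIso (TensorProduct.assoc R M.X N.X P.X) (assoc_comm M N P)
  leftUnitor M := mkIso (TensorProduct.lid R M.X) (lid_comm M)
  rightUnitor M := mkIso (TensorProduct.rid R M.X) (rid_comm M)

/-- The tensor product of comodules is the one of the underlying modules. -/
def inducing : Monoidal.InducingFunctorData (forget (R := R) (H := H)) where
  μIso _ _ := Iso.refl _
  εIso := Iso.refl _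
  whiskerLeft_eq _ _ _ _ := rfl
  whiskerRight_eq _ _ := rfl
  tensorHom_eq _ _ := rfl
  associator_eq M N P := by
    ext1
    exact TensorProduct.ext_threefold fun m n p => rfl
  leftUnitor_eq M := by
    ext1
    exact TensorProduct.ext' fun m n => rfl
  rightUnitor_eq M := by
    ext1
    exact TensorProduct.ext' fun m n => rfl

instance : MonoidalCategory (Comod R H) := Monoidal.induced forget inducing

instance : (forget (R := R) (H := H)).Monoidal := Monoidal.fromInducedMonoidal forget inducing

instance : BraidedCategory (Comod R H) :=
  BraidedCategory.ofFaithful forget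
    (fun M N => mkIso (TensorProduct.comm R M.X N.X) (comm_comm M N))
    (fun M N => by
      ext1
      exact TensorProduct.ext' fun m n => rfl)

instance : (forget (R := R) (H := H)).Braided where
  braided M N := by
      ext1
      exact TensorProduct.ext' fun m n => rfl

instance : SymmetricCategory (Comod R H) := SymmetricCategory.ofFaithful forget

instance : (forget (R := R) (H := H)).Additive where

instance : (forget (R := R) (H := H)).Linear R where

instance : MonoidalPreadditive (Comod R H) := monoidalPreadditive_of_faithful forget

instance : MonoidalLinear R (Comod R H) := MonoidalLinear.ofFaithful R forget

/-- The regular comodule `(H, δ)`. -/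
def regular : Comod R H where
  X := ModuleCat.of R H
  coact := Coalgebra.comul
  counit_coact := by
    rw [Coalgebra.rTensor_counit_comp_comul]
    ext; simp
  coassoc := by
    exact Coalgebra.coassoc

/-- The regular comodule is an algebra in comodules, with the multiplication of `H`. -/
instance : MonObj (regular (R := R) (H := H)) where
  one := ⟨Algebra.linearMap R H, by
    ext
    change Coalgebra.comul (R := R) (algebraMap R H 1) = 1 ⊗ₜ algebraMap R H 1
    simp [Algebra.TensorProduct.one_def]⟩
  mul := ⟨LinearMap.mul' R H, by
    have h : (LinearMap.mul' R H).lTensor H ∘ₗ mulMiddle (R := R) H H H =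
        LinearMap.mul' R (H ⊗[R] H) := by
      ext a b c d
      simp
    refine TensorProduct.ext' fun (a b : H) => ?_
    change Coalgebra.comul (R := R) (a * b) = _
    rw [Bialgebra.comul_mul]
    exact (LinearMap.congr_fun h
      (Coalgebra.comul (R := R) a ⊗ₜ Coalgebra.comul (R := R) b)).symm⟩
  one_mul := by
    ext1
    exact TensorProduct.ext' fun (r : R) (h : H) => (Algebra.smul_def r h).symm
  mul_one := by
    ext1
    refine TensorProduct.ext' fun (h : H) (r : R) => ?_
    change h * algebraMap R H r = r • h
    rw [Algebra.smul_def, _root_.mul_comm]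
  mul_assoc := by
    ext1
    exact TensorProduct.ext_threefold fun (m n p : H) => _root_.mul_assoc m n p

instance : IsCommMonObj (regular (R := R) (H := H)) where
  mul_comm := by
    ext1
    exact TensorProduct.ext' fun (m n : H) => _root_.mul_comm n m

/-- The comultiplication as a morphism of comodules `(H, δ) ⟶ (H, δ) ⊙ H`, where the coaction on the
target is the one of the first factor. -/
def regularCoaction : regular ⟶ (regular ⊗ trivial.obj (ModuleCat.of R H) : Comod R H) :=
  ⟨Coalgebra.comul (R := R) (A := H), by
    have h : mulMiddle (R := R) H H H ∘ₗ (TensorProduct.mk R H H 1).lTensor (H ⊗[R] H) =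
        (TensorProduct.assoc R H H H).toLinearMap := by
      ext a b c
      simp
    have h' : (regular ⊗ trivial.obj (ModuleCat.of R H) : Comod R H).coact =
        (TensorProduct.assoc R H H H).toLinearMap ∘ₗ
          (Coalgebra.comul (R := R) (A := H)).rTensor H := by
      refine TensorProduct.ext' fun a b => ?_
      exact LinearMap.congr_fun h (Coalgebra.comul (R := R) a ⊗ₜ b)
    rw [h']
    exact Coalgebra.coassoc (R := R) (A := H)⟩

end Comod
end Comodules

noncomputable section TensorFunctors

variable (R : Type u) [CommRing R]

/-- A tensor functor: an `R`-linear symmetric strong monoidal functor with a right adjoint. -/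
structure TensorFunctor (D : Type*) [Category* D] [Preadditive D] [Linear R D]
    [MonoidalCategory D] [SymmetricCategory D] (C : Type*) [Category* C] [Preadditive C]
    [Linear R C] [MonoidalCategory C] [SymmetricCategory C] where
  functor : D ⥤ C
  [braided : functor.Braided]
  [additive : functor.Additive]
  [linear : functor.Linear R]
  [isLeftAdjoint : functor.IsLeftAdjoint]

namespace TensorFunctor

attribute [instance] braided additive linear isLeftAdjoint

variable {R} {D : Type*} [Category* D] [Preadditive D] [Linear R D]
    [MonoidalCategory D] [SymmetricCategory D] {C : Type*} [Category* C] [Preadditive C]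
    [Linear R C] [MonoidalCategory C] [SymmetricCategory C]

/-- Symmetric monoidal natural transformations. -/
@[ext]
structure Hom (F G : TensorFunctor R D C) where
  hom : F.functor ⟶ G.functor
  [isMonoidal : NatTrans.IsMonoidal hom]

attribute [instance] Hom.isMonoidal

instance : Category (TensorFunctor R D C) where
  Hom := Hom
  id F := ⟨𝟙 F.functor⟩
  comp f g := ⟨f.hom ≫ g.hom⟩

end TensorFunctor

section Comparison

variable {R} {H : Type u} [CommRing H] [HopfAlgebra R H]

/-- The morphism from the unit to a trivial comodule given by an element. -/
def trivialEl {M : ModuleCat.{u} R} :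
    M →ₗ[R] (𝟙_ (Comod R H) ⟶ Comod.trivial.obj M) where
  toFun m := ⟨LinearMap.toSpanSingleton R M m, by
    refine LinearMap.ext_ring ?_
    change (1 : H) ⊗ₜ[R] ((1 : R) • m) = (1 : H) ⊗ₜ[R] ((1 : R) • m)
    rfl⟩
  map_add' m n := by
    ext1
    refine LinearMap.ext_ring ?_
    change (1 : R) • (m + n) = (1 : R) • m + (1 : R) • n
    rw [smul_add]
  map_smul' r m := by
    ext1
    refine LinearMap.ext_ring ?_
    change (1 : R) • (r • m) = r • ((1 : R) • m)
    rw [smul_comm]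

lemma trivial_ext {M : ModuleCat.{u} R} {N : Comod R H} {f g : Comod.trivial.obj M ⟶ N}
    (h : ∀ m : M, trivialEl m ≫ f = trivialEl m ≫ g) : f = g := by
  ext1
  refine LinearMap.ext fun m => ?_
  have := LinearMap.congr_fun (congrArg Comod.Hom.hom (h m)) (1 : R)
  change f.hom ((1 : R) • m) = g.hom ((1 : R) • m) at this
  rwa [one_smul] at this

/-- The universal property of `𝟙 ⊙ M` in comodules, for the trivial comodule on `M`. -/
def trivialDesc {M : ModuleCat.{u} R} {N : Comod R H} (φ : M →ₗ[R] (𝟙_ (Comod R H) ⟶ N)) :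
    Comod.trivial.obj M ⟶ N :=
  ⟨{ toFun := fun m => (φ m).hom (1 : R)
     map_add' := fun m n => congrArg (fun f => Comod.Hom.hom f (1 : R)) (φ.map_add m n)
     map_smul' := fun r m => congrArg (fun f => Comod.Hom.hom f (1 : R)) (φ.map_smul r m) }, by
    refine LinearMap.ext fun m => ?_
    exact LinearMap.congr_fun (φ m).comm (1 : R)⟩

lemma trivialEl_desc {M : ModuleCat.{u} R} {N : Comod R H}
    (φ : M →ₗ[R] (𝟙_ (Comod R H) ⟶ N)) (m : M) :
    trivialEl m ≫ trivialDesc φ = φ m := by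
  ext1
  refine LinearMap.ext_ring ?_
  change (φ ((1 : R) • m)).hom (1 : R) = (φ m).hom (1 : R)
  rw [one_smul]

variable {C : Type w} [Category.{u} C] [Preadditive C] [Linear R C]
  [MonoidalCategory C] [SymmetricCategory C] [HasColimits C]

open Functor.LaxMonoidal Functor.OplaxMonoidal Functor.Monoidal

/-- The canonical morphism `𝟙 ⊙ M ⟶ F (𝟙 ⊙ M)`. -/
def comparison (F : TensorFunctor R (Comod R H) C) (M : ModuleCat.{u} R) :
    (scalar R C).obj M ⟶ F.functor.obj (Comod.trivial.obj M) :=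
  scalarDesc
    { toFun := fun m => ε F.functor ≫ F.functor.map (trivialEl m)
      map_add' := fun m n => by rw [map_add, F.functor.map_add, Preadditive.comp_add]
      map_smul' := fun r m => by rw [map_smul, F.functor.map_smul, Linear.comp_smul]; rfl }

@[simp]
lemma el_comparison (F : TensorFunctor R (Comod R H) C) (M : ModuleCat.{u} R) (m : M) :
    el C m ≫ comparison F M = ε F.functor ≫ F.functor.map (trivialEl m) :=
  el_scalarDesc _ _

@[simp]
lemma el_comparison_assoc (F : TensorFunctor R (Comod R H) C) (M : ModuleCat.{u} R) (m : M) {Z : C} (k : F.functor.obj (Comod.trivial.obj M) ⟶ Z) :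
    el C m ≫ comparison F M ≫ k = ε F.functor ≫ F.functor.map (trivialEl m) ≫ k := by
  rw [← Category.assoc, el_comparison]; simp only [Category.assoc]

lemma map_trivial_ext (F : TensorFunctor R (Comod R H) C) {M : ModuleCat.{u} R} {X : C}
    {f g : F.functor.obj (Comod.trivial.obj M) ⟶ X}
    (h : ∀ m : M, F.functor.map (trivialEl m) ≫ f = F.functor.map (trivialEl m) ≫ g) :
    f = g := by
  let adj := Adjunction.ofIsLeftAdjoint F.functor
  apply (adj.homEquiv _ _).injective
  apply trivial_ext
  intro m
  rw [← adj.homEquiv_naturality_left, ← adj.homEquiv_naturality_left, h]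

/-- The adjunction of a tensor functor is linear. -/
def adjLinearEquiv (F : TensorFunctor R (Comod R H) C) (N : Comod R H) (X : C) :
    (N ⟶ F.functor.rightAdjoint.obj X) ≃ₗ[R] (F.functor.obj N ⟶ X) where
  __ := ((Adjunction.ofIsLeftAdjoint F.functor).homEquiv N X).symm
  map_add' f g := by
    simp [Adjunction.homEquiv_counit, Preadditive.add_comp]
  map_smul' r f := by
    simp [Adjunction.homEquiv_counit, Linear.smul_comp]

/-- The inverse of `comparison`. -/
def comparisonInv (F : TensorFunctor R (Comod R H) C) (M : ModuleCat.{u} R) :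
    F.functor.obj (Comod.trivial.obj M) ⟶ (scalar R C).obj M :=
  adjLinearEquiv F _ _ (trivialDesc ((adjLinearEquiv F _ _).symm.toLinearMap ∘ₗ
    Linear.leftComp R _ (η F.functor) ∘ₗ el C))

lemma map_trivialEl_comparisonInv (F : TensorFunctor R (Comod R H) C) (M : ModuleCat.{u} R)
    (m : M) : F.functor.map (trivialEl m) ≫ comparisonInv F M = η F.functor ≫ el C m := by
  let adj := Adjunction.ofIsLeftAdjoint F.functor
  have h := adj.homEquiv_naturality_left_symm (trivialEl (H := H) m)
    (trivialDesc ((adjLinearEquiv F _ _).symm.toLinearMap ∘ₗ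
      Linear.leftComp R _ (η F.functor) ∘ₗ el C))
  rw [trivialEl_desc] at h
  refine h.symm.trans ?_
  exact (adjLinearEquiv F _ _).apply_symm_apply _

/-- Tensor functors preserve external tensor products: `𝟙 ⊙ M ≅ F (𝟙 ⊙ M)`. -/
def comparisonIso (F : TensorFunctor R (Comod R H) C) (M : ModuleCat.{u} R) :
    (scalar R C).obj M ≅ F.functor.obj (Comod.trivial.obj M) where
  hom := comparison F M
  inv := comparisonInv F M
  hom_inv_id := scalar_ext fun m => by
    rw [el_comparison_assoc, map_trivialEl_comparisonInv]
    simp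
  inv_hom_id := map_trivial_ext F fun m => by
    rw [← Category.assoc, map_trivialEl_comparisonInv, Category.assoc, el_comparison]
    simp

lemma comparison_naturality {F G : TensorFunctor R (Comod R H) C} (α : F ⟶ G)
    (M : ModuleCat.{u} R) :
    comparison F M ≫ α.hom.app _ = comparison G M := scalar_ext fun m => by
  rw [el_comparison_assoc, el_comparison, α.hom.naturality]
  have := α.isMonoidal.unit
  rw [← Category.assoc, this]

end Comparison

end TensorFunctors

noncomputable section Torsors

variable (R H : Type u) [CommRing R] [CommRing H] [HopfAlgebra R H]

/-- A (commutative) Adams Hopf algebra: it is flat, and its category of comodules is generated by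
the objects with duals. -/
structure IsAdamsHopfAlgebra : Prop where
  flat : Module.Flat R H
  generated : ObjectProperty.IsSeparating
    (fun M : Comod R H => ∃ N : Comod R H, Nonempty (ExactPairing M N))

variable (C : Type w) [Category.{u} C] [Preadditive C] [Linear R C]
  [MonoidalCategory C] [SymmetricCategory C] [HasColimits C]

/-- A commutative algebra `X` in `C` with a morphism `τ : X ⟶ X ⊙ H`, not subject to any axiom.
The axioms of an `H`-torsor are collected in `IsTorsor`. -/
structure CoactedAlgebra where
  X : C
  [mon : MonObj X]
  [comm : IsCommMonObj X]
  τ : X ⟶ X ⊗ (scalar R C).obj (ModuleCat.of R H)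

namespace CoactedAlgebra

attribute [instance] mon comm

variable {R H C}

/-- Morphisms of algebras that commute with `τ`. -/
@[ext]
structure Hom (A B : CoactedAlgebra R H C) where
  hom : A.X ⟶ B.X
  [isMonHom : IsMonHom hom]
  comm : A.τ ≫ hom ▷ (scalar R C).obj (ModuleCat.of R H) = hom ≫ B.τ

attribute [instance] Hom.isMonHom

instance : Category (CoactedAlgebra R H C) where
  Hom := Hom
  id A := { hom := 𝟙 A.X, comm := by simp }
  comp f g :=
    { hom := f.hom ≫ g.hom
      comm := by
        rw [comp_whiskerRight, ← Category.assoc, f.comm, Category.assoc, g.comm,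
          Category.assoc] }

end CoactedAlgebra

variable [MonoidalPreadditive C] [MonoidalLinear R C] [MonoidalClosed C]

open Functor.LaxMonoidal Functor.OplaxMonoidal Functor.Monoidal MonObj

instance : (scalar R C).Monoidal := (scalarCore R C).toMonoidal

/-- The algebra structure on `𝟙 ⊙ H` induced by the algebra `H`. Hence `X ⊙ H = X ⊗ (𝟙 ⊙ H)` is an
algebra, as a tensor product of algebras, whenever `X` is. -/
instance : MonObj ((scalar R C).obj (ModuleCat.of R H)) :=
  letI : MonObj (ModuleCat.of R H) :=
    ModuleCat.MonModuleEquivalenceAlgebra.inverseObj (AlgCat.of R H)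
  (scalar R C).monObjObj (ModuleCat.of R H)

/-- `(X, τ)` is an `H`-torsor: `X` is faithfully flat, that is, `X ⊗ -` preserves the finite limits
that exist and is conservative; `τ` is a morphism of algebras, coassociative and counital; and
`X ⊗ X ⟶ X ⊗ X ⊙ H ⟶ X ⊙ H` is an isomorphism. -/
structure IsTorsor (A : CoactedAlgebra R H C) : Prop where
  flat : PreservesFiniteLimits (tensorLeft A.X)
  conservative : (tensorLeft A.X).ReflectsIsomorphisms
  isMonHom : IsMonHom A.τ
  coassoc : A.τ ≫ A.τ ▷ (scalar R C).obj (ModuleCat.of R H) =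
    A.τ ≫ A.X ◁ ((scalar R C).map (ModuleCat.ofHom (Coalgebra.comul (R := R) (A := H))) ≫
      δ (scalar R C) (ModuleCat.of R H) (ModuleCat.of R H)) ≫ (α_ _ _ _).inv
  counit : A.τ ≫ A.X ◁ ((scalar R C).map (Y := 𝟙_ (ModuleCat.{u} R))
      (ModuleCat.ofHom (Coalgebra.counit (R := R) (A := H))) ≫ Functor.OplaxMonoidal.η (scalar R C)) ≫
        (ρ_ A.X).hom = 𝟙 A.X
  isIso : IsIso (A.X ◁ A.τ ≫ (α_ _ _ _).inv ≫ μ[A.X] ▷ (scalar R C).obj (ModuleCat.of R H))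

/-- The property of being an `H`-torsor. -/
def torsorProperty : ObjectProperty (CoactedAlgebra R H C) := IsTorsor R H C

/-- The category of `H`-torsors in `C`. -/
abbrev Torsor := (torsorProperty R H C).FullSubcategory

open scoped Obj in
lemma evalRegular_isMonHom {F G : TensorFunctor R (Comod R H) C} (α : F ⟶ G) :
    IsMonHom (α.hom.app (Comod.regular (R := R) (H := H))) where
  one_hom := by
    have h := α.isMonoidal.unit
    simp only [Functor.obj.η_def, Category.assoc, α.hom.naturality]
    rw [← Category.assoc, h]
  mul_hom := by
    have h := α.isMonoidal.tensor (Comod.regular (R := R) (H := H)) Comod.regular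
    simp only [Functor.obj.μ_def, Category.assoc, α.hom.naturality]
    rw [← Category.assoc, h, Category.assoc]

lemma comparisonIso_inv_eq {F G : TensorFunctor R (Comod R H) C} (α : F ⟶ G)
    (M : ModuleCat.{u} R) :
    α.hom.app _ ≫ (comparisonIso G M).inv = (comparisonIso F M).inv := by
  rw [Iso.comp_inv_eq, Iso.eq_inv_comp]
  exact comparison_naturality α M

lemma delta_naturality {F G : TensorFunctor R (Comod R H) C} (α : F ⟶ G) (M N : Comod R H) :
    α.hom.app (M ⊗ N) ≫ δ G.functor M N =
      δ F.functor M N ≫ (α.hom.app M ⊗ₘ α.hom.app N) := by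
  rw [← cancel_epi (Functor.LaxMonoidal.μ F.functor M N), ← Category.assoc, α.isMonoidal.tensor]
  simp

lemma evalRegular_comm {F G : TensorFunctor R (Comod R H) C} (α : F ⟶ G) :
    (F.functor.map Comod.regularCoaction ≫ δ F.functor _ _ ≫
      F.functor.obj Comod.regular ◁ (comparisonIso F (ModuleCat.of R H)).inv) ≫
        α.hom.app Comod.regular ▷ (scalar R C).obj (ModuleCat.of R H) =
    α.hom.app Comod.regular ≫ G.functor.map Comod.regularCoaction ≫ δ G.functor _ _ ≫
      G.functor.obj Comod.regular ◁ (comparisonIso G (ModuleCat.of R H)).inv := by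
  rw [← α.hom.naturality_assoc, Category.assoc, Category.assoc, ← Category.assoc (α.hom.app _),
    delta_naturality, Category.assoc, ← comparisonIso_inv_eq R H C α, whisker_exchange,
    MonoidalCategory.tensorHom_def, Category.assoc, MonoidalCategory.whiskerLeft_comp]

open scoped Obj in
/-- The functor that sends a tensor functor `F` to the algebra `F (H, δ)` with the morphism
`F (H, δ) ⟶ F ((H, δ) ⊙ H) ≅ F (H, δ) ⊙ H` induced by `δ`. -/
def evalRegular : TensorFunctor R (Comod R H) C ⥤ CoactedAlgebra R H C where
  obj F :=
    { X := F.functor.obj Comod.regular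
      τ := F.functor.map Comod.regularCoaction ≫ δ F.functor _ _ ≫
        F.functor.obj Comod.regular ◁ (comparisonIso F (ModuleCat.of R H)).inv }
  map {F G} α :=
    { hom := α.hom.app Comod.regular
      isMonHom := evalRegular_isMonHom R H C α
      comm := evalRegular_comm R H C α }

end Torsors
end UnivTorsor

/-! Write A for the algebra F(H, δ). The coaction embeds a comodule M in the cofree comodule H ⊙ M
as the equalizer of two morphisms H ⊙ M ⇉ H ⊙ (H ⊗ M), and this equalizer becomes split over R. If F
preserves it, then F M is the equalizer of A ⊙ M ⇉ A ⊙ (H ⊗ M), where one arrow comes from τ and the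
other from the coaction of M. So F, its monoidal structure and the transformations out of it can be
read off from (A, τ). Conversely, this equalizer makes sense for every torsor and defines the
inverse construction.

From F to a torsor. The untwisting isomorphism H ⊗ M ≅ H ⊙ M, whose inverse uses the antipode, gives
the torsor condition after F is applied (`extend_freeι`). The substance is that A is faithfully
flat. By the Adams condition, H is a filtered colimit of dualizable comodules
(`RegularIndex.isColimit`). A tensor functor preserves duals and colimits, and tensoring with a
dualizable object preserves limits, so A is flat because filtered colimits in C are exact. For
conservativity, the unit of H factors through dualizable V with 𝟙 ⟶ V dual to a surjection of
comodules. Surjections are cokernels, F preserves cokernels, and dualizing back shows that Y ⟶ F V ⊗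
Y is a kernel. Filtered colimits of kernels are kernels, so each Y ⟶ A ⊗ Y is a kernel
(`isKernelMono_unitMap`), and this suffices to reflect isomorphisms. Once A is faithfully flat, F
preserves the equalizers above, because A ⊗ - turns them into images of split ones
(`mapCoactionIsLimit`). This gives full faithfulness.

From a torsor to F. Let E M be the equalizer of A ⊙ M ⇉ A ⊙ (H ⊗ M). Flatness of A and A ⊗ A ≅ A ⊙ H
turn the defining equalizer, tensored with A, into the split one, so A ⊗ E M ≅ A ⊙ M
(`isIso_extend_of_isLimit`). Since A ⊗ - is conservative, E inherits from M ↦ A ⊙ M that it is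
strong monoidal. It inherits a right adjoint by adjoint lifting along the comonadic functor A ⊗ -.
Finally E(H, δ) ≅ A by comparison with τ.

The groupoid statement is direct: a morphism of torsors A ⟶ B becomes invertible after base change
to B, and B ⊗ - reflects isomorphisms. -/

namespace UnivTorsor

/-! ### Comodules: the untwisting isomorphism, cofree comodules and the split bar construction. -/

noncomputable section ComoduleStructure

variable {R H : Type u} [CommRing R] [CommRing H] [HopfAlgebra R H]

namespace Comod

/-- For a linear endomorphism `f` of `H`, the map `h ⊗ m ↦ h f(m₍₋₁₎) ⊗ m₍₀₎`. -/
def twist (M : Comod R H) (f : H →ₗ[R] H) : H ⊗[R] M.X →ₗ[R] H ⊗[R] M.X :=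
  (LinearMap.mul' R H ∘ₗ f.lTensor H).rTensor M.X ∘ₗ
    (TensorProduct.assoc R H H M.X).symm.toLinearMap ∘ₗ M.coact.lTensor H

/-- By coassociativity, both sides send `h ⊗ m` to `h g(m₍₋₂₎) f(m₍₋₁₎) ⊗ m₍₀₎`. Thus `twist` turns
convolution on `End H` into composition, in reversed order, and convolution inverses into inverse
maps. -/
lemma twist_comp_twist (M : Comod R H) (f g : H →ₗ[R] H) :
    M.twist f ∘ₗ M.twist g =
      M.twist (LinearMap.mul' R H ∘ₗ TensorProduct.map g f ∘ₗ Coalgebra.comul (R := R)) := by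
  have h1 : (LinearMap.mul' R H ∘ₗ f.lTensor H).rTensor M.X ∘ₗ
      (TensorProduct.assoc R H H M.X).symm.toLinearMap ∘ₗ M.coact.lTensor H ∘ₗ
      (LinearMap.mul' R H ∘ₗ g.lTensor H).rTensor M.X ∘ₗ
      (TensorProduct.assoc R H H M.X).symm.toLinearMap =
      (LinearMap.mul' R H ∘ₗ (LinearMap.mul' R H ∘ₗ TensorProduct.map g f).lTensor H).rTensor M.X ∘ₗ
      (TensorProduct.assoc R H (H ⊗[R] H) M.X).symm.toLinearMap ∘ₗ
      ((TensorProduct.assoc R H H M.X).symm.toLinearMap ∘ₗ M.coact.lTensor H).lTensor H := by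
    refine TensorProduct.ext_threefold' fun a b m => ?_
    simp only [LinearMap.comp_apply, LinearEquiv.coe_coe, LinearMap.lTensor_tmul,
      TensorProduct.assoc_symm_tmul, LinearMap.rTensor_tmul, LinearMap.mul'_apply]
    induction M.coact m using TensorProduct.induction_on with
    | zero => simp
    | add x y hx hy => simp only [TensorProduct.tmul_add, map_add, hx, hy]
    | tmul x y => simp [_root_.mul_assoc]
  have h2 : (TensorProduct.assoc R H H M.X).symm.toLinearMap ∘ₗ M.coact.lTensor H ∘ₗ M.coact =
      (Coalgebra.comul (R := R) (A := H)).rTensor M.X ∘ₗ M.coact := by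
    rw [← M.coassoc, ← LinearMap.comp_assoc]; simp
  have h3 : (LinearMap.mul' R H ∘ₗ (LinearMap.mul' R H ∘ₗ TensorProduct.map g f).lTensor H).rTensor
        M.X ∘ₗ (TensorProduct.assoc R H (H ⊗[R] H) M.X).symm.toLinearMap ∘ₗ
        ((Coalgebra.comul (R := R) (A := H)).rTensor M.X).lTensor H =
      (LinearMap.mul' R H ∘ₗ (LinearMap.mul' R H ∘ₗ TensorProduct.map g f ∘ₗ
        Coalgebra.comul (R := R)).lTensor H).rTensor M.X ∘ₗ
        (TensorProduct.assoc R H H M.X).symm.toLinearMap :=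
    TensorProduct.ext_threefold' fun a b m => rfl
  refine (congrArg (· ∘ₗ M.coact.lTensor H) h1).trans ?_
  simp only [LinearMap.comp_assoc, ← LinearMap.lTensor_comp]
  rw [h2]
  have h4 := congrArg (· ∘ₗ M.coact.lTensor H) h3
  simp only [LinearMap.comp_assoc, ← LinearMap.lTensor_comp] at h4
  exact h4

lemma twist_counit (M : Comod R H) :
    M.twist (Algebra.linearMap R H ∘ₗ Coalgebra.counit (R := R)) = LinearMap.id := by
  have h : (LinearMap.mul' R H ∘ₗ (Algebra.linearMap R H ∘ₗ
        Coalgebra.counit (R := R)).lTensor H).rTensor M.X ∘ₗ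
      (TensorProduct.assoc R H H M.X).symm.toLinearMap =
      (TensorProduct.lid R M.X ∘ₗ (Coalgebra.counit (R := R) (A := H)).rTensor M.X).lTensor H := by
    refine TensorProduct.ext_threefold' fun a b m => ?_
    simp [TensorProduct.tmul_smul, ← TensorProduct.smul_tmul', ← Algebra.commutes,
      ← Algebra.smul_def]
  refine (congrArg (· ∘ₗ M.coact.lTensor H) h).trans ?_
  rw [← LinearMap.lTensor_comp, LinearMap.comp_assoc, M.counit_coact, LinearMap.lTensor_id]

/-- The coaction as a morphism of comodules. -/
def coaction (M : Comod R H) : M ⟶ regular ⊗ trivial.obj (forget.obj M) :=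
  ⟨M.coact, by
    have h : mulMiddle (R := R) H H M.X ∘ₗ (TensorProduct.mk R H M.X 1).lTensor (H ⊗[R] H) =
        (TensorProduct.assoc R H H M.X).toLinearMap := by
      ext a b c
      simp
    have h' : (regular ⊗ trivial.obj (forget.obj M) : Comod R H).coact =
        (TensorProduct.assoc R H H M.X).toLinearMap ∘ₗ
          (Coalgebra.comul (R := R) (A := H)).rTensor M.X := by
      refine TensorProduct.ext' fun a b => ?_
      exact LinearMap.congr_fun h (Coalgebra.comul (R := R) a ⊗ₜ b)
    rw [h']
    exact M.coassoc⟩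

open MonObj in
/-- The morphism `H ⊗ M ⟶ H ⊙ M`, `h ⊗ m ↦ h m₍₋₁₎ ⊗ m₍₀₎`. -/
def untwist (M : Comod R H) : regular ⊗ M ⟶ regular ⊗ trivial.obj (forget.obj M) :=
  regular ◁ M.coaction ≫ (α_ _ _ _).inv ≫ μ[regular] ▷ trivial.obj (forget.obj M)

lemma untwist_hom (M : Comod R H) : M.untwist.hom = M.twist LinearMap.id := by
  simp only [twist, LinearMap.lTensor_id, LinearMap.comp_id]
  rfl

/-- The antipode is the convolution inverse of the identity of `H`, so the twist by the antipode
inverts the twist by the identity. -/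
instance (M : Comod R H) : IsIso M.untwist := by
  have h1 : M.twist (HopfAlgebra.antipode R) ∘ₗ M.twist LinearMap.id = LinearMap.id := by
    rw [twist_comp_twist, ← twist_counit]
    exact congrArg _ HopfAlgebra.mul_antipode_lTensor_comul
  have h2 : M.twist LinearMap.id ∘ₗ M.twist (HopfAlgebra.antipode R) = LinearMap.id := by
    rw [twist_comp_twist, ← twist_counit]
    exact congrArg _ HopfAlgebra.mul_antipode_rTensor_comul
  let e : (regular ⊗ M : Comod R H) ≅ regular ⊗ trivial.obj (forget.obj M) :=
    mkIso (LinearEquiv.ofLinearMap (M.twist LinearMap.id) (M.twist (HopfAlgebra.antipode R)) h2 h1)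
      (by
        have h := M.untwist.comm
        rw [untwist_hom] at h
        exact h)
  have : M.untwist = e.hom := by
    ext1
    exact M.untwist_hom
  rw [this]
  infer_instance

lemma coaction_naturality {M N : Comod R H} (f : M ⟶ N) :
    f ≫ N.coaction = M.coaction ≫ regular ◁ trivial.map (forget.map f) := by
  ext1
  exact f.comm

lemma untwist_naturality {M N : Comod R H} (f : M ⟶ N) :
    regular ◁ f ≫ N.untwist = M.untwist ≫ regular ◁ trivial.map (forget.map f) := by
  simp only [untwist, Category.assoc, ← whisker_exchange, ← MonoidalCategory.whiskerLeft_comp_assoc,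
    coaction_naturality]
  simp only [MonoidalCategory.whiskerLeft_comp, Category.assoc]
  congr 1
  rw [associator_inv_naturality_right_assoc, whisker_exchange]

/-- The cofree comodule on a module. -/
def cofree : ModuleCat.{u} R ⥤ Comod R H := trivial ⋙ tensorLeft regular

/-- The natural isomorphism `H ⊗ M ≅ H ⊙ M`. -/
def untwistIso : tensorLeft (regular (R := R) (H := H)) ≅ forget ⋙ cofree :=
  NatIso.ofComponents (fun M =>
    (asIso M.untwist : regular ⊗ M ≅ regular ⊗ trivial.obj (forget.obj M)))
    fun f => untwist_naturality f

/-- The cofree comodule functor is right adjoint to the forgetful functor. -/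
def forgetAdj : forget (R := R) (H := H) ⊣ cofree where
  unit := { app := fun M => M.coaction, naturality := fun _ _ f => coaction_naturality f }
  counit :=
    { app := fun X => ModuleCat.ofHom (TensorProduct.lid R X ∘ₗ
        (Coalgebra.counit (R := R) (A := H)).rTensor X)
      naturality := fun X Y f => by
        ext1
        refine TensorProduct.ext' fun (h : H) (x : X) => ?_
        change TensorProduct.lid R Y (Coalgebra.counit (R := R) h ⊗ₜ f.hom x) =
          f.hom (TensorProduct.lid R X (Coalgebra.counit (R := R) h ⊗ₜ x))
        simp }
  left_triangle_components M := by
    ext1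
    exact M.counit_coact
  right_triangle_components X := by
    ext1
    have h : (TensorProduct.lid R X ∘ₗ
        (Coalgebra.counit (R := R) (A := H)).rTensor X).lTensor H ∘ₗ
        mulMiddle (R := R) H H X ∘ₗ (TensorProduct.mk R H X 1).lTensor (H ⊗[R] H) =
        ((TensorProduct.rid R H).toLinearMap ∘ₗ
          (Coalgebra.counit (R := R) (A := H)).lTensor H).rTensor X := by
      refine TensorProduct.ext_threefold fun a b x => ?_
      simp [TensorProduct.tmul_smul, TensorProduct.smul_tmul']
    refine TensorProduct.ext' fun (a : H) (x : X) => ?_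
    refine (LinearMap.congr_fun h (Coalgebra.comul (R := R) a ⊗ₜ x)).trans ?_
    have h' := LinearMap.congr_fun (Coalgebra.lTensor_counit_comp_comul (R := R) (A := H)) a
    simp only [LinearMap.comp_apply] at h'
    simp only [LinearMap.rTensor_tmul, LinearMap.comp_apply, h']
    change (TensorProduct.rid R H (a ⊗ₜ 1)) ⊗ₜ[R] x = a ⊗ₜ[R] x
    simp

/-- The bar construction of the adjunction of `forget` and `cofree` is split by `forget`. -/
def forgetSplit (M : Comod R H) :
    IsSplitEqualizer (forget.map (cofree.map (forget.map M.coaction)))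
      (forget.map (cofree.obj (forget.obj M)).coaction) (forget.map M.coaction) where
  leftRetraction := forgetAdj.counit.app (forget.obj M)
  rightRetraction := forgetAdj.counit.app (forget.obj (cofree.obj (forget.obj M)))
  condition := (forget.map_comp _ _).symm.trans
    ((congrArg forget.map (coaction_naturality M.coaction).symm).trans (forget.map_comp _ _))
  ι_leftRetraction := forgetAdj.left_triangle_components M
  bottom_rightRetraction := forgetAdj.left_triangle_components _
  top_rightRetraction := forgetAdj.counit.naturality (forget.map M.coaction)

/-! ### Kernels of comodules over a flat Hopf algebra. -/

section Kernels

variable [Module.Flat R H] {M N : Comod R H} (f : M ⟶ N)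

/-- Flatness keeps `H ⊗ ker f ⟶ H ⊗ M ⟶ H ⊗ N` exact, and colinearity of `f` places the coaction of
`k` in the kernel of the second map. -/
lemma coact_mem_range (k : LinearMap.ker f.hom) :
    M.coact k ∈ LinearMap.range ((LinearMap.ker f.hom).subtype.lTensor H) := by
  have h : Function.Exact ((LinearMap.ker f.hom).subtype.lTensor H) (f.hom.lTensor H) :=
    Module.Flat.lTensor_exact H (LinearMap.exact_subtype_ker_map f.hom)
  refine (h _).mp ?_
  have := LinearMap.congr_fun f.comm k
  simp only [LinearMap.comp_apply] at this
  rw [← this, k.2, map_zero]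

lemma lTensor_ker_injective :
    Function.Injective ((LinearMap.ker f.hom).subtype.lTensor H) :=
  Module.Flat.lTensor_preserves_injective_linearMap _ (Submodule.injective_subtype _)

/-- The coaction on the kernel. -/
def kerCoact : LinearMap.ker f.hom →ₗ[R] H ⊗[R] LinearMap.ker f.hom :=
  (LinearEquiv.ofInjective _ (lTensor_ker_injective f)).symm.toLinearMap ∘ₗ
    LinearMap.codRestrict _ (M.coact ∘ₗ (LinearMap.ker f.hom).subtype) (coact_mem_range f)

lemma lTensor_kerCoact :
    (LinearMap.ker f.hom).subtype.lTensor H ∘ₗ kerCoact f =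
      M.coact ∘ₗ (LinearMap.ker f.hom).subtype := by
  ext k
  have := LinearEquiv.apply_symm_apply
    (LinearEquiv.ofInjective _ (lTensor_ker_injective f)) ⟨M.coact k, coact_mem_range f k⟩
  exact congrArg Subtype.val this

/-- The kernel of a morphism of comodules. -/
def ker : Comod R H where
  X := ModuleCat.of R (LinearMap.ker f.hom)
  coact := kerCoact f
  counit_coact := by
    refine LinearMap.ext fun k => Subtype.ext ?_
    have h : (LinearMap.ker f.hom).subtype ∘ₗ (TensorProduct.lid R (LinearMap.ker f.hom) ∘ₗ
        (Coalgebra.counit (R := R) (A := H)).rTensor (LinearMap.ker f.hom)) =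
        (TensorProduct.lid R M.X ∘ₗ (Coalgebra.counit (R := R) (A := H)).rTensor M.X) ∘ₗ
          (LinearMap.ker f.hom).subtype.lTensor H := by
      ext; simp
    refine (LinearMap.congr_fun h (kerCoact f k)).trans ?_
    have h' := LinearMap.congr_fun (lTensor_kerCoact f) k
    simp only [LinearMap.comp_apply] at h' ⊢
    rw [h']
    exact LinearMap.congr_fun M.counit_coact k
  coassoc := by
    -- Flatness used twice embeds `H ⊗ (H ⊗ ker f)` in `H ⊗ (H ⊗ M)`, where coassociativity is that
    -- of `M`.
    have hinj : Function.Injective (((LinearMap.ker f.hom).subtype.lTensor H).lTensor H) :=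
      Module.Flat.lTensor_preserves_injective_linearMap _ (lTensor_ker_injective f)
    refine LinearMap.ext fun k => hinj ?_
    have h : ((LinearMap.ker f.hom).subtype.lTensor H).lTensor H ∘ₗ
        (TensorProduct.assoc R H H (LinearMap.ker f.hom)).toLinearMap ∘ₗ
          (Coalgebra.comul (R := R) (A := H)).rTensor (LinearMap.ker f.hom) =
        ((TensorProduct.assoc R H H M.X).toLinearMap ∘ₗ
          (Coalgebra.comul (R := R) (A := H)).rTensor M.X) ∘ₗ
          (LinearMap.ker f.hom).subtype.lTensor H := by
      refine TensorProduct.ext' fun a b => ?_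
      simp only [LinearMap.comp_apply, LinearMap.rTensor_tmul, LinearMap.lTensor_tmul]
      induction Coalgebra.comul (R := R) a using TensorProduct.induction_on with
      | zero => simp
      | add x y hx hy => simp only [TensorProduct.add_tmul, map_add, hx, hy]
      | tmul x y => simp
    refine (LinearMap.congr_fun h (kerCoact f k)).trans ?_
    have h1 := lTensor_kerCoact f
    have h2 := LinearMap.congr_fun h1 k
    simp only [LinearMap.comp_apply] at h2 ⊢
    rw [h2]
    refine (LinearMap.congr_fun M.coassoc k).trans ?_
    change _ = ((LinearMap.ker f.hom).subtype.lTensor H).lTensor H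
      ((kerCoact f).lTensor H (kerCoact f k))
    rw [← LinearMap.comp_apply, ← LinearMap.lTensor_comp, h1, LinearMap.lTensor_comp]
    exact congrArg (M.coact.lTensor H) h2.symm

/-- The inclusion of the kernel. -/
def kerι : ker f ⟶ M := ⟨(LinearMap.ker f.hom).subtype, (lTensor_kerCoact f).symm⟩

lemma kerι_comp : kerι f ≫ f = 0 := by
  ext1
  exact LinearMap.ext fun k => k.2

instance : Mono (kerι f) where
  right_cancellation g h e := by
    ext1
    refine LinearMap.ext fun x => Subtype.ext ?_
    exact LinearMap.congr_fun (congrArg Hom.hom e) x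

/-- The kernel is a kernel. -/
def isLimitKer : IsLimit (KernelFork.ofι (kerι f) (kerι_comp f)) :=
  KernelFork.IsLimit.ofι' _ _ fun {L} g hg =>
    have h0 : ∀ l, g.hom l ∈ LinearMap.ker f.hom := fun l =>
      LinearMap.congr_fun (congrArg Hom.hom hg) l
    ⟨⟨LinearMap.codRestrict _ g.hom h0, by
      refine LinearMap.ext fun l => lTensor_ker_injective f ?_
      refine (LinearMap.congr_fun (lTensor_kerCoact f) _).trans ?_
      refine (LinearMap.congr_fun g.comm l).trans ?_
      exact LinearMap.congr_fun (LinearMap.lTensor_comp H (LinearMap.ker f.hom).subtype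
        (LinearMap.codRestrict _ g.hom h0)) (L.coact l)⟩, by ext1; rfl⟩

instance : HasKernels (Comod R H) where
  has_limit f := ⟨⟨_, isLimitKer f⟩⟩

instance : HasEqualizers (Comod R H) := Preadditive.hasEqualizers_of_hasKernels

end Kernels

end Comod
end ComoduleStructure
end UnivTorsor

namespace UnivTorsor

/-! ### Duals of direct sums. -/

noncomputable section BiproductDual

variable {D : Type*} [Category* D] [Preadditive D] [MonoidalCategory D] [MonoidalPreadditive D]
  [HasBinaryBiproducts D]

open ExactPairing

/-- The zigzag that mixes a coevaluation and an evaluation of two different pairs depends on the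
inner morphisms only through `x ≫ p`. For inclusions and projections of a biproduct, `x ≫ p` is zero
or the identity, so the mixed terms vanish and the others are ordinary zigzags. -/
lemma whiskerLeft_coevaluation_tensorHom {X Y X' Y' Z W : D} [ExactPairing X Y]
    [ExactPairing X' Y'] (x : X ⟶ Z) (y : Y ⟶ W) (q : W ⟶ Y') (p : Z ⟶ X') :
    W ◁ (η_ X Y ≫ (x ⊗ₘ y)) ≫ (α_ W Z W).inv ≫ ((q ⊗ₘ p) ≫ ε_ X' Y') ▷ W =
      q ▷ 𝟙_ D ≫ Y' ◁ (η_ X Y ≫ (x ≫ p) ▷ Y) ≫ (α_ _ _ _).inv ≫ ε_ X' Y' ▷ Y ≫ 𝟙_ D ◁ y := by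
  rw [← whisker_exchange]
  simp only [MonoidalCategory.tensorHom_def', MonoidalCategory.whiskerLeft_comp, comp_whiskerRight,
    Category.assoc, ← associator_inv_naturality_left_assoc,
    ← associator_inv_naturality_middle_assoc, ← associator_inv_naturality_right_assoc]
  simp only [whisker_exchange_assoc, ← MonoidalCategory.whiskerLeft_comp_assoc]
  simp [whisker_exchange]

lemma coevaluation_tensorHom_whiskerRight {X Y X' Y' Z W : D} [ExactPairing X Y]
    [ExactPairing X' Y'] (x : X ⟶ Z) (y : Y ⟶ W) (q : W ⟶ Y') (p : Z ⟶ X') :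
    (η_ X Y ≫ (x ⊗ₘ y)) ▷ Z ≫ (α_ Z W Z).hom ≫ Z ◁ ((q ⊗ₘ p) ≫ ε_ X' Y') =
      𝟙_ D ◁ p ≫ (η_ X Y ≫ X ◁ (y ≫ q)) ▷ X' ≫ (α_ _ _ _).hom ≫ X ◁ ε_ X' Y' ≫ x ▷ 𝟙_ D := by
  rw [whisker_exchange_assoc, associator_naturality_right_assoc, whisker_exchange]
  simp only [MonoidalCategory.tensorHom_def, MonoidalCategory.whiskerLeft_comp, comp_whiskerRight,
    Category.assoc, associator_naturality_left_assoc,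
    associator_naturality_middle_assoc, whisker_exchange, whisker_exchange_assoc]

/-- The direct sum of dualizable objects is dualizable. -/
@[reducible]
def exactPairingBiprod (X₁ Y₁ X₂ Y₂ : D) [ExactPairing X₁ Y₁] [ExactPairing X₂ Y₂] :
    ExactPairing (X₁ ⊞ X₂) (Y₁ ⊞ Y₂) where
  coevaluation' := η_ X₁ Y₁ ≫ (biprod.inl ⊗ₘ biprod.inl) + η_ X₂ Y₂ ≫ (biprod.inr ⊗ₘ biprod.inr)
  evaluation' := (biprod.fst ⊗ₘ biprod.fst) ≫ ε_ X₁ Y₁ + (biprod.snd ⊗ₘ biprod.snd) ≫ ε_ X₂ Y₂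
  coevaluation_evaluation' := by
    simp only [MonoidalPreadditive.whiskerLeft_add, MonoidalPreadditive.add_whiskerRight,
      Preadditive.comp_add, Preadditive.add_comp, whiskerLeft_coevaluation_tensorHom]
    simp only [biprod.inl_fst, biprod.inr_snd, biprod.inl_snd, biprod.inr_fst, id_whiskerRight,
      MonoidalPreadditive.zero_whiskerRight, comp_zero, MonoidalPreadditive.whiskerLeft_zero,
      zero_comp, Category.comp_id, add_zero, zero_add, coevaluation_evaluation_assoc]
    -- What remains is `fst ≫ inl + snd ≫ inr = 𝟙`.
    rw [← cancel_epi (ρ_ _).inv, ← cancel_mono (λ_ _).hom]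
    simp
  evaluation_coevaluation' := by
    simp only [MonoidalPreadditive.whiskerLeft_add, MonoidalPreadditive.add_whiskerRight,
      Preadditive.comp_add, Preadditive.add_comp, coevaluation_tensorHom_whiskerRight]
    simp only [biprod.inl_fst, biprod.inr_snd, biprod.inl_snd, biprod.inr_fst,
      MonoidalCategory.whiskerLeft_id, MonoidalPreadditive.zero_whiskerRight, comp_zero,
      MonoidalPreadditive.whiskerLeft_zero,
      zero_comp, Category.comp_id, add_zero, zero_add, evaluation_coevaluation_assoc]
    rw [← cancel_epi (λ_ _).inv, ← cancel_mono (ρ_ _).hom]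
    simp

end BiproductDual

/-! ### Direct sums and quotients of comodules, and generation by dualizable comodules. -/

noncomputable section Dualizable
variable {R H : Type u} [CommRing R] [CommRing H] [HopfAlgebra R H]

namespace Comod

lemma assoc_comul_lTensor {P Q : Type u} [AddCommGroup P] [Module R P] [AddCommGroup Q]
    [Module R Q] (f : P →ₗ[R] Q) :
    ((TensorProduct.assoc R H H Q).toLinearMap ∘ₗ
        (Coalgebra.comul (R := R) (A := H)).rTensor Q) ∘ₗ f.lTensor H =
      (f.lTensor H).lTensor H ∘ₗ (TensorProduct.assoc R H H P).toLinearMap ∘ₗ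
        (Coalgebra.comul (R := R) (A := H)).rTensor P := by
  refine TensorProduct.ext' fun x y => ?_
  simp only [LinearMap.comp_apply, LinearMap.lTensor_tmul, LinearMap.rTensor_tmul]
  induction Coalgebra.comul (R := R) x using TensorProduct.induction_on with
  | zero => simp
  | add x y hx hy => simp only [TensorProduct.add_tmul, map_add, hx, hy]
  | tmul x y => simp

lemma lid_counit_lTensor {P Q : Type u} [AddCommGroup P] [Module R P] [AddCommGroup Q]
    [Module R Q] (f : P →ₗ[R] Q) :
    ((TensorProduct.lid R Q).toLinearMap ∘ₗ
        (Coalgebra.counit (R := R) (A := H)).rTensor Q) ∘ₗ f.lTensor H =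
      f ∘ₗ (TensorProduct.lid R P).toLinearMap ∘ₗ
        (Coalgebra.counit (R := R) (A := H)).rTensor P :=
  TensorProduct.ext' fun x y => by simp

/-- A coaction that agrees with the one of `M` along a linear map `f : M → X` satisfies the
comodule axioms on the image of `f`. -/
lemma counit_coact_comp (M : Comod R H) {X : Type u} [AddCommGroup X] [Module R X]
    (f : M.X →ₗ[R] X) (c : X →ₗ[R] H ⊗[R] X) (h : c ∘ₗ f = f.lTensor H ∘ₗ M.coact) :
    (TensorProduct.lid R X ∘ₗ (Coalgebra.counit (R := R) (A := H)).rTensor X ∘ₗ c) ∘ₗ f =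
      LinearMap.id ∘ₗ f := by
  rw [← LinearMap.comp_assoc, LinearMap.comp_assoc, h, ← LinearMap.comp_assoc,
    lid_counit_lTensor, LinearMap.comp_assoc, LinearMap.comp_assoc, M.counit_coact]
  rfl

lemma coassoc_comp (M : Comod R H) {X : Type u} [AddCommGroup X] [Module R X]
    (f : M.X →ₗ[R] X) (c : X →ₗ[R] H ⊗[R] X) (h : c ∘ₗ f = f.lTensor H ∘ₗ M.coact) :
    (TensorProduct.assoc R H H X ∘ₗ (Coalgebra.comul (R := R) (A := H)).rTensor X ∘ₗ c) ∘ₗ f =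
      (c.lTensor H ∘ₗ c) ∘ₗ f := by
  rw [← LinearMap.comp_assoc, LinearMap.comp_assoc, h, ← LinearMap.comp_assoc,
    assoc_comul_lTensor, LinearMap.comp_assoc, LinearMap.comp_assoc, M.coassoc,
    LinearMap.comp_assoc, h, ← LinearMap.comp_assoc, ← LinearMap.comp_assoc,
    ← LinearMap.lTensor_comp, ← LinearMap.lTensor_comp, h]

/-- The coaction on the direct sum of comodules. -/
def prodCoact (M N : Comod R H) : M.X × N.X →ₗ[R] H ⊗[R] (M.X × N.X) :=
  (LinearMap.inl R M.X N.X).lTensor H ∘ₗ M.coact ∘ₗ LinearMap.fst R M.X N.X +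
    (LinearMap.inr R M.X N.X).lTensor H ∘ₗ N.coact ∘ₗ LinearMap.snd R M.X N.X

lemma prodCoact_inl (M N : Comod R H) : prodCoact M N ∘ₗ LinearMap.inl R M.X N.X =
    (LinearMap.inl R M.X N.X).lTensor H ∘ₗ M.coact := by
  ext; simp [prodCoact]

lemma prodCoact_inr (M N : Comod R H) : prodCoact M N ∘ₗ LinearMap.inr R M.X N.X =
    (LinearMap.inr R M.X N.X).lTensor H ∘ₗ N.coact := by
  ext; simp [prodCoact]

lemma fst_prodCoact (M N : Comod R H) : M.coact ∘ₗ LinearMap.fst R M.X N.X =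
    (LinearMap.fst R M.X N.X).lTensor H ∘ₗ prodCoact M N := by
  rw [prodCoact, LinearMap.comp_add]
  simp only [← LinearMap.comp_assoc, ← LinearMap.lTensor_comp]
  simp

lemma snd_prodCoact (M N : Comod R H) : N.coact ∘ₗ LinearMap.snd R M.X N.X =
    (LinearMap.snd R M.X N.X).lTensor H ∘ₗ prodCoact M N := by
  rw [prodCoact, LinearMap.comp_add]
  simp only [← LinearMap.comp_assoc, ← LinearMap.lTensor_comp]
  simp

/-- The direct sum of comodules. -/
def prod (M N : Comod R H) : Comod R H where
  X := ModuleCat.of R (M.X × N.X)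
  coact := prodCoact M N
  counit_coact := LinearMap.prod_ext (counit_coact_comp M _ _ (prodCoact_inl M N))
    (counit_coact_comp N _ _ (prodCoact_inr M N))
  coassoc := LinearMap.prod_ext (coassoc_comp M _ _ (prodCoact_inl M N))
    (coassoc_comp N _ _ (prodCoact_inr M N))

/-- The direct sum is a biproduct. -/
def prodBicone (M N : Comod R H) : BinaryBicone M N where
  pt := prod M N
  fst := ⟨LinearMap.fst R M.X N.X, fst_prodCoact M N⟩
  snd := ⟨LinearMap.snd R M.X N.X, snd_prodCoact M N⟩
  inl := ⟨LinearMap.inl R M.X N.X, prodCoact_inl M N⟩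
  inr := ⟨LinearMap.inr R M.X N.X, prodCoact_inr M N⟩
  inl_fst := by ext1; exact LinearMap.fst_comp_inl ..
  inl_snd := by ext1; exact LinearMap.snd_comp_inl ..
  inr_fst := by ext1; exact LinearMap.fst_comp_inr ..
  inr_snd := by ext1; exact LinearMap.snd_comp_inr ..

instance : HasBinaryBiproducts (Comod R H) where
  has_binary_biproduct M N := ⟨⟨prodBicone M N, isBinaryBilimitOfTotal _ (by
    ext1
    refine LinearMap.ext fun (x : M.X × N.X) => ?_
    change (x.1, (0 : N.X)) + ((0 : M.X), x.2) = x
    simp)⟩⟩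

/-- The quotient of a comodule by a submodule `I` with `coact I ⊆ ker (H ⊗ M ⟶ H ⊗ M / I)`. -/
def quotient (M : Comod R H) (I : Submodule R M.X)
    (hI : I ≤ LinearMap.ker (I.mkQ.lTensor H ∘ₗ M.coact)) : Comod R H where
  X := ModuleCat.of R (M.X ⧸ I)
  coact := I.liftQ (I.mkQ.lTensor H ∘ₗ M.coact) hI
  counit_coact := Submodule.linearMap_qext _ (counit_coact_comp M I.mkQ _ (I.liftQ_mkQ _ hI))
  coassoc := Submodule.linearMap_qext _ (coassoc_comp M I.mkQ _ (I.liftQ_mkQ _ hI))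

/-- The projection to a quotient. -/
def quotientMk (M : Comod R H) (I : Submodule R M.X)
    (hI : I ≤ LinearMap.ker (I.mkQ.lTensor H ∘ₗ M.coact)) : M ⟶ M.quotient I hI :=
  ⟨I.mkQ, I.liftQ_mkQ _ hI⟩

/-- Comodules with a dual. -/
def HasDual (M : Comod R H) : Prop := ∃ N : Comod R H, Nonempty (ExactPairing M N)

lemma hasDual_unit : HasDual (𝟙_ (Comod R H)) := ⟨_, ⟨exactPairingUnit⟩⟩

lemma HasDual.biprod {M N : Comod R H} (hM : M.HasDual) (hN : N.HasDual) : (M ⊞ N).HasDual := by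
  obtain ⟨M', ⟨_⟩⟩ := hM
  obtain ⟨N', ⟨_⟩⟩ := hN
  exact ⟨_, ⟨exactPairingBiprod M M' N N'⟩⟩

/-- The elements of a comodule that lie in the image of a dualizable comodule. -/
def dualImage (M : Comod R H) : Submodule R M.X where
  carrier := {m | ∃ (V : Comod R H) (_ : V.HasDual) (p : V ⟶ M) (x : V.X), p.hom x = m}
  zero_mem' := ⟨_, hasDual_unit, 0, 0, rfl⟩
  add_mem' := by
    rintro _ _ ⟨V, hV, p, x, rfl⟩ ⟨W, hW, q, y, rfl⟩
    refine ⟨_, hV.biprod hW, biprod.desc p q,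
      (biprod.inl : V ⟶ V ⊞ W).hom x + (biprod.inr : W ⟶ V ⊞ W).hom y, ?_⟩
    have h1 := LinearMap.congr_fun (congrArg Hom.hom (biprod.inl_desc p q)) x
    have h2 := LinearMap.congr_fun (congrArg Hom.hom (biprod.inr_desc p q)) y
    rw [map_add]
    exact congrArg₂ (· + ·) h1 h2
  smul_mem' := by
    rintro r _ ⟨V, hV, p, x, rfl⟩
    exact ⟨V, hV, p, r • x, map_smul _ _ _⟩

/-- This is the elementwise form of generation. The elements reached from dualizable comodules form
a subobject, and the projection to the quotient by it kills every morphism from a dualizable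
comodule. A separating family forces that projection to be zero. -/
lemma exists_hasDual (hH : IsAdamsHopfAlgebra R H) (M : Comod R H) (m : M.X) :
    ∃ (V : Comod R H) (_ : V.HasDual) (p : V ⟶ M) (x : V.X), p.hom x = m := by
  have hI : M.dualImage ≤ LinearMap.ker (M.dualImage.mkQ.lTensor H ∘ₗ M.coact) := by
    rintro _ ⟨V, hV, p, x, rfl⟩
    have h1 : M.dualImage.mkQ ∘ₗ p.hom = 0 := by
      ext x
      exact (Submodule.Quotient.mk_eq_zero _).mpr ⟨V, hV, p, x, rfl⟩
    have h2 := LinearMap.congr_fun p.comm x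
    simp only [LinearMap.comp_apply, LinearMap.mem_ker] at h2 ⊢
    rw [h2, ← LinearMap.comp_apply, ← LinearMap.lTensor_comp, h1]
    simp
  have h : M.quotientMk M.dualImage hI = 0 := hH.generated _ _ fun V hV p => by
    ext1
    refine LinearMap.ext fun x => ?_
    exact (Submodule.Quotient.mk_eq_zero _).mpr ⟨V, hV, p, x, rfl⟩
  have h' := LinearMap.congr_fun (congrArg Hom.hom h) m
  exact (Submodule.Quotient.mk_eq_zero _).mp h'

end Comod
end Dualizable
end UnivTorsor

namespace UnivTorsor

/-! ### The regular comodule as a filtered colimit of dualizable comodules. -/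

noncomputable section Dualizable
variable {R H : Type u} [CommRing R] [CommRing H] [HopfAlgebra R H]

namespace Comod
open ExactPairing

section Pairing
variable (V N : Comod R H) [ExactPairing V N]

/-- The evaluation of an exact pairing of comodules, as a linear map. -/
def evalMap : N.X ⊗[R] V.X →ₗ[R] R := (ε_ V N).hom

/-- The coevaluation of an exact pairing of comodules, as an element. -/
def coevalEl : V.X ⊗[R] N.X := (η_ V N).hom (1 : R)

lemma zigzag_left (v : V.X) :
    TensorProduct.rid R V.X ((evalMap V N).lTensor V.X
      (TensorProduct.assoc R V.X N.X V.X (coevalEl V N ⊗ₜ v))) = v := by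
  have h := LinearMap.congr_fun (congrArg Hom.hom (evaluation_coevaluation V N)) ((1 : R) ⊗ₜ[R] v)
  refine (congrArg (TensorProduct.rid R V.X) h).trans ?_
  change TensorProduct.rid R V.X ((TensorProduct.rid R V.X).symm (TensorProduct.lid R V.X
    ((1 : R) ⊗ₜ[R] v))) = v
  simp

lemma zigzag_right (n : N.X) :
    TensorProduct.lid R N.X ((evalMap V N).rTensor N.X
      ((TensorProduct.assoc R N.X V.X N.X).symm (n ⊗ₜ coevalEl V N))) = n := by
  have h := LinearMap.congr_fun (congrArg Hom.hom (coevaluation_evaluation V N)) (n ⊗ₜ[R] (1 : R))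
  refine (congrArg (TensorProduct.lid R N.X) h).trans ?_
  change TensorProduct.lid R N.X ((TensorProduct.lid R N.X).symm (TensorProduct.rid R N.X
    (n ⊗ₜ[R] (1 : R)))) = n
  simp

/-- The zigzag identity expands `n` in the second legs of the coevaluation, with the values `evalMap
V N (n ⊗ₜ v)` as coefficients. -/
lemma eq_zero_of_evalMap {n : N.X} (h : ∀ v, evalMap V N (n ⊗ₜ v) = 0) : n = 0 := by
  rw [← zigzag_right V N n]
  induction coevalEl V N using TensorProduct.induction_on with
  | zero => simp
  | add x y hx hy => simp only [TensorProduct.tmul_add, map_add, hx, hy, add_zero]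
  | tmul x y => simp [h]

/-- Every linear form on `V` is given by an element of the dual. -/
lemma exists_evalMap (φ : V.X →ₗ[R] R) : ∃ n : N.X, ∀ v, evalMap V N (n ⊗ₜ v) = φ v := by
  refine ⟨TensorProduct.lid R N.X (φ.rTensor N.X (coevalEl V N)), fun v => ?_⟩
  conv_rhs => rw [← zigzag_left V N v]
  induction coevalEl V N using TensorProduct.induction_on with
  | zero => simp
  | add x y hx hy => simp only [TensorProduct.add_tmul, map_add, ← hx, ← hy]
  | tmul x y => simp [← TensorProduct.smul_tmul', mul_comm]

/-- The zigzag identity writes each `v` as a combination of the finitely many first legs of the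
coevaluation. This finiteness allows an essentially small family of dualizable comodules to be
indexed in `Type u`. -/
lemma finite_of_exactPairing (V N : Comod R H) [ExactPairing V N] : Module.Finite R V.X := by
  have h : ∀ t : V.X ⊗[R] N.X, ∃ S : Submodule R V.X, S.FG ∧ ∀ v : V.X,
      TensorProduct.rid R V.X ((evalMap V N).lTensor V.X
        (TensorProduct.assoc R V.X N.X V.X (t ⊗ₜ v))) ∈ S := by
    intro t
    induction t using TensorProduct.induction_on with
    | zero => exact ⟨⊥, Submodule.fg_bot, fun v => by simp⟩
    | add x y hx hy =>
      obtain ⟨S, hS, hx⟩ := hx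
      obtain ⟨T, hT, hy⟩ := hy
      refine ⟨S ⊔ T, hS.sup hT, fun v => ?_⟩
      rw [TensorProduct.add_tmul, map_add, map_add, map_add]
      exact add_mem (le_sup_left (a := S) (hx v)) (le_sup_right (a := S) (hy v))
    | tmul x y =>
      refine ⟨R ∙ x, Submodule.fg_span_singleton x, fun v => ?_⟩
      exact Submodule.smul_mem _ _ (Submodule.mem_span_singleton_self x)
  obtain ⟨S, hS, hv⟩ := h (coevalEl V N)
  have : S = ⊤ := by
    refine eq_top_iff.mpr fun v _ => ?_
    rw [← zigzag_left V N v]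
    exact hv v
  exact ⟨this ▸ hS⟩

end Pairing

/-- A comodule structure on a quotient of `Rⁿ` with a dual, and a morphism from it to the regular
comodule. These form a small category. -/
structure RegularIndex (R H : Type u) [CommRing R] [CommRing H] [HopfAlgebra R H] where
  n : ℕ
  K : Submodule R (Fin n → R)
  coact : ((Fin n → R) ⧸ K) →ₗ[R] H ⊗[R] ((Fin n → R) ⧸ K)
  counit_coact : TensorProduct.lid R ((Fin n → R) ⧸ K) ∘ₗ
    (Coalgebra.counit (R := R) (A := H)).rTensor ((Fin n → R) ⧸ K) ∘ₗ coact = LinearMap.id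
  coassoc : TensorProduct.assoc R H H ((Fin n → R) ⧸ K) ∘ₗ
    (Coalgebra.comul (R := R) (A := H)).rTensor ((Fin n → R) ⧸ K) ∘ₗ coact =
      coact.lTensor H ∘ₗ coact
  hasDual : HasDual ⟨ModuleCat.of R ((Fin n → R) ⧸ K), coact, counit_coact, coassoc⟩
  q : (⟨ModuleCat.of R ((Fin n → R) ⧸ K), coact, counit_coact, coassoc⟩ : Comod R H) ⟶ regular

namespace RegularIndex

/-- The underlying comodule. -/
def obj (i : RegularIndex R H) : Comod R H :=
  ⟨ModuleCat.of R ((Fin i.n → R) ⧸ i.K), i.coact, i.counit_coact, i.coassoc⟩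

/-- The morphism to the regular comodule. -/
def toRegular (i : RegularIndex R H) : i.obj ⟶ regular := i.q

instance : Category.{u} (RegularIndex R H) where
  Hom i j := {f : i.obj ⟶ j.obj // f ≫ j.toRegular = i.toRegular}
  id i := ⟨𝟙 _, Category.id_comp _⟩
  comp f g := ⟨f.1 ≫ g.1, by rw [Category.assoc, g.2, f.2]⟩

/-- The diagram of dualizable comodules over the regular comodule. -/
def diagram : RegularIndex R H ⥤ Comod R H where
  obj i := i.obj
  map f := f.1

/-- The cocone with vertex the regular comodule. -/
def cocone : Cocone (diagram (R := R) (H := H)) where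
  pt := regular
  ι := { app := fun i => i.toRegular
         naturality := fun _ _ f => f.2.trans (Category.comp_id _).symm }

end RegularIndex

/-- A coaction transported along a linear equivalence. -/
def transport (V : Comod R H) {X : Type u} [AddCommGroup X] [Module R X] (e : V.X ≃ₗ[R] X) :
    X →ₗ[R] H ⊗[R] X := e.toLinearMap.lTensor H ∘ₗ V.coact ∘ₗ e.symm.toLinearMap

lemma transport_comp (V : Comod R H) {X : Type u} [AddCommGroup X] [Module R X]
    (e : V.X ≃ₗ[R] X) : V.transport e ∘ₗ e.toLinearMap = e.toLinearMap.lTensor H ∘ₗ V.coact := by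
  ext; simp [transport]

/-- A dualizable comodule is finitely generated, so it is a quotient of some `Rⁿ`, to which the
coaction is transported. Hence the small index category represents all dualizable comodules over the
regular one. -/
lemma RegularIndex.exists_iso {V : Comod R H} (hV : V.HasDual) (q : V ⟶ regular) :
    ∃ (i : RegularIndex R H) (e : V ≅ i.obj), e.hom ≫ i.toRegular = q := by
  obtain ⟨N, ⟨_⟩⟩ := hV
  have := finite_of_exactPairing V N
  obtain ⟨n, f, hf⟩ := Module.Finite.exists_fin' R V.X
  let e : V.X ≃ₗ[R] ((Fin n → R) ⧸ LinearMap.ker f) := (f.quotKerEquivOfSurjective hf).symm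
  have he : Function.Surjective e.toLinearMap := e.surjective
  have h1 := LinearMap.cancel_right he |>.mp (counit_coact_comp V _ _ (V.transport_comp e))
  have h2 := LinearMap.cancel_right he |>.mp (coassoc_comp V _ _ (V.transport_comp e))
  let V' : Comod R H := ⟨ModuleCat.of R ((Fin n → R) ⧸ LinearMap.ker f), V.transport e, h1, h2⟩
  let e' : V ≅ V' := mkIso e (V.transport_comp e)
  exact ⟨⟨n, LinearMap.ker f, V.transport e, h1, h2, ⟨N, ⟨exactPairingCongrLeft e'.symm⟩⟩,
    e'.inv ≫ q⟩, e', e'.hom_inv_id_assoc q⟩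

/-- The linear form given by a morphism to the regular comodule. -/
def counitForm {V : Comod R H} (q : V ⟶ regular) : V.X →ₗ[R] R :=
  Coalgebra.counit (R := R) (A := H) ∘ₗ (show V.X →ₗ[R] H from q.hom)

/-- The regular comodule is cofree on `R`: a morphism into it is determined by its composite with
the counit, and `regularLift` shows that every linear form occurs. -/
lemma hom_eq_counitForm {V : Comod R H} (q : V ⟶ regular) :
    q.hom = (TensorProduct.rid R H).toLinearMap ∘ₗ (counitForm q).lTensor H ∘ₗ V.coact := by
  have h (f : V.X →ₗ[R] H) (h1 : Coalgebra.comul (R := R) ∘ₗ f = f.lTensor H ∘ₗ V.coact) :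
      f = (TensorProduct.rid R H).toLinearMap ∘ₗ
        (Coalgebra.counit (R := R) (A := H) ∘ₗ f).lTensor H ∘ₗ V.coact := by
    rw [LinearMap.lTensor_comp, LinearMap.comp_assoc, ← h1,
      ← LinearMap.comp_assoc _ _ (LinearMap.lTensor H _), Coalgebra.lTensor_counit_comp_comul]
    ext; simp
  exact h q.hom q.comm

lemma regular_hom_ext {V : Comod R H} {q r : V ⟶ regular} (h : counitForm q = counitForm r) :
    q = r := by
  ext1
  exact (hom_eq_counitForm q).trans (h ▸ (hom_eq_counitForm r).symm)

/-- The morphism to the regular comodule given by a linear form. -/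
def regularLift {V : Comod R H} (φ : V.X →ₗ[R] R) : V ⟶ regular :=
  ⟨(TensorProduct.rid R H).toLinearMap ∘ₗ φ.lTensor H ∘ₗ V.coact, by
    have h : Coalgebra.comul (R := R) ∘ₗ (TensorProduct.rid R H).toLinearMap ∘ₗ φ.lTensor H =
        ((TensorProduct.rid R H).toLinearMap ∘ₗ φ.lTensor H).lTensor H ∘ₗ
        (TensorProduct.assoc R H H V.X).toLinearMap ∘ₗ
          (Coalgebra.comul (R := R) (A := H)).rTensor V.X := by
      refine TensorProduct.ext' fun a v => ?_
      simp only [LinearMap.comp_apply, LinearMap.lTensor_tmul, LinearMap.rTensor_tmul,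
        LinearEquiv.coe_coe, TensorProduct.rid_tmul, map_smul]
      induction Coalgebra.comul (R := R) a using TensorProduct.induction_on with
      | zero => simp
      | add x y hx hy => simp only [TensorProduct.add_tmul, map_add, smul_add, hx, hy]
      | tmul x y => simp [TensorProduct.tmul_smul]
    refine (congrArg (· ∘ₗ V.coact) h).trans ?_
    rw [LinearMap.comp_assoc, LinearMap.comp_assoc, V.coassoc, ← LinearMap.comp_assoc,
      ← LinearMap.lTensor_comp]
    rfl⟩

@[simp]
lemma counitForm_regularLift {V : Comod R H} (φ : V.X →ₗ[R] R) :
    counitForm (regularLift φ) = φ := by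
  have h : Coalgebra.counit (R := R) (A := H) ∘ₗ (TensorProduct.rid R H).toLinearMap ∘ₗ
      φ.lTensor H = φ ∘ₗ (TensorProduct.lid R V.X).toLinearMap ∘ₗ
        (Coalgebra.counit (R := R) (A := H)).rTensor V.X := by
    refine TensorProduct.ext' fun a v => ?_
    simp [mul_comm]
  refine (congrArg (· ∘ₗ V.coact) h).trans ?_
  rw [LinearMap.comp_assoc, LinearMap.comp_assoc, V.counit_coact, LinearMap.comp_id]

lemma counitForm_comp {V W : Comod R H} (f : V ⟶ W) (q : W ⟶ regular) :
    counitForm (f ≫ q) = counitForm q ∘ₗ f.hom := rfl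

lemma counitForm_zero (V : Comod R H) : counitForm (0 : V ⟶ regular) = 0 :=
  LinearMap.comp_zero _

section Filtered

/-- A morphism between dualizable comodules over the regular comodule that is zero on `regular`
becomes zero after passing to a larger dualizable comodule over the regular comodule. -/
lemma exists_comp_eq_zero (hH : IsAdamsHopfAlgebra R H) {P V : Comod R H} (hP : P.HasDual)
    (hV : V.HasDual) (g : P ⟶ V) (q : V ⟶ regular) (hg : g ≫ q = 0) :
    ∃ (W : Comod R H) (_ : W.HasDual) (r : W ⟶ regular) (f : V ⟶ W), f ≫ r = q ∧ g ≫ f = 0 := by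
  have := hH.flat
  obtain ⟨N, ⟨_⟩⟩ := hV
  obtain ⟨P', ⟨_⟩⟩ := hP
  let : HasRightDual V := ⟨N⟩
  let : HasRightDual P := ⟨P'⟩
  -- Morphisms `V ⟶ regular` are linear forms on `V`, hence elements of the dual `N`; the element
  -- for `q` is `n`.
  obtain ⟨n, hn⟩ := exists_evalMap V N (counitForm q)
  -- The vanishing of `g ≫ q` says that the transpose of `g` kills `n`.
  have hn' : n ∈ LinearMap.ker (gᘁ).hom := by
    refine eq_zero_of_evalMap P P' fun y => ?_
    have h1 := LinearMap.congr_fun (congrArg Hom.hom (rightAdjointMate_comp_evaluation g))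
      (n ⊗ₜ[R] y)
    refine h1.trans ((hn (g.hom y)).trans ?_)
    rw [← LinearMap.comp_apply, ← counitForm_comp, hg, counitForm_zero]
    rfl
  -- The kernel of the transpose is a comodule, so `n` comes from some `x` in a dualizable `L` over
  -- it. The dual `W` of `L` is the larger comodule, and `V ⟶ W` is the dual of `L ⟶ N`.
  obtain ⟨L, ⟨W, ⟨_⟩⟩, p, x, hx⟩ := exists_hasDual hH (ker (gᘁ)) ⟨n, hn'⟩
  let : ExactPairing W L := BraidedCategory.exactPairing_swap L W
  let : HasLeftDual L := ⟨W⟩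
  let : HasLeftDual N := ⟨V⟩
  let w : L ⟶ N := p ≫ kerι (gᘁ)
  have hw : w.hom x = n := congrArg Subtype.val hx
  have hw0 : w ≫ (gᘁ) = 0 := by rw [Category.assoc, kerι_comp, comp_zero]
  -- Evaluation against `x` is a linear form on `W`, and so gives `W ⟶ regular`.
  let φ : W.X →ₗ[R] R := evalMap W L ∘ₗ TensorProduct.mk R L.X W.X x
  refine ⟨W, ⟨L, ⟨inferInstance⟩⟩, regularLift φ, ᘁw, ?_, ?_⟩
  · refine regular_hom_ext (LinearMap.ext fun v => ?_)
    rw [counitForm_comp, counitForm_regularLift, ← hn v, ← hw]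
    exact LinearMap.congr_fun (congrArg Hom.hom (leftAdjointMate_comp_evaluation w)) (x ⊗ₜ[R] v)
  -- The composite `P ⟶ V ⟶ W` is dual to `L ⟶ N ⟶ P'`, which is zero; transposing under the duality
  -- of `W` and `L` is injective.
  · have h1 : L ◁ (g ≫ (ᘁw : V ⟶ W)) ≫ ε_ W L = 0 := by
      rw [MonoidalCategory.whiskerLeft_comp, Category.assoc]
      have h2 : L ◁ (ᘁw : V ⟶ W) ≫ ε_ W L = w ▷ V ≫ ε_ V N :=
        leftAdjointMate_comp_evaluation w
      have h3 : (gᘁ) ▷ P ≫ ε_ P P' = N ◁ g ≫ ε_ V N := rightAdjointMate_comp_evaluation g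
      rw [h2, whisker_exchange_assoc, ← h3, ← comp_whiskerRight_assoc, hw0]
      simp
    have h2 := tensorLeftHomEquiv_whiskerLeft_comp_evaluation (Z := L) (g ≫ (ᘁw : V ⟶ W))
    have h3 : (g ≫ (ᘁw : V ⟶ W)) ≫ (ρ_ W).inv = 0 := by
      refine h2.symm.trans ?_
      refine (congrArg (tensorLeftHomEquiv P W L (𝟙_ _)) h1).trans ?_
      simp [tensorLeftHomEquiv]
    rw [← cancel_mono (ρ_ W).inv, h3, zero_comp]

namespace RegularIndex

/-- `toRegular` as a linear map. -/
def toRegularMap (i : RegularIndex R H) : i.obj.X →ₗ[R] H := i.toRegular.hom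

lemma toRegularMap_hom {i j : RegularIndex R H} (f : i ⟶ j) (v : i.obj.X) :
    j.toRegularMap (f.1.hom v) = i.toRegularMap v :=
  LinearMap.congr_fun (congrArg Hom.hom f.2) v

/-- The components of a cocone as linear maps. -/
def coconeMap (s : Cocone (diagram (R := R) (H := H))) (i : RegularIndex R H) :
    i.obj.X →ₗ[R] s.pt.X := (s.ι.app i).hom

lemma coconeMap_hom (s : Cocone (diagram (R := R) (H := H))) {i j : RegularIndex R H}
    (f : i ⟶ j) (v : i.obj.X) : coconeMap s j (f.1.hom v) = coconeMap s i v :=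
  LinearMap.congr_fun (congrArg Hom.hom (s.w f)) v

lemma exists_hom_obj {W : Comod R H} (hW : W.HasDual) (r : W ⟶ regular) {i : RegularIndex R H}
    (f : i.obj ⟶ W) (hf : f ≫ r = i.toRegular) :
    ∃ (k : RegularIndex R H) (g : i ⟶ k) (e : W ≅ k.obj), g.1 = f ≫ e.hom := by
  obtain ⟨k, e, he⟩ := exists_iso hW r
  exact ⟨k, ⟨f ≫ e.hom, by rw [Category.assoc, he, hf]⟩, e, rfl⟩

lemma hasDual_obj (i : RegularIndex R H) : i.obj.HasDual := i.hasDual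

/-- Direct sums bound pairs of objects. The difference of two parallel arrows vanishes on `regular`,
so `exists_comp_eq_zero` coequalizes them. -/
lemma isFiltered (hH : IsAdamsHopfAlgebra R H) : IsFiltered (RegularIndex R H) where
  cocone_objs i j := by
    obtain ⟨k, e, he⟩ := exists_iso (i.hasDual_obj.biprod j.hasDual_obj)
      (biprod.desc i.toRegular j.toRegular)
    exact ⟨k, ⟨biprod.inl ≫ e.hom, by simp [he]⟩, ⟨biprod.inr ≫ e.hom, by simp [he]⟩, True.intro⟩
  cocone_maps i j f g := by
    obtain ⟨W, hW, r, p, hp, h⟩ := exists_comp_eq_zero hH i.hasDual_obj j.hasDual_obj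
      (f.1 - g.1) j.toRegular (by rw [Preadditive.sub_comp, f.2, g.2, sub_self])
    obtain ⟨k, e, he, hk⟩ := exists_hom_obj hW r p hp
    refine ⟨k, e, Subtype.ext ?_⟩
    change f.1 ≫ e.1 = g.1 ≫ e.1
    rw [← sub_eq_zero, ← Preadditive.sub_comp, hk, ← Category.assoc, h, zero_comp]
  nonempty := (exists_iso hasDual_unit (0 : 𝟙_ (Comod R H) ⟶ regular)).nonempty

lemma exists_toRegular_eq (hH : IsAdamsHopfAlgebra R H) (h : H) :
    ∃ (i : RegularIndex R H) (v : i.obj.X), i.toRegularMap v = h := by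
  obtain ⟨V, hV, p, x, hx⟩ := exists_hasDual hH regular h
  obtain ⟨i, e, he⟩ := exists_iso hV p
  exact ⟨i, e.hom.hom x, (LinearMap.congr_fun (congrArg Hom.hom he) x).trans hx⟩

/-- The element `v` is hit by a dualizable `P` over the kernel comodule. The composite from `P` to
`regular` is zero, so it already dies at a later stage of the diagram. -/
lemma exists_map_eq_zero (hH : IsAdamsHopfAlgebra R H) {i : RegularIndex R H} {v : i.obj.X}
    (hv : i.toRegularMap v = 0) : ∃ (k : RegularIndex R H) (g : i ⟶ k), g.1.hom v = 0 := by
  have := hH.flat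
  obtain ⟨P, hP, p, x, hx⟩ := exists_hasDual hH (ker i.toRegular) ⟨v, hv⟩
  obtain ⟨W, hW, r, f, hf, h⟩ := exists_comp_eq_zero hH hP i.hasDual_obj
    (p ≫ kerι i.toRegular) i.toRegular (by rw [Category.assoc, kerι_comp, comp_zero])
  obtain ⟨k, g, e, hk⟩ := exists_hom_obj hW r f hf
  refine ⟨k, g, ?_⟩
  have hx' : (p ≫ kerι i.toRegular).hom x = v := congrArg Subtype.val hx
  rw [← hx', hk]
  have h1 := LinearMap.congr_fun (congrArg Hom.hom h) x
  exact (congrArg e.hom.hom h1).trans (map_zero _)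

/-- Over a common bound the difference of the two elements maps to zero in `H`, hence dies further
on. This makes the map out of the colimit independent of representatives. -/
lemma coconeMap_eq (hH : IsAdamsHopfAlgebra R H) (s : Cocone (diagram (R := R) (H := H)))
    {i j : RegularIndex R H} {v : i.obj.X} {w : j.obj.X}
    (h : i.toRegularMap v = j.toRegularMap w) : coconeMap s i v = coconeMap s j w := by
  have := isFiltered hH
  let f : i ⟶ IsFiltered.max i j := IsFiltered.leftToMax i j
  let g : j ⟶ IsFiltered.max i j := IsFiltered.rightToMax i j
  obtain ⟨l, p, hp⟩ := exists_map_eq_zero hH (v := f.1.hom v - g.1.hom w) (by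
    rw [map_sub, toRegularMap_hom, toRegularMap_hom, h, sub_self])
  rw [map_sub, sub_eq_zero] at hp
  rw [← coconeMap_hom s f, ← coconeMap_hom s p, hp, coconeMap_hom, coconeMap_hom]

lemma exists_desc (hH : IsAdamsHopfAlgebra R H) (s : Cocone (diagram (R := R) (H := H))) :
    ∃ f : regular ⟶ s.pt, ∀ i : RegularIndex R H, i.toRegular ≫ f = s.ι.app i := by
  have := isFiltered hH
  -- A representative of each element of `H` is fixed; by `coconeMap_eq` the choice does not matter,
  -- which also gives linearity.
  choose i v hv using exists_toRegular_eq hH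
  let f : H → s.pt.X := fun h => coconeMap s (i h) (v h)
  have hf (j : RegularIndex R H) (w : j.obj.X) : f (j.toRegularMap w) = coconeMap s j w :=
    coconeMap_eq hH s (hv _)
  let F : H →ₗ[R] s.pt.X :=
    { toFun := f
      map_add' := fun a b => by
        let p : i a ⟶ IsFiltered.max (i a) (i b) := IsFiltered.leftToMax _ _
        let q : i b ⟶ IsFiltered.max (i a) (i b) := IsFiltered.rightToMax _ _
        have h3 := hf _ (p.1.hom (v a) + q.1.hom (v b))
        rw [map_add, map_add, toRegularMap_hom, toRegularMap_hom, coconeMap_hom, coconeMap_hom,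
          hv, hv] at h3
        exact h3
      map_smul' := fun r a => by
        have h3 := hf _ (r • v a)
        rw [map_smul, map_smul, hv] at h3
        exact h3 }
  have hF (j : RegularIndex R H) : F ∘ₗ j.toRegularMap = coconeMap s j := LinearMap.ext (hf j)
  refine ⟨⟨F, ?_⟩, fun j => Comod.hom_ext (hF j)⟩
  refine LinearMap.ext fun (h : H) => ?_
  have h1 : s.pt.coact ∘ₗ coconeMap s (i h) = (coconeMap s (i h)).lTensor H ∘ₗ (i h).obj.coact :=
    (s.ι.app (i h)).comm
  have h2 : Coalgebra.comul (R := R) ∘ₗ (i h).toRegularMap =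
      (i h).toRegularMap.lTensor H ∘ₗ (i h).obj.coact := (i h).toRegular.comm
  -- Colinearity is checked on the image of a single index, whose two structure maps are colinear.
  have h3 : (s.pt.coact ∘ₗ F) ∘ₗ (i h).toRegularMap =
      (F.lTensor H ∘ₗ Coalgebra.comul (R := R)) ∘ₗ (i h).toRegularMap := by
    rw [LinearMap.comp_assoc, LinearMap.comp_assoc, hF, h1, h2, ← hF, LinearMap.lTensor_comp,
      LinearMap.comp_assoc]
  have h4 := LinearMap.congr_fun h3 (v h)
  rw [LinearMap.comp_apply, LinearMap.comp_apply _ (i h).toRegularMap, hv] at h4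
  exact h4

/-- The regular comodule is the colimit of the dualizable comodules over it. -/
def isColimit (hH : IsAdamsHopfAlgebra R H) : IsColimit (cocone (R := R) (H := H)) where
  desc s := (exists_desc hH s).choose
  fac s i := (exists_desc hH s).choose_spec i
  uniq s m hm := by
    ext1
    refine LinearMap.ext fun h => ?_
    obtain ⟨i, v, rfl⟩ := exists_toRegular_eq hH h
    exact LinearMap.congr_fun (congrArg Hom.hom
      ((hm i).trans ((exists_desc hH s).choose_spec i).symm)) v

end RegularIndex

end Filtered

end Comod
end Dualizable
end UnivTorsor

namespace UnivTorsor

/-! ### Strong monoidal functors preserve duals. -/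

noncomputable section ExactPairingMap

open ExactPairing Functor.LaxMonoidal Functor.OplaxMonoidal Functor.Monoidal

variable {D C : Type*} [Category* D] [MonoidalCategory D] [Category* C] [MonoidalCategory C]

/-- Strong monoidal functors preserve exact pairings. -/
@[reducible]
def mapExactPairing (F : D ⥤ C) [F.Monoidal] (X Y : D) [ExactPairing X Y] :
    ExactPairing (F.obj X) (F.obj Y) where
  coevaluation' := ε F ≫ F.map (η_ X Y) ≫ δ F X Y
  evaluation' := μ F Y X ≫ F.map (ε_ X Y) ≫ η F
  coevaluation_evaluation' := by
    have h := congrArg F.map (coevaluation_evaluation X Y)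
    simp only [Functor.map_comp, map_whiskerLeft, map_whiskerRight, map_associator_inv,
      Category.assoc, map_rightUnitor, map_leftUnitor_inv] at h
    rw [← cancel_epi (F.obj Y ◁ η F), ← cancel_epi (δ F Y (𝟙_ D)),
      ← cancel_mono (ε F ▷ F.obj Y), ← cancel_mono (μ F (𝟙_ D) Y)]
    simp only [MonoidalCategory.whiskerLeft_comp, comp_whiskerRight, Category.assoc] at h ⊢
    simpa using h
  evaluation_coevaluation' := by
    have h := congrArg F.map (evaluation_coevaluation X Y)
    simp only [Functor.map_comp, map_whiskerLeft, map_whiskerRight, map_associator,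
      Category.assoc, map_rightUnitor_inv, map_leftUnitor] at h
    rw [← cancel_epi (η F ▷ F.obj X), ← cancel_epi (δ F (𝟙_ D) X),
      ← cancel_mono (F.obj X ◁ ε F), ← cancel_mono (μ F X (𝟙_ D))]
    simp only [MonoidalCategory.whiskerLeft_comp, comp_whiskerRight, Category.assoc] at h ⊢
    simpa using h

end ExactPairingMap

/-! ### Monomorphisms that are kernels. -/

noncomputable section KernelMono

variable {C : Type*} [Category* C] [HasZeroMorphisms C]

/-- A morphism is a kernel. -/
def IsKernelMono {X Y : C} (f : X ⟶ Y) : Prop :=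
  ∃ (Z : C) (g : Y ⟶ Z) (w : f ≫ g = 0), Nonempty (IsLimit (KernelFork.ofι f w))

lemma IsKernelMono.mono {X Y : C} {f : X ⟶ Y} (hf : IsKernelMono f) : Mono f := by
  obtain ⟨Z, g, w, ⟨h⟩⟩ := hf
  exact ⟨fun a b e => Fork.IsLimit.hom_ext h e⟩

/-- The test ranges over all `g` killed by `f`, so the lemma applies without knowledge of the
morphism whose kernel `f` is. -/
lemma IsKernelMono.exists_lift {X Y : C} {f : X ⟶ Y} (hf : IsKernelMono f) {T : C} (t : T ⟶ Y)
    (ht : ∀ (Z : C) (g : Y ⟶ Z), f ≫ g = 0 → t ≫ g = 0) : ∃ l : T ⟶ X, l ≫ f = t := by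
  obtain ⟨Z, g, w, ⟨h⟩⟩ := hf
  exact ⟨_, (KernelFork.IsLimit.lift' h t (ht Z g w)).2⟩

lemma isKernelMono_of {X Y Z : C} {f : X ⟶ Y} [Mono f] (g : Y ⟶ Z) (w : f ≫ g = 0)
    (h : ∀ (T : C) (t : T ⟶ Y), t ≫ g = 0 → ∃ l : T ⟶ X, l ≫ f = t) : IsKernelMono f :=
  ⟨Z, g, w, ⟨KernelFork.IsLimit.ofι' _ _ fun t ht => ⟨_, (h _ t ht).choose_spec⟩⟩⟩

lemma IsKernelMono.of_iso {X Y X' Y' : C} {f : X ⟶ Y} (hf : IsKernelMono f) {f' : X' ⟶ Y'}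
    (a : X' ≅ X) (b : Y' ≅ Y) (h : f' ≫ b.hom = a.hom ≫ f) : IsKernelMono f' := by
  have := hf.mono
  have hf' : f' = a.hom ≫ f ≫ b.inv := by rw [← Category.assoc, ← h]; simp
  have : Mono f' := by rw [hf']; infer_instance
  obtain ⟨Z, g, w, ⟨hl⟩⟩ := hf
  refine isKernelMono_of (b.hom ≫ g) (by rw [hf']; simp [w]) fun T t ht => ?_
  obtain ⟨l, hl⟩ := KernelFork.IsLimit.lift' hl (t ≫ b.hom) (by simpa using ht)
  refine ⟨l ≫ a.inv, ?_⟩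
  have hl' : l ≫ f = t ≫ b.hom := hl
  rw [hf']
  simp [reassoc_of% hl']

end KernelMono

/-! ### Exact filtered colimits: stability of kernels and of flat objects. -/

noncomputable section FilteredKernel

variable {C : Type w} [Category.{u} C] [Preadditive C] [HasColimits C] [HasEqualizers C] [AB5 C]

lemma colim_preservesFiniteLimits (J : Type u) [SmallCategory J] [IsFiltered J] :
    PreservesFiniteLimits (colim (J := J) (C := C)) :=
  (inferInstance : HasExactColimitsOfShape J C).preservesFiniteLimits

/-- A filtered colimit of kernels is a kernel. -/
lemma isKernelMono_colimit {J : Type u} [SmallCategory J] [IsFiltered J] {K D : J ⥤ C}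
    (α : K ⟶ D) (h : ∀ j, IsKernelMono (α.app j)) {cK : Cocone K} {cD : Cocone D}
    (hK : IsColimit cK) (hD : IsColimit cD) (f : cK.pt ⟶ cD.pt)
    (hf : ∀ j, cK.ι.app j ≫ f = α.app j ≫ cD.ι.app j) : IsKernelMono f := by
  have := colim_preservesFiniteLimits (C := C) J
  have (j : J) := (h j).mono
  have : Mono α := NatTrans.mono_of_mono_app α
  -- The transformation `α` is the kernel of its cokernel. Cokernels are pointwise, so whatever
  -- kills `α.app j` factors through the cokernel at `j`; the lifts are natural because `α` is
  -- pointwise mono.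
  have hker : IsLimit (KernelFork.ofι α (cokernel.condition α)) :=
    KernelFork.IsLimit.ofι' _ _ fun {T} t ht => by
      have hex (j : J) : ∃ l : T.obj j ⟶ K.obj j, l ≫ α.app j = t.app j := by
        refine (h j).exists_lift _ fun Z g hg => ?_
        let e := CokernelCofork.mapIsColimit _ (cokernelIsCokernel α) ((evaluation J C).obj j)
        obtain ⟨g', h1⟩ : ∃ g' : (cokernel α).obj j ⟶ Z, (cokernel.π α).app j ≫ g' = g :=
          ⟨_, (CokernelCofork.IsColimit.desc' e g hg).2⟩
        have h2 : t.app j ≫ (cokernel.π α).app j = 0 := by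
          rw [← NatTrans.comp_app, ht]; rfl
        rw [← h1, reassoc_of% h2, zero_comp]
      choose l hl using hex
      refine ⟨{ app := l, naturality := fun i j φ => ?_ }, ?_⟩
      · rw [← cancel_mono (α.app j), Category.assoc, hl, Category.assoc, α.naturality,
          reassoc_of% (hl i), t.naturality]
      · ext j
        exact hl j
  have h1 : IsKernelMono (colim.map α) :=
    ⟨_, colim.map (cokernel.π α), by rw [← colim.map_comp, cokernel.condition, colim.map_zero],
      ⟨KernelFork.mapIsLimit _ hker colim⟩⟩
  refine h1.of_iso (hK.coconePointUniqueUpToIso (colimit.isColimit K))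
    (hD.coconePointUniqueUpToIso (colimit.isColimit D)) (hK.hom_ext fun j => ?_)
  rw [reassoc_of% (hf j)]
  simp

variable [MonoidalCategory C] [SymmetricCategory C] [MonoidalClosed C]

/-- The functor `c.pt ⊗ -` is `X ↦ (j ↦ D j ⊗ X)` followed by `colim`. The first preserves finite
limits pointwise, the second by exactness. -/
lemma preservesFiniteLimits_tensorLeft_colimit {J : Type u} [SmallCategory J] [IsFiltered J]
    {D : J ⥤ C} (h : ∀ j, PreservesFiniteLimits (tensorLeft (D.obj j))) {c : Cocone D}
    (hc : IsColimit c) : PreservesFiniteLimits (tensorLeft c.pt) := by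
  have := colim_preservesFiniteLimits (C := C) J
  let Θ : C ⥤ J ⥤ C := (D ⋙ curriedTensor C).flip
  have hΘ : PreservesFiniteLimits Θ := ⟨fun I _ _ => ⟨fun {K} =>
    preservesLimit_of_evaluation _ _ fun j =>
      (inferInstance : PreservesLimit K (tensorLeft (D.obj j)))⟩⟩
  have hcX (X : C) : IsColimit ((tensorRight X).mapCocone c) := isColimitOfPreserves _ hc
  let e : Θ ⋙ colim ≅ tensorLeft c.pt := NatIso.ofComponents
    (fun X => (colimit.isColimit (Θ.obj X)).coconePointUniqueUpToIso (hcX X)) (by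
      intro X Y f
      refine colimit.hom_ext fun j => ?_
      have h1 := (colimit.isColimit (Θ.obj X)).comp_coconePointUniqueUpToIso_hom (hcX X) j
      have h2 := (colimit.isColimit (Θ.obj Y)).comp_coconePointUniqueUpToIso_hom (hcX Y) j
      have h3 : colimit.ι (Θ.obj X) j ≫ colim.map (Θ.map f) =
        D.obj j ◁ f ≫ colimit.ι (Θ.obj Y) j := ι_colimMap _ _
      refine ((reassoc_of% h3) _).trans ?_
      refine (congrArg (D.obj j ◁ f ≫ ·) h2).trans ?_
      refine Eq.trans ?_ ((reassoc_of% h1) _).symm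
      exact whisker_exchange (c.ι.app j) f)
  exact preservesFiniteLimits_of_natIso e

end FilteredKernel

end UnivTorsor

namespace UnivTorsor

/-! ### Descent along an algebra whose unit maps are kernels. -/

noncomputable section UnitMap

open MonObj

variable {C : Type*} [Category* C] [MonoidalCategory C]

/-- The morphism `Y ⟶ A ⊗ Y` given by the unit of `A`. -/
def unitMap (A : C) [MonObj A] (Y : C) : Y ⟶ A ⊗ Y := (λ_ Y).inv ≫ η[A] ▷ Y

lemma unitMap_naturality (A : C) [MonObj A] {Y Z : C} (g : Y ⟶ Z) :
    g ≫ unitMap A Z = unitMap A Y ≫ A ◁ g := by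
  rw [unitMap, unitMap, leftUnitor_inv_naturality_assoc, whisker_exchange, Category.assoc]

variable [Preadditive C] [MonoidalPreadditive C]

/-- This is descent for morphisms. If `g : A ⊗ Y ⟶ Z` kills the unit map, then `t ≫ g`, followed by
the mono `Z ⟶ A ⊗ Z`, equals `t ≫ A ◁ (unitMap A Y ≫ g) = 0` by the condition on `t`. -/
lemma exists_lift_unitMap {A : C} [MonObj A] (h : ∀ Y, IsKernelMono (unitMap A Y)) {T Y : C}
    (t : T ⟶ A ⊗ Y) (ht : t ≫ unitMap A (A ⊗ Y) = t ≫ A ◁ unitMap A Y) :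
    ∃ l : T ⟶ Y, l ≫ unitMap A Y = t := by
  refine (h Y).exists_lift t fun Z g hg => ?_
  have := (h Z).mono
  rw [← cancel_mono (unitMap A Z), Category.assoc, unitMap_naturality, reassoc_of% ht,
    ← MonoidalCategory.whiskerLeft_comp, hg, zero_comp,
    MonoidalPreadditive.whiskerLeft_zero, comp_zero]

/-- If `A ◁ f` is invertible, then `f` is mono. Moreover `Y ⟶ A ⊗ Y ≅ A ⊗ X` satisfies the descent
condition, so it lifts to a morphism `Y ⟶ X`, the inverse of `f`. -/
lemma reflectsIsomorphisms_of_isKernelMono {A : C} [MonObj A]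
    (h : ∀ Y, IsKernelMono (unitMap A Y)) : (tensorLeft A).ReflectsIsomorphisms where
  reflects {X Y} f hf := by
    have : IsIso (A ◁ f) := hf
    have := (h X).mono
    have := (h Y).mono
    have hX : Mono f := by
      have : Mono (f ≫ unitMap A Y) := by rw [unitMap_naturality]; infer_instance
      exact mono_of_mono f (unitMap A Y)
    obtain ⟨l, hl⟩ := exists_lift_unitMap h (unitMap A Y ≫ inv (A ◁ f)) (by
      have h1 : A ◁ f ≫ A ◁ unitMap A Y = A ◁ unitMap A X ≫ A ◁ A ◁ f := by
        rw [← MonoidalCategory.whiskerLeft_comp, unitMap_naturality,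
          MonoidalCategory.whiskerLeft_comp]
      have : IsIso (A ◁ A ◁ f) := inferInstanceAs (IsIso ((tensorLeft A).map (A ◁ f)))
      rw [← cancel_mono (A ◁ A ◁ f), Category.assoc, Category.assoc, Category.assoc,
        Category.assoc, ← unitMap_naturality, ← h1, IsIso.inv_hom_id_assoc,
        IsIso.inv_hom_id_assoc, unitMap_naturality])
    have h2 : l ≫ f = 𝟙 Y := by
      rw [← cancel_mono (unitMap A Y), Category.assoc, unitMap_naturality, reassoc_of% hl]
      simp
    refine ⟨l, ?_, h2⟩
    rw [← cancel_mono f, Category.assoc, h2]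
    simp

end UnitMap

/-! ### Kernels obtained by dualizing cokernels. -/

noncomputable section DualKernel

open ExactPairing

variable {C : Type*} [Category* C] [MonoidalCategory C] [Preadditive C] [MonoidalPreadditive C]
  [SymmetricCategory C] [MonoidalClosed C]

/-- The morphism `X' ⟶ 𝟙` dual to `u : 𝟙 ⟶ X`. -/
def unitMate {X X' : C} [ExactPairing X X'] (u : 𝟙_ C ⟶ X) : X' ⟶ 𝟙_ C :=
  (ρ_ X').inv ≫ X' ◁ u ≫ ε_ X X'

/-- If the dual of `u : 𝟙 ⟶ X` is a cokernel, then `Y ⟶ X ⊗ Y` is a kernel. -/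
lemma isKernelMono_of_unitMate {X X' K : C} [ExactPairing X X'] (u : 𝟙_ C ⟶ X) (k : K ⟶ X')
    (w : k ≫ unitMate u = 0) (h : IsColimit (CokernelCofork.ofπ (unitMate u) w)) (Y : C) :
    IsKernelMono ((λ_ Y).inv ≫ u ▷ Y) := by
  let e := CokernelCofork.mapIsColimit _ h (tensorRight Y)
  have hepi (Y : C) : Epi (unitMate (X' := X') u ▷ Y) :=
    ⟨fun a b hab => Cofork.IsColimit.hom_ext (CokernelCofork.mapIsColimit _ h (tensorRight Y)) hab⟩
  have hdesc {Y Z : C} (g : X' ⊗ Y ⟶ Z) (hg : k ▷ Y ≫ g = 0) :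
      ∃ l : 𝟙_ C ⊗ Y ⟶ Z, unitMate u ▷ Y ≫ l = g :=
    ⟨_, (CokernelCofork.IsColimit.desc'
      (CokernelCofork.mapIsColimit _ h (tensorRight Y)) g hg).2⟩
  have hu : X' ◁ ((λ_ Y).inv ≫ u ▷ Y) ≫ (α_ _ _ _).inv ≫ ε_ X X' ▷ Y = unitMate u ▷ Y := by
    rw [unitMate, MonoidalCategory.whiskerLeft_comp, Category.assoc,
      associator_inv_naturality_middle_assoc, ← comp_whiskerRight, comp_whiskerRight (ρ_ X').inv]
    simp
  have : Mono ((λ_ Y).inv ≫ u ▷ Y) := ⟨fun {T} a b hab => by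
    have h1 (c : T ⟶ Y) : unitMate (X' := X') u ▷ T ≫ 𝟙_ C ◁ c =
        X' ◁ (c ≫ (λ_ Y).inv ≫ u ▷ Y) ≫ (α_ _ _ _).inv ≫ ε_ X X' ▷ Y := by
      rw [← whisker_exchange, MonoidalCategory.whiskerLeft_comp, Category.assoc, hu]
    have h2 : 𝟙_ C ◁ a = 𝟙_ C ◁ b := by
      rw [← cancel_epi (unitMate (X' := X') u ▷ T), h1, h1, hab]
    simpa using h2⟩
  -- The kernel is taken of `X ⊗ Y ⟶ [K, 𝟙 ⊗ Y]`. Under duality and currying, `Hom(T, -)` of the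
  -- sequence is `Hom(-, Y)` of `K ⊗ T ⟶ X' ⊗ T ⟶ 𝟙 ⊗ T`, a cokernel since `- ⊗ T` preserves
  -- colimits.
  let p : X ⊗ Y ⟶ (ihom K).obj (𝟙_ C ⊗ Y) :=
    MonoidalClosed.curry (k ▷ (X ⊗ Y) ≫ (α_ _ _ _).inv ≫ ε_ X X' ▷ Y)
  have hp {T : C} (t : T ⟶ X ⊗ Y) : t ≫ p = MonoidalClosed.curry
      (k ▷ T ≫ X' ◁ t ≫ (α_ _ _ _).inv ≫ ε_ X X' ▷ Y) := by
    rw [← MonoidalClosed.curry_natural_left, whisker_exchange_assoc]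
  refine isKernelMono_of p ?_ fun T t ht => ?_
  · rw [hp, hu, ← comp_whiskerRight, w]
    apply MonoidalClosed.uncurry_injective
    simp [MonoidalClosed.uncurry_eq]
  · have ht' : k ▷ T ≫ X' ◁ t ≫ (α_ _ _ _).inv ≫ ε_ X X' ▷ Y = 0 := by
      apply MonoidalClosed.curry_injective
      rw [← hp, ht]
      apply MonoidalClosed.uncurry_injective
      simp [MonoidalClosed.uncurry_eq]
    -- The transpose of `t` kills `K ⊗ T`, so it factors through `𝟙 ⊗ T`.
    obtain ⟨l, hl⟩ := hdesc _ ht'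
    refine ⟨(λ_ T).inv ≫ l ≫ (λ_ Y).hom, ?_⟩
    have h1 : 𝟙_ C ◁ ((λ_ T).inv ≫ l ≫ (λ_ Y).hom) = l := by simp
    apply (tensorLeftHomEquiv T X X' Y).symm.injective
    change X' ◁ (_ ≫ (λ_ Y).inv ≫ u ▷ Y) ≫ (α_ _ _ _).inv ≫ ε_ X X' ▷ Y ≫ (λ_ Y).hom =
      X' ◁ t ≫ (α_ _ _ _).inv ≫ ε_ X X' ▷ Y ≫ (λ_ Y).hom
    rw [MonoidalCategory.whiskerLeft_comp, Category.assoc, reassoc_of% hu, whisker_exchange_assoc,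
      h1, reassoc_of% hl]

end DualKernel

end UnivTorsor

namespace UnivTorsor

/-! ### Faithful flatness of the image of the regular comodule. -/

noncomputable section FaithfullyFlat

open ExactPairing Functor.LaxMonoidal Functor.OplaxMonoidal Functor.Monoidal

variable {R H : Type u} [CommRing R] [CommRing H] [HopfAlgebra R H]

namespace Comod

variable [Module.Flat R H]

/-- Surjective morphisms of comodules are cokernels. -/
def isColimitOfSurjective {M N : Comod R H} (f : M ⟶ N) (hf : Function.Surjective f.hom) :
    IsColimit (CokernelCofork.ofπ f (kerι_comp f)) :=
  have hepi : Epi f := ⟨fun a b h => by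
    ext1
    refine LinearMap.ext fun n => ?_
    obtain ⟨m, rfl⟩ := hf n
    exact LinearMap.congr_fun (congrArg Hom.hom h) m⟩
  CokernelCofork.IsColimit.ofπ' _ _ fun {L} g hg => by
    have hle : LinearMap.ker f.hom ≤ LinearMap.ker g.hom := fun m hm =>
      LinearMap.congr_fun (congrArg Hom.hom hg) ⟨m, hm⟩
    let l : N.X →ₗ[R] L.X := (LinearMap.ker f.hom).liftQ g.hom hle ∘ₗ
      (f.hom.quotKerEquivOfSurjective hf).symm.toLinearMap
    have hl : l ∘ₗ f.hom = g.hom := by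
      refine LinearMap.ext fun m => ?_
      have : (f.hom.quotKerEquivOfSurjective hf).symm (f.hom m) = Submodule.Quotient.mk m :=
        (LinearEquiv.symm_apply_eq _).mpr rfl
      change (LinearMap.ker f.hom).liftQ g.hom hle
        ((f.hom.quotKerEquivOfSurjective hf).symm (f.hom m)) = _
      rw [this]
      rfl
    refine ⟨⟨l, ?_⟩, Comod.hom_ext hl⟩
    refine (LinearMap.cancel_right hf).mp ?_
    rw [LinearMap.comp_assoc, hl, g.comm, LinearMap.comp_assoc, f.comm, ← LinearMap.comp_assoc,
      ← LinearMap.lTensor_comp, hl]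

omit [Module.Flat R H] in
-- The linear form of `q` takes the value `ε(1) = 1` on the image of `1` under `u`. The element of
-- `N` that represents this form is therefore sent to `1` by the dual of `u`.
lemma unitMate_surjective {V N : Comod R H} [ExactPairing V N] (u : 𝟙_ (Comod R H) ⟶ V)
    (q : V ⟶ regular) (h : u ≫ q = MonObj.one) :
    Function.Surjective (unitMate (X' := N) u).hom := by
  obtain ⟨n, hn⟩ := exists_evalMap V N (counitForm q)
  have h1 : (unitMate (X' := N) u).hom n = (1 : R) := by
    refine (hn (u.hom (1 : R))).trans ?_
    refine (congrArg (Coalgebra.counit (R := R) (A := H))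
      (LinearMap.congr_fun (congrArg Hom.hom h) (1 : R))).trans ?_
    change Coalgebra.counit (R := R) (algebraMap R H 1) = 1
    simp
  intro r
  refine ⟨(show R from r) • n, ?_⟩
  rw [map_smul, h1]
  exact mul_one (show R from r)

end Comod

variable {C : Type w} [Category.{u} C] [Preadditive C] [Linear R C]
  [MonoidalCategory C] [SymmetricCategory C] [MonoidalPreadditive C] [MonoidalLinear R C]
  [MonoidalClosed C] [HasColimits C]

/-- The dual of `u` is surjective, hence a cokernel of comodules. The left adjoint `F` preserves
cokernels and, being strong monoidal, duals, so `isKernelMono_of_unitMate` applies in `C`. -/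
lemma isKernelMono_map [Module.Flat R H] (F : TensorFunctor R (Comod R H) C) {V N : Comod R H}
    [ExactPairing V N] (u : 𝟙_ (Comod R H) ⟶ V)
    (q : V ⟶ Comod.regular) (h : u ≫ q = MonObj.one) (Y : C) :
    IsKernelMono ((λ_ Y).inv ≫ (ε F.functor ≫ F.functor.map u) ▷ Y) := by
  let := mapExactPairing F.functor V N
  have h1 : unitMate (X' := F.functor.obj N) (ε F.functor ≫ F.functor.map u) =
      F.functor.map (unitMate (X' := N) u) ≫ η F.functor := by
    change (ρ_ _).inv ≫ F.functor.obj N ◁ (ε F.functor ≫ F.functor.map u) ≫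
      μ F.functor N V ≫ F.functor.map (ε_ V N) ≫ η F.functor = _
    rw [unitMate]
    simp only [Functor.map_comp, map_rightUnitor_inv, map_whiskerLeft, Category.assoc,
      μ_δ_assoc, MonoidalCategory.whiskerLeft_comp]
  have hc := CokernelCofork.mapIsColimit _
    (Comod.isColimitOfSurjective _ (Comod.unitMate_surjective (N := N) u q h)) F.functor
  have hepi : Epi (F.functor.map (unitMate (X' := N) u)) :=
    ⟨fun a b hab => Cofork.IsColimit.hom_ext hc hab⟩
  have hepi' : Epi (unitMate (X' := F.functor.obj N) (ε F.functor ≫ F.functor.map u)) := by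
    rw [h1]; infer_instance
  have w : F.functor.map (Comod.kerι (unitMate (X' := N) u)) ≫
      unitMate (X' := F.functor.obj N) (ε F.functor ≫ F.functor.map u) = 0 := by
    rw [h1, ← Functor.map_comp_assoc, Comod.kerι_comp, Functor.map_zero, zero_comp]
  refine isKernelMono_of_unitMate _ _ w (CokernelCofork.IsColimit.ofπ' _ _ fun {L} g hg => ?_) Y
  let l : F.functor.obj (𝟙_ (Comod R H)) ⟶ L := (CokernelCofork.IsColimit.desc' hc g hg).1
  have hl : F.functor.map (unitMate (X' := N) u) ≫ l = g :=
    (CokernelCofork.IsColimit.desc' hc g hg).2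
  refine ⟨ε F.functor ≫ l, ?_⟩
  rw [h1, Category.assoc, η_ε_assoc, hl]

variable [HasEqualizers C] [AB5 C]

open Comod

open scoped Obj in
-- The unit of `F(H, δ)` is the filtered colimit of morphisms `𝟙 ⟶ F V` with `V` dualizable through
-- which the unit of `H` factors; each gives a kernel by `isKernelMono_map`.
lemma isKernelMono_unitMap (hH : IsAdamsHopfAlgebra R H) (F : TensorFunctor R (Comod R H) C)
    (Y : C) : IsKernelMono (unitMap (F.functor.obj regular) Y) := by
  have := hH.flat
  have := RegularIndex.isFiltered hH
  -- The unit `𝟙 ⟶ regular` of the algebra is itself an index `j`. The indices under `j` are cofinal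
  -- and carry compatible morphisms from `𝟙`.
  obtain ⟨j, e, he⟩ := RegularIndex.exists_iso hasDual_unit
    (MonObj.one (X := regular (R := R) (H := H)))
  let T := Under.forget j ⋙ RegularIndex.diagram ⋙ F.functor ⋙ tensorRight Y
  let hT := (Functor.Final.isColimitWhiskerEquiv (Under.forget j) _).symm
    (isColimitOfPreserves (F.functor ⋙ tensorRight Y) (RegularIndex.isColimit hH))
  let α : (Functor.const (Under j)).obj Y ⟶ T :=
    { app := fun k => (λ_ Y).inv ≫ (ε F.functor ≫ F.functor.map (e.hom ≫ k.hom.1)) ▷ Y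
      naturality := fun k l f => by
        have h : k.hom.1 ≫ f.right.1 = l.hom.1 := congrArg Subtype.val (Under.w f)
        refine (Category.id_comp _).trans ?_
        change _ = ((λ_ Y).inv ≫ _) ≫ F.functor.map f.right.1 ▷ Y
        rw [Category.assoc, ← comp_whiskerRight, Category.assoc, ← Functor.map_comp,
          Category.assoc, h]
        rfl }
  -- Connectedness makes `Y` the colimit of the constant diagram.
  have : IsConnected (Under j) := IsFiltered.isConnected _
  refine isKernelMono_colimit α (fun k => ?_) (isColimitConstCocone _ Y) hT _ fun k => ?_
  · obtain ⟨N, ⟨_⟩⟩ := k.right.hasDual_obj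
    refine isKernelMono_map (N := N) F _ k.right.toRegular ?_ Y
    rw [Category.assoc, ← he]
    exact congrArg (e.hom ≫ ·) k.hom.2
  · refine (Category.id_comp _).trans ?_
    change _ = ((λ_ Y).inv ≫ _) ≫ F.functor.map k.right.toRegular ▷ Y
    rw [Category.assoc, ← comp_whiskerRight, Category.assoc, ← Functor.map_comp, Category.assoc,
      k.hom.2, he]
    rfl

open scoped Obj in
-- Tensoring with a dualizable object is a right adjoint, so it preserves limits; `F(H, δ)` is a
-- filtered colimit of such objects.
lemma preservesFiniteLimits_regular (hH : IsAdamsHopfAlgebra R H)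
    (F : TensorFunctor R (Comod R H) C) :
    PreservesFiniteLimits (tensorLeft (F.functor.obj (regular (R := R) (H := H)))) := by
  have := RegularIndex.isFiltered hH
  refine preservesFiniteLimits_tensorLeft_colimit (fun j => ?_)
    (isColimitOfPreserves F.functor (RegularIndex.isColimit hH))
  obtain ⟨N, ⟨_⟩⟩ := j.hasDual_obj
  let := mapExactPairing F.functor j.obj N
  exact ⟨fun I _ _ => (tensorLeftAdjunction (F.functor.obj j.obj)
    (F.functor.obj N)).rightAdjoint_preservesLimits.preservesLimitsOfShape⟩

lemma reflectsIsomorphisms_regular (hH : IsAdamsHopfAlgebra R H)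
    (F : TensorFunctor R (Comod R H) C) :
    (tensorLeft (F.functor.obj (regular (R := R) (H := H)))).ReflectsIsomorphisms := by
  let _ : MonObj (F.functor.obj (regular (R := R) (H := H))) := F.functor.monObjObj _
  exact reflectsIsomorphisms_of_isKernelMono (isKernelMono_unitMap hH F)

end FaithfullyFlat

end UnivTorsor

namespace UnivTorsor

/-! ### The free module functor `X ↦ A ⊗ X` as a lax monoidal functor. -/

noncomputable section FreeModule

open Functor.LaxMonoidal

variable {C : Type*} [Category* C] [MonoidalCategory C] [SymmetricCategory C]

/-- With this identity, compatibility of `tensorLeft A` with the braiding reduces to commutativity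
of `A`. -/
lemma tensorμ_braiding (X Y Z W : C) :
    tensorμ X Y Z W ≫ ((β_ X Z).hom ⊗ₘ (β_ Y W).hom) =
      (β_ (X ⊗ Y) (Z ⊗ W)).hom ≫ tensorμ Z W X Y := by
  simp only [tensorμ, Category.assoc, BraidedCategory.braiding_naturality,
    BraidedCategory.braiding_tensor_right_hom, BraidedCategory.braiding_tensor_left_hom,
    comp_whiskerRight, whisker_assoc, MonoidalCategory.whiskerLeft_comp, pentagon_assoc,
    pentagon_inv_hom_hom_hom_inv_assoc, Iso.inv_hom_id_assoc, whiskerLeft_hom_inv_assoc]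
  rw [← MonoidalCategory.whiskerLeft_comp_assoc Z ((β_ X W).hom ▷ Y), ← comp_whiskerRight,
    SymmetricCategory.symmetry, MonoidalCategory.tensorHom_def]
  simp

/-- The functor `X ↦ A ⊗ X` is lax monoidal for an algebra `A`. -/
instance laxMonoidalTensorLeft (A : C) [MonObj A] : (tensorLeft A).LaxMonoidal where
  ε := unitMap A (𝟙_ C)
  μ X Y := tensorμ A X A Y ≫ MonObj.mul ▷ (X ⊗ Y)
  μ_natural_left {X Y} f Z := by
    change (A ◁ f) ▷ (A ⊗ Z) ≫ _ = _ ≫ A ◁ (f ▷ Z)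
    have := tensorμ_natural_left (𝟙 A) f A Z
    simp only [id_tensorHom, id_whiskerRight, MonoidalCategory.tensorHom_id] at this
    rw [reassoc_of% this, Category.assoc, whisker_exchange]
  μ_natural_right {X Y} Z f := by
    change (A ⊗ Z) ◁ (A ◁ f) ≫ _ = _ ≫ A ◁ (Z ◁ f)
    have := tensorμ_natural_right A Z (𝟙 A) f
    simp only [id_tensorHom, MonoidalCategory.whiskerLeft_id] at this
    rw [reassoc_of% this, Category.assoc, whisker_exchange]
  associativity X Y Z := by
    change (tensorμ A X A Y ≫ MonObj.mul ▷ (X ⊗ Y)) ▷ (A ⊗ Z) ≫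
      (tensorμ A (X ⊗ Y) A Z ≫ MonObj.mul ▷ _) ≫ A ◁ (α_ X Y Z).hom =
      (α_ _ _ _).hom ≫ (A ⊗ X) ◁ (tensorμ A Y A Z ≫ MonObj.mul ▷ _) ≫
        tensorμ A X A (Y ⊗ Z) ≫ MonObj.mul ▷ _
    have h1 := tensorμ_natural_left (MonObj.mul (X := A)) (𝟙 (X ⊗ Y)) A Z
    have h2 := tensorμ_natural_right A X (MonObj.mul (X := A)) (𝟙 (Y ⊗ Z))
    have h3 := tensor_associativity A X A Y A Z
    simp only [MonoidalCategory.tensorHom_id, MonoidalCategory.id_tensorHom, id_whiskerRight,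
      MonoidalCategory.whiskerLeft_id, Category.comp_id] at h1 h2
    simp only [comp_whiskerRight, MonoidalCategory.whiskerLeft_comp, Category.assoc]
    rw [reassoc_of% h1, reassoc_of% h2]
    rw [← reassoc_of% h3, MonoidalCategory.tensorHom_def', Category.assoc,
      ← comp_whiskerRight_assoc, MonObj.mul_assoc, ← comp_whiskerRight, ← comp_whiskerRight,
      whisker_exchange]
  left_unitality X := by
    have h := tensor_left_unitality A X
    have h1 := tensorμ_natural_left (MonObj.one (X := A)) (𝟙 (𝟙_ C)) A X
    simp only [MonoidalCategory.tensorHom_id, id_whiskerRight, MonoidalCategory.id_tensorHom,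
      MonoidalCategory.whiskerLeft_id] at h1
    change (λ_ (A ⊗ X)).hom = ((λ_ (𝟙_ C)).inv ≫ MonObj.one ▷ 𝟙_ C) ▷ (A ⊗ X) ≫
      (tensorμ A (𝟙_ C) A X ≫ MonObj.mul ▷ (𝟙_ C ⊗ X)) ≫ A ◁ (λ_ X).hom
    rw [comp_whiskerRight, Category.assoc, Category.assoc, reassoc_of% h1,
      ← comp_whiskerRight_assoc, MonObj.one_mul, h, MonoidalCategory.tensorHom_def]
  right_unitality X := by
    have h := tensor_right_unitality A X
    have h1 := tensorμ_natural_right A X (MonObj.one (X := A)) (𝟙 (𝟙_ C))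
    simp only [MonoidalCategory.tensorHom_id, id_whiskerRight, MonoidalCategory.id_tensorHom,
      MonoidalCategory.whiskerLeft_id] at h1
    change (ρ_ (A ⊗ X)).hom = (A ⊗ X) ◁ ((λ_ (𝟙_ C)).inv ≫ MonObj.one ▷ 𝟙_ C) ≫
      (tensorμ A X A (𝟙_ C) ≫ MonObj.mul ▷ (X ⊗ 𝟙_ C)) ≫ A ◁ (ρ_ X).hom
    rw [MonoidalCategory.whiskerLeft_comp, Category.assoc, Category.assoc, reassoc_of% h1,
      ← comp_whiskerRight_assoc, MonObj.mul_one, h, MonoidalCategory.tensorHom_def]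

lemma tensorLeft_μ (A : C) [MonObj A] (X Y : C) :
    μ (tensorLeft A) X Y = tensorμ A X A Y ≫ MonObj.mul ▷ (X ⊗ Y) := rfl

instance laxBraidedTensorLeft (A : C) [MonObj A] [IsCommMonObj A] :
    (tensorLeft A).LaxBraided where
  braided X Y := by
    change (tensorμ A X A Y ≫ MonObj.mul ▷ (X ⊗ Y)) ≫ A ◁ (β_ X Y).hom =
      (β_ (A ⊗ X) (A ⊗ Y)).hom ≫ tensorμ A Y A X ≫ MonObj.mul ▷ (Y ⊗ X)
    rw [← reassoc_of% tensorμ_braiding, Category.assoc, MonoidalCategory.tensorHom_def',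
      Category.assoc, ← comp_whiskerRight, IsCommMonObj.mul_comm, whisker_exchange]

variable {D : Type*} [Category* D] [MonoidalCategory D] [SymmetricCategory D]

open scoped Obj in
/-- The tensorator as a transformation `F A ⊗ F X ⟶ F (A ⊗ X)`. -/
def tensorLeftComparison (F : D ⥤ C) [F.LaxMonoidal] (A : D) :
    F ⋙ tensorLeft (F.obj A) ⟶ tensorLeft A ⋙ F where
  app X := μ F A X
  naturality _ _ f := μ_natural_right F A f

open scoped Obj in
instance (F : D ⥤ C) [F.LaxBraided] (A : D) [MonObj A] :
    NatTrans.IsMonoidal (tensorLeftComparison F A) where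
  unit := by
    change (unitMap (F.obj A) (𝟙_ C) ≫ F.obj A ◁ ε F) ≫ μ F A (𝟙_ D) =
      ε F ≫ F.map (unitMap A (𝟙_ D))
    rw [← unitMap_naturality, Category.assoc]
    congr 1
    simp only [unitMap, Functor.map_comp, Category.assoc, Functor.obj.η_def, comp_whiskerRight,
      μ_natural_left]
    rw [← left_unitality_inv_assoc]
  tensor X Y := by
    change ((tensorμ (F.obj A) (F.obj X) (F.obj A) (F.obj Y) ≫ MonObj.mul ▷ (F.obj X ⊗ F.obj Y)) ≫
      F.obj A ◁ μ F X Y) ≫ μ F A (X ⊗ Y) = (μ F A X ⊗ₘ μ F A Y) ≫ μ F (A ⊗ X) (A ⊗ Y) ≫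
        F.map (tensorμ A X A Y ≫ MonObj.mul ▷ (X ⊗ Y))
    have h := tensorμ_comp_μ_tensorHom_μ_comp_μ F A X A Y
    rw [Functor.map_comp, ← reassoc_of% h, ← μ_natural_left, MonoidalCategory.tensorHom_def]
    simp only [Functor.obj.μ_def, comp_whiskerRight, Category.assoc, whisker_exchange_assoc]

/-- The transformation `A ⊗ X ⟶ B ⊗ X` given by a morphism `A ⟶ B`. -/
def tensorLeftMap {A B : C} (φ : A ⟶ B) : tensorLeft A ⟶ tensorLeft B where
  app X := φ ▷ X
  naturality _ _ f := whisker_exchange φ f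

instance {A B : C} [MonObj A] [MonObj B] (φ : A ⟶ B) [IsMonHom φ] :
    NatTrans.IsMonoidal (tensorLeftMap φ) where
  unit := by
    change ((λ_ (𝟙_ C)).inv ≫ MonObj.one ▷ _) ≫ φ ▷ _ = (λ_ (𝟙_ C)).inv ≫ MonObj.one ▷ _
    rw [Category.assoc, ← comp_whiskerRight, IsMonHom.one_hom]
  tensor X Y := by
    change (tensorμ A X A Y ≫ MonObj.mul ▷ (X ⊗ Y)) ≫ φ ▷ (X ⊗ Y) =
      (φ ▷ X ⊗ₘ φ ▷ Y) ≫ tensorμ B X B Y ≫ MonObj.mul ▷ (X ⊗ Y)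
    have h := tensorμ_natural φ (𝟙 X) φ (𝟙 Y)
    simp only [MonoidalCategory.tensorHom_id, id_whiskerRight] at h
    rw [reassoc_of% h, Category.assoc, ← comp_whiskerRight, ← comp_whiskerRight, IsMonHom.mul_hom]

/-- The transformation `(A ⊗ B) ⊗ X ⟶ A ⊗ (B ⊗ X)`. -/
def tensorLeftAssoc (A B : C) : tensorLeft (A ⊗ B) ⟶ tensorLeft B ⋙ tensorLeft A where
  app X := (α_ A B X).hom

instance (A B : C) [MonObj A] [MonObj B] : NatTrans.IsMonoidal (tensorLeftAssoc A B) where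
  unit := by
    change ((λ_ (𝟙_ C)).inv ≫ ((λ_ (𝟙_ C)).inv ≫ (MonObj.one ⊗ₘ MonObj.one)) ▷ _) ≫ (α_ _ _ _).hom =
      ((λ_ (𝟙_ C)).inv ≫ MonObj.one ▷ _) ≫ A ◁ ((λ_ (𝟙_ C)).inv ≫ MonObj.one ▷ _)
    rw [MonoidalCategory.tensorHom_def, comp_whiskerRight, comp_whiskerRight, Category.assoc,
      Category.assoc, Category.assoc, associator_naturality_middle,
      associator_naturality_left_assoc,
      Category.assoc, MonoidalCategory.whiskerLeft_comp, ← whisker_exchange_assoc]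
    have h : (λ_ (𝟙_ C)).inv ▷ 𝟙_ C ≫ (α_ (𝟙_ C) (𝟙_ C) (𝟙_ C)).hom =
      𝟙_ C ◁ (λ_ (𝟙_ C)).inv := by monoidal
    rw [reassoc_of% h]
  tensor X Y := by
    change (tensorμ (A ⊗ B) X (A ⊗ B) Y ≫ (tensorμ A B A B ≫ (MonObj.mul ⊗ₘ MonObj.mul)) ▷
        (X ⊗ Y)) ≫
      (α_ A B (X ⊗ Y)).hom = ((α_ A B X).hom ⊗ₘ (α_ A B Y).hom) ≫
        (tensorμ A (B ⊗ X) A (B ⊗ Y) ≫ MonObj.mul ▷ ((B ⊗ X) ⊗ (B ⊗ Y))) ≫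
          A ◁ (tensorμ B X B Y ≫ MonObj.mul ▷ (X ⊗ Y))
    have h := associator_monoidal A B X A B Y
    simp only [comp_whiskerRight, Category.assoc, MonoidalCategory.whiskerLeft_comp]
    rw [← whisker_exchange_assoc, ← reassoc_of% h]
    simp only [MonoidalCategory.tensorHom_def, comp_whiskerRight, Category.assoc,
      associator_naturality_left, associator_naturality_middle, associator_naturality_left_assoc]

end FreeModule

end UnivTorsor

namespace UnivTorsor

/-! ### Linear morphisms between free modules, as a Kleisli calculus. -/

noncomputable section Extend

variable {C : Type*} [Category* C] [MonoidalCategory C] (A : C) [MonObj A]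

/-- The `A`-linear extension `A ⊗ X ⟶ A ⊗ Y` of a morphism `X ⟶ A ⊗ Y`. -/
def extend {X Y : C} (f : X ⟶ A ⊗ Y) : A ⊗ X ⟶ A ⊗ Y :=
  A ◁ f ≫ (α_ A A Y).inv ≫ MonObj.mul ▷ Y

lemma whiskerLeft_extend {X X' Y : C} (g : X' ⟶ X) (f : X ⟶ A ⊗ Y) :
    A ◁ g ≫ extend A f = extend A (g ≫ f) := by
  simp [extend]

lemma extend_whiskerLeft {X Y Y' : C} (f : X ⟶ A ⊗ Y) (g : Y ⟶ Y') :
    extend A f ≫ A ◁ g = extend A (f ≫ A ◁ g) := by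
  simp [extend, ← whisker_exchange]

/-- This is Kleisli composition for the monad `A ⊗ -`; the content is associativity of `A`. -/
lemma extend_extend {X Y Z : C} (f : X ⟶ A ⊗ Y) (g : Y ⟶ A ⊗ Z) :
    extend A f ≫ extend A g = extend A (f ≫ extend A g) := by
  simp only [extend, MonoidalCategory.whiskerLeft_comp, Category.assoc]
  rw [← whisker_exchange_assoc, ← associator_inv_naturality_right_assoc]
  congr 2
  rw [associator_inv_naturality_left_assoc, associator_inv_naturality_middle_assoc,
    ← comp_whiskerRight, ← comp_whiskerRight, MonObj.mul_assoc]
  simp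

lemma extend_unitMap (X : C) : extend A (unitMap A X) = 𝟙 (A ⊗ X) := by
  have h : A ◁ MonObj.one ▷ X ≫ (α_ A A X).inv ≫ MonObj.mul ▷ X =
      (α_ A (𝟙_ C) X).inv ≫ (ρ_ A).hom ▷ X := by
    rw [associator_inv_naturality_middle_assoc, ← comp_whiskerRight, MonObj.mul_one]
  simp only [extend, unitMap, MonoidalCategory.whiskerLeft_comp, Category.assoc, h]
  simp

lemma unitMap_extend {X Y : C} (f : X ⟶ A ⊗ Y) : unitMap A X ≫ extend A f = f := by
  simp only [extend]
  rw [← reassoc_of% (unitMap_naturality A f), unitMap, Category.assoc,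
    associator_inv_naturality_left_assoc, ← comp_whiskerRight, MonObj.one_mul]
  simp

variable {A} in
lemma extend_comp_whiskerRight {B : C} [MonObj B] (φ : A ⟶ B) [IsMonHom φ] {X Y : C}
    (f : X ⟶ A ⊗ Y) : extend A f ≫ φ ▷ Y = φ ▷ X ≫ extend B (f ≫ φ ▷ Y) := by
  simp only [extend, Category.assoc, ← comp_whiskerRight, IsMonHom.mul_hom,
    MonoidalCategory.tensorHom_def, MonoidalCategory.whiskerLeft_comp]
  simp only [comp_whiskerRight, ← associator_inv_naturality_left_assoc,
    ← associator_inv_naturality_middle_assoc, whisker_exchange_assoc]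

variable {A} in
/-- Extension of scalars preserves isomorphisms of free modules. -/
lemma isIso_extend_comp {B : C} [MonObj B] (φ : A ⟶ B) [IsMonHom φ] {X Y : C}
    (f : X ⟶ A ⊗ Y) [IsIso (extend A f)] : IsIso (extend B (f ≫ φ ▷ Y)) := by
  let g : Y ⟶ A ⊗ X := unitMap A Y ≫ inv (extend A f)
  have hφ (Z : C) : unitMap A Z ≫ φ ▷ Z = unitMap B Z := by
    simp [unitMap, ← comp_whiskerRight]
  have h1 : f ≫ φ ▷ Y ≫ extend B (g ≫ φ ▷ X) = unitMap B X := by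
    -- The inverse of an `A`-linear isomorphism is `A`-linear, hence the extension of its
    -- restriction `g` along the unit. Base change of `g` then gives the inverse over `B`.
    have hg : extend A g = inv (extend A f) := by
      rw [← cancel_epi (extend A f), IsIso.hom_inv_id, ← cancel_mono (extend A f), Category.assoc,
        extend_extend, Category.assoc, IsIso.inv_hom_id, Category.comp_id, extend_unitMap]
      simp
    rw [← extend_comp_whiskerRight, hg]
    exact ((reassoc_of% (unitMap_extend A f)) _).symm.trans (by simp [hφ])
  have h2 : g ≫ φ ▷ X ≫ extend B (f ≫ φ ▷ Y) = unitMap B Y := by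
    rw [← extend_comp_whiskerRight, ← hφ]
    simp [g]
  refine ⟨extend B (g ≫ φ ▷ X), ?_, ?_⟩
  · rw [extend_extend, Category.assoc, h1, extend_unitMap]
  · rw [extend_extend, Category.assoc, h2, extend_unitMap]

end Extend

/-! ### Tensor products of linear morphisms between free modules. -/

noncomputable section ExtendSymmetric

variable {C : Type*} [Category* C] [MonoidalCategory C] [SymmetricCategory C]

/-- The isomorphism `Q ⊗ (A ⊗ X) ≅ A ⊗ (Q ⊗ X)`. -/
def swapIso (Q A X : C) : Q ⊗ (A ⊗ X) ≅ A ⊗ (Q ⊗ X) :=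
  (α_ Q A X).symm ≪≫ whiskerRightIso (β_ Q A) X ≪≫ α_ A Q X

lemma swapIso_naturality (Q A : C) {X Y : C} (g : X ⟶ Y) :
    Q ◁ A ◁ g ≫ (swapIso Q A Y).hom = (swapIso Q A X).hom ≫ A ◁ Q ◁ g := by
  simp only [swapIso, Iso.trans_hom, Iso.symm_hom, whiskerRightIso_hom, Category.assoc]
  rw [associator_inv_naturality_right_assoc, whisker_exchange_assoc, associator_naturality_right]

variable (A : C) [MonObj A]

/-- Tensoring with `Q` commutes with linear extension once `A` is moved past `Q` by the symmetry. -/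
lemma extend_swap (Q : C) {X Y : C} (g : X ⟶ A ⊗ Y) :
    (swapIso Q A X).hom ≫ extend A (Q ◁ g ≫ (swapIso Q A Y).hom) =
      Q ◁ extend A g ≫ (swapIso Q A Y).hom := by
  have h : Q ◁ ((α_ A A Y).inv ≫ MonObj.mul ▷ Y) ≫ (swapIso Q A Y).hom =
      (swapIso Q A (A ⊗ Y)).hom ≫ A ◁ (swapIso Q A Y).hom ≫ (α_ A A (Q ⊗ Y)).inv ≫
        MonObj.mul ▷ (Q ⊗ Y) := by
    have h1 := BraidedCategory.braiding_naturality_right Q (MonObj.mul (X := A))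
    simp only [swapIso, Iso.trans_hom, Iso.symm_hom, whiskerRightIso_hom,
      MonoidalCategory.whiskerLeft_comp, Category.assoc]
    rw [associator_inv_naturality_middle_assoc, ← comp_whiskerRight_assoc, h1,
      BraidedCategory.braiding_tensor_right_hom]
    simp
  simp only [extend, MonoidalCategory.whiskerLeft_comp, Category.assoc] at h ⊢
  rw [h, reassoc_of% (swapIso_naturality Q A g)]

lemma tensorLeft_μ_eq {X X' Y Y' : C} (f : X ⟶ A ⊗ X') (g : Y ⟶ A ⊗ Y') :
    (f ⊗ₘ g) ≫ Functor.LaxMonoidal.μ (tensorLeft A) X' Y' =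
      f ▷ Y ≫ (α_ A X' Y).hom ≫ extend A (X' ◁ g ≫ (swapIso X' A Y').hom) := by
  simp [tensorLeft_μ, tensorμ, extend, MonoidalCategory.tensorHom_def, swapIso]

/-- The extension of the product factors as `extend A f` tensored with `Y`, followed by `X'`
tensored with `extend A g`. -/
lemma isIso_extend_tensor {X X' Y Y' : C} (f : X ⟶ A ⊗ X') (g : Y ⟶ A ⊗ Y')
    [IsIso (extend A f)] [IsIso (extend A g)] :
    IsIso (extend A ((f ⊗ₘ g) ≫ Functor.LaxMonoidal.μ (tensorLeft A) X' Y')) := by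
  have h1 : extend A (f ▷ Y ≫ (α_ A X' Y).hom) =
      (α_ A X Y).inv ≫ extend A f ▷ Y ≫ (α_ A X' Y).hom := by
    simp [extend]
  have h2 : extend A (X' ◁ g ≫ (swapIso X' A Y').hom) =
      (swapIso X' A Y).inv ≫ X' ◁ extend A g ≫ (swapIso X' A Y').hom := by
    rw [Iso.eq_inv_comp, extend_swap]
  rw [tensorLeft_μ_eq, ← Category.assoc, ← extend_extend, h1, h2]
  infer_instance

end ExtendSymmetric

/-! ### Monoidal structures on subfunctors. -/

noncomputable section Subfunctor

open Functor.LaxMonoidal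

variable {C D : Type*} [Category* C] [MonoidalCategory C] [Category* D] [MonoidalCategory D]

lemma isMonoidal_of_mono_comp {E F G : C ⥤ D} [E.LaxMonoidal] [F.LaxMonoidal] [G.LaxMonoidal]
    (α : E ⟶ F) (β : F ⟶ G) [∀ X, Mono (β.app X)] [NatTrans.IsMonoidal β]
    [NatTrans.IsMonoidal (α ≫ β)] : NatTrans.IsMonoidal α where
  unit := by
    rw [← cancel_mono (β.app _), NatTrans.IsMonoidal.unit (τ := β), Category.assoc]
    exact NatTrans.IsMonoidal.unit (τ := α ≫ β)
  tensor X Y := by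
    rw [← cancel_mono (β.app _), Category.assoc, Category.assoc, NatTrans.IsMonoidal.tensor,
      tensorHom_comp_tensorHom_assoc]
    exact NatTrans.IsMonoidal.tensor (τ := α ≫ β) X Y

/-- A lax monoidal structure on a subfunctor of a lax monoidal functor. -/
@[reducible]
def laxMonoidalOfMono {E P : C ⥤ D} [P.LaxMonoidal] (ι : E ⟶ P) [∀ X, Mono (ι.app X)]
    (e : 𝟙_ D ⟶ E.obj (𝟙_ C)) (he : e ≫ ι.app _ = ε P)
    (m : ∀ X Y, E.obj X ⊗ E.obj Y ⟶ E.obj (X ⊗ Y))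
    (hm : ∀ X Y, m X Y ≫ ι.app _ = (ι.app X ⊗ₘ ι.app Y) ≫ μ P X Y) : E.LaxMonoidal where
  ε := e
  μ := m
  μ_natural_left {X Y} f Z := by
    rw [← cancel_mono (ι.app _)]
    simp only [Category.assoc, hm, ι.naturality, reassoc_of% hm, ← μ_natural_left]
    rw [whiskerRight_comp_tensorHom_assoc, ι.naturality, tensorHom_comp_whiskerRight_assoc]
  μ_natural_right {X Y} Z f := by
    rw [← cancel_mono (ι.app _)]
    simp only [Category.assoc, hm, ι.naturality, reassoc_of% hm, ← μ_natural_right]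
    rw [whiskerLeft_comp_tensorHom_assoc, ι.naturality, tensorHom_comp_whiskerLeft_assoc]
  associativity X Y Z := by
    rw [← cancel_mono (ι.app _)]
    simp only [Category.assoc, hm, ι.naturality, reassoc_of% hm]
    have h1 : m X Y ▷ E.obj Z ≫ (ι.app (X ⊗ Y) ⊗ₘ ι.app Z) =
        ((ι.app X ⊗ₘ ι.app Y) ⊗ₘ ι.app Z) ≫ μ P X Y ▷ P.obj Z := by
      rw [whiskerRight_comp_tensorHom, hm, tensorHom_comp_whiskerRight]
    have h2 : E.obj X ◁ m Y Z ≫ (ι.app X ⊗ₘ ι.app (Y ⊗ Z)) =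
        (ι.app X ⊗ₘ ι.app Y ⊗ₘ ι.app Z) ≫ P.obj X ◁ μ P Y Z := by
      rw [whiskerLeft_comp_tensorHom, hm, tensorHom_comp_whiskerLeft]
    rw [reassoc_of% h1, reassoc_of% h2, Functor.LaxMonoidal.associativity,
      associator_naturality_assoc]
  left_unitality X := by
    rw [← cancel_mono (ι.app _)]
    simp only [Category.assoc, hm, ι.naturality, reassoc_of% hm]
    rw [← leftUnitor_naturality, Functor.LaxMonoidal.left_unitality, ← he]
    rw [whiskerRight_comp_tensorHom_assoc, comp_whiskerRight, Category.assoc,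
      MonoidalCategory.tensorHom_def', comp_whiskerRight, whisker_exchange_assoc]
    simp [← whisker_exchange_assoc]
  right_unitality X := by
    rw [← cancel_mono (ι.app _)]
    simp only [Category.assoc, hm, ι.naturality, reassoc_of% hm]
    rw [← rightUnitor_naturality, Functor.LaxMonoidal.right_unitality, ← he]
    rw [whiskerLeft_comp_tensorHom_assoc]
    simp [MonoidalCategory.tensorHom_def, whisker_exchange_assoc]

variable [BraidedCategory C] [BraidedCategory D]

/-- A subfunctor of a lax braided functor is lax braided. -/
@[reducible]
def laxBraidedOfMono {E P : C ⥤ D} [E.LaxMonoidal] [P.LaxBraided] (ι : E ⟶ P)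
    [NatTrans.IsMonoidal ι] [∀ X, Mono (ι.app X)] : E.LaxBraided where
  braided X Y := by
    rw [← cancel_mono (ι.app _), Category.assoc, Category.assoc, ι.naturality,
      NatTrans.IsMonoidal.tensor, reassoc_of% NatTrans.IsMonoidal.tensor (τ := ι),
      Functor.LaxBraided.braided, BraidedCategory.braiding_naturality_assoc]

end Subfunctor

/-! ### Strong monoidality detected after faithfully flat base change. -/

noncomputable section Strong

open Functor.LaxMonoidal

variable {C D : Type*} [Category* C] [MonoidalCategory C] [SymmetricCategory C]
  [Category* D] [MonoidalCategory D] (A : C) [MonObj A]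
  [(tensorLeft A).ReflectsIsomorphisms] {E Q : D ⥤ C} [E.LaxMonoidal] [Q.Monoidal]
  (ι : E ⟶ Q ⋙ tensorLeft A) [NatTrans.IsMonoidal ι] [∀ X, IsIso (extend A (ι.app X))]

include ι

/-- After tensoring with `A`, the isomorphisms `A ⊗ E X ≅ A ⊗ Q X` identify `ε E` with the
invertible `ε Q`, and `A ⊗ -` reflects isomorphisms. -/
lemma isIso_ε_of_isIso_extend : IsIso (ε E) := by
  have h := NatTrans.IsMonoidal.unit (τ := ι)
  have : IsIso (A ◁ ε E) := by
    have h1 : A ◁ ε E ≫ extend A (ι.app (𝟙_ D)) = A ◁ ε Q := by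
      rw [whiskerLeft_extend, h]
      change extend A (unitMap A _ ≫ A ◁ ε Q) = _
      rw [← extend_whiskerLeft, extend_unitMap, Category.id_comp]
    have : IsIso (A ◁ ε E ≫ extend A (ι.app (𝟙_ D))) := by rw [h1]; infer_instance
    exact IsIso.of_isIso_comp_right _ (extend A (ι.app (𝟙_ D)))
  have : IsIso ((tensorLeft A).map (ε E)) := this
  exact isIso_of_reflects_iso (ε E) (tensorLeft A)

/-- After base change to `A`, `μ E` is compared with `μ Q` through the tensor product of two
isomorphisms of free modules, invertible by `isIso_extend_tensor`. -/
lemma isIso_μ_of_isIso_extend (X Y : D) : IsIso (μ E X Y) := by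
  have h := NatTrans.IsMonoidal.tensor (τ := ι) X Y
  have : IsIso (A ◁ μ E X Y) := by
    have h1 : A ◁ μ E X Y ≫ extend A (ι.app (X ⊗ Y)) =
        extend A ((ι.app X ⊗ₘ ι.app Y) ≫ μ (tensorLeft A) (Q.obj X) (Q.obj Y)) ≫
          A ◁ μ Q X Y := by
      rw [whiskerLeft_extend, h, extend_whiskerLeft, Category.assoc]
      rfl
    have := isIso_extend_tensor A (ι.app X) (ι.app Y)
    have : IsIso (A ◁ μ E X Y ≫ extend A (ι.app (X ⊗ Y))) := by rw [h1]; infer_instance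
    exact IsIso.of_isIso_comp_right _ (extend A (ι.app (X ⊗ Y)))
  have : IsIso ((tensorLeft A).map (μ E X Y)) := this
  exact isIso_of_reflects_iso (μ E X Y) (tensorLeft A)

end Strong

end UnivTorsor

namespace UnivTorsor

/-! ### Pointwise equalizers of monoidal transformations. -/

noncomputable section EqualizerFunctor

variable {C D : Type*} [Category* C] [Category* D] [HasEqualizers D] {P P' : C ⥤ D}
  (s t : P ⟶ P')

/-- The pointwise equalizer of two natural transformations. -/
def equalizerFunctor : C ⥤ D where
  obj X := equalizer (s.app X) (t.app X)
  map {X Y} f := equalizer.lift (equalizer.ι _ _ ≫ P.map f) (by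
    rw [Category.assoc, Category.assoc, s.naturality, t.naturality, equalizer.condition_assoc])
  map_id X := by ext; simp
  map_comp f g := by ext; simp

/-- The inclusion of the pointwise equalizer. -/
def equalizerInclusion : equalizerFunctor s t ⟶ P where
  app X := equalizer.ι (s.app X) (t.app X)
  naturality _ _ _ := equalizer.lift_ι _ _

instance (X : C) : Mono ((equalizerInclusion s t).app X) :=
  inferInstanceAs (Mono (equalizer.ι (s.app X) (t.app X)))

lemma equalizerInclusion_condition (X : C) :
    (equalizerInclusion s t).app X ≫ s.app X = (equalizerInclusion s t).app X ≫ t.app X :=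
  equalizer.condition _ _

section Linear

variable [Preadditive C] [Preadditive D] [P.Additive]

instance : (equalizerFunctor s t).Additive where
  map_add {X Y f g} := by
    rw [← cancel_mono ((equalizerInclusion s t).app Y), Preadditive.add_comp,
      (equalizerInclusion s t).naturality, (equalizerInclusion s t).naturality,
      (equalizerInclusion s t).naturality, P.map_add, Preadditive.comp_add]

instance (R : Type*) [CommRing R] [Linear R C] [Linear R D] [P.Linear R] :
    (equalizerFunctor s t).Linear R where
  map_smul {X Y} f r := by
    rw [← cancel_mono ((equalizerInclusion s t).app Y), Linear.smul_comp,
      (equalizerInclusion s t).naturality, (equalizerInclusion s t).naturality,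
      P.map_smul, Linear.comp_smul]

end Linear

open Functor.LaxMonoidal

section Monoidal

variable [MonoidalCategory C] [MonoidalCategory D] [P.LaxMonoidal] [P'.LaxMonoidal]
  [NatTrans.IsMonoidal s] [NatTrans.IsMonoidal t]

instance : (equalizerFunctor s t).LaxMonoidal :=
  laxMonoidalOfMono (equalizerInclusion s t)
    (equalizer.lift (ε P) (by
      rw [NatTrans.IsMonoidal.unit (τ := s), NatTrans.IsMonoidal.unit (τ := t)]))
    (equalizer.lift_ι _ _)
    (fun X Y => equalizer.lift
      (((equalizerInclusion s t).app X ⊗ₘ (equalizerInclusion s t).app Y) ≫ μ P X Y) (by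
        rw [Category.assoc, Category.assoc, NatTrans.IsMonoidal.tensor (τ := s),
          NatTrans.IsMonoidal.tensor (τ := t), tensorHom_comp_tensorHom_assoc,
          tensorHom_comp_tensorHom_assoc, equalizerInclusion_condition,
          equalizerInclusion_condition]))
    (fun _ _ => equalizer.lift_ι _ _)

instance : NatTrans.IsMonoidal (equalizerInclusion s t) where
  unit := equalizer.lift_ι _ _
  tensor _ _ := equalizer.lift_ι _ _

end Monoidal

instance [MonoidalCategory C] [MonoidalCategory D] [BraidedCategory C] [BraidedCategory D]
    [P.LaxBraided] [P'.LaxMonoidal] [NatTrans.IsMonoidal s] [NatTrans.IsMonoidal t] :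
    (equalizerFunctor s t).LaxBraided :=
  laxBraidedOfMono (equalizerInclusion s t)

end EqualizerFunctor

/-! ### Linearity, symmetry and the right adjoint of `M ↦ 𝟙 ⊙ M`. -/

noncomputable section ScalarProperties

open Functor.LaxMonoidal

variable {R : Type u} [CommRing R] {C : Type w} [Category.{u} C] [Preadditive C] [Linear R C]
  [MonoidalCategory C] [HasColimits C]

instance : (scalar R C).Additive where
  map_add {M N f g} := scalar_ext fun m => by
    simp [Preadditive.comp_add]

instance : (scalar R C).Linear R where
  map_smul {M N} f r := scalar_ext fun m => by
    simp [Linear.comp_smul]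

variable [SymmetricCategory C] [MonoidalPreadditive C] [MonoidalLinear R C] [MonoidalClosed C]

instance : (scalar R C).LaxBraided where
  braided M N := scalarTensor_ext fun m n => by
    change (el C m ⊗ₘ el C n) ≫ scalarMu M N ≫ _ = (el C m ⊗ₘ el C n) ≫ _ ≫ scalarMu N M
    rw [el_scalarMu_assoc, el_scalar_map, BraidedCategory.braiding_naturality_assoc, el_scalarMu,
      braiding_leftUnitor_assoc, ← unitors_equal]
    rfl

/-- The functor `X ↦ Hom(𝟙, X)` to modules is right adjoint to `M ↦ 𝟙 ⊙ M`. -/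
def scalarAdj : scalar R C ⊣ (linearCoyoneda R C).obj (Opposite.op (𝟙_ C)) :=
  Adjunction.mkOfHomEquiv
    { homEquiv := fun M X =>
        { toFun := fun f => ModuleCat.ofHom (Linear.rightComp R _ f ∘ₗ el C)
          invFun := fun g => scalarDesc g.hom
          left_inv := fun f => scalar_ext fun m => el_scalarDesc _ _
          right_inv := fun g => by ext m; exact el_scalarDesc _ _ }
      homEquiv_naturality_left_symm := fun {_ _ X} f g => scalar_ext fun m => by
        change el C m ≫ scalarDesc (X := X) (g.hom ∘ₗ f.hom) =
          el C m ≫ (scalar R C).map f ≫ scalarDesc g.hom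
        rw [el_scalarDesc, el_scalar_map_assoc]
        exact (el_scalarDesc (X := X) g.hom _).symm
      homEquiv_naturality_right := fun f g => by
        ext m
        exact (Category.assoc (el C m) f g).symm }

end ScalarProperties

end UnivTorsor

namespace UnivTorsor

/-! ### The coaction as a monoidal transformation over modules. -/

noncomputable section HopfModules

open Functor.LaxMonoidal

variable (R H : Type u) [CommRing R] [CommRing H] [HopfAlgebra R H]

/-- The underlying module of the Hopf algebra. -/
abbrev hopfModule : ModuleCat.{u} R := ModuleCat.of R H

instance : MonObj (hopfModule R H) :=
  ModuleCat.MonModuleEquivalenceAlgebra.inverseObj (AlgCat.of R H)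

variable {R H}

/-- The coaction as a natural transformation of functors to modules. -/
def coactionTrans : Comod.forget (R := R) (H := H) ⟶
    Comod.forget ⋙ tensorLeft (hopfModule R H) where
  app M := ModuleCat.ofHom M.coact
  naturality M N f := by
    ext1
    exact f.comm

instance : NatTrans.IsMonoidal (coactionTrans (R := R) (H := H)) where
  unit := by
    ext1
    refine LinearMap.ext_ring ?_
    change (1 : H) ⊗ₜ[R] (1 : R) = (algebraMap R H 1) ⊗ₜ[R] (1 : R)
    rw [map_one]
  tensor M N := by
    ext1
    have h (x : H ⊗[R] M.X) (y : H ⊗[R] N.X) : (Comod.mulMiddle H M.X N.X) (x ⊗ₜ y) =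
        (μ (tensorLeft (hopfModule R H)) M.X N.X).hom (x ⊗ₜ y) := by
      induction x using TensorProduct.induction_on with
      | zero => simp only [TensorProduct.zero_tmul, map_zero]
      | add a b ha hb => simp only [TensorProduct.add_tmul, map_add, ha, hb]
      | tmul a m =>
        induction y using TensorProduct.induction_on with
        | zero => simp only [TensorProduct.tmul_zero, map_zero]
        | add a b ha hb => simp only [TensorProduct.tmul_add, map_add, ha, hb]
        | tmul b n => rfl
    have h1 : μ Comod.forget M N = 𝟙 (Comod.forget.obj M ⊗ Comod.forget.obj N) := rfl
    have h2 : μ (Comod.forget ⋙ tensorLeft (hopfModule R H)) M N =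
      μ (tensorLeft (hopfModule R H)) M.X N.X := by
      rw [Functor.LaxMonoidal.comp_μ, h1]
      exact (congrArg _ ((tensorLeft (hopfModule R H)).map_id _)).trans (Category.comp_id _)
    rw [h2]
    exact TensorProduct.ext' fun (m : M.X) (n : N.X) => h (M.coact m) (N.coact n)

end HopfModules

/-! ### The two monoidal transformations `A ⊙ M ⟶ A ⊙ (H ⊗ M)`. -/

noncomputable section CoactMap

open Functor.LaxMonoidal

variable {R H : Type u} [CommRing R] [CommRing H] [HopfAlgebra R H]
variable {C : Type w} [Category.{u} C] [Preadditive C] [Linear R C]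
  [MonoidalCategory C] [SymmetricCategory C] [HasColimits C]
  [MonoidalPreadditive C] [MonoidalLinear R C] [MonoidalClosed C]

variable {A : C} (τ : A ⟶ A ⊗ (scalar R C).obj (hopfModule R H))

/-- The morphism `A ⊙ X ⟶ A ⊙ (H ⊗ X)` induced by `τ`. -/
def coactMap (X : ModuleCat.{u} R) :
    A ⊗ (scalar R C).obj X ⟶ A ⊗ (scalar R C).obj (hopfModule R H ⊗ X) :=
  τ ▷ (scalar R C).obj X ≫ (α_ _ _ _).hom ≫ A ◁ μ (scalar R C) _ _

lemma coactMap_naturality {X Y : ModuleCat.{u} R} (f : X ⟶ Y) :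
    A ◁ (scalar R C).map f ≫ coactMap τ Y =
      coactMap τ X ≫ A ◁ (scalar R C).map (hopfModule R H ◁ f) := by
  simp only [coactMap, Category.assoc]
  rw [whisker_exchange_assoc, associator_naturality_right_assoc,
    ← MonoidalCategory.whiskerLeft_comp, μ_natural_right, MonoidalCategory.whiskerLeft_comp]

/-- The linear map `h ↦ h ⊗ x`. -/
def tensorEl {X : ModuleCat.{u} R} (x : X) : hopfModule R H ⟶ hopfModule R H ⊗ X :=
  ModuleCat.ofHom ((TensorProduct.mk R H X).flip x)

lemma scalar_whiskerLeft_el {X : ModuleCat.{u} R} (Y : ModuleCat.{u} R) (x : X) :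
    (scalar R C).obj Y ◁ el C x ≫ μ (scalar R C) Y X =
      (ρ_ _).hom ≫ (scalar R C).map (ModuleCat.ofHom ((TensorProduct.mk R Y X).flip x)) :=
  el_externalDesc _ x

/-- Morphisms out of `A ⊙ X` are determined by their restrictions to the elements `x`. This formula
reduces identities for `coactMap` to identities for `τ`. -/
lemma el_coactMap {X : ModuleCat.{u} R} (x : X) :
    A ◁ el C x ≫ coactMap τ X =
      (ρ_ A).hom ≫ τ ≫ A ◁ (scalar R C).map (tensorEl x) := by
  have h := scalar_whiskerLeft_el (C := C) (hopfModule R H) x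
  simp only [coactMap]
  rw [whisker_exchange_assoc, associator_naturality_right_assoc,
    ← MonoidalCategory.whiskerLeft_comp, h, MonoidalCategory.whiskerLeft_comp]
  rw [MonoidalCategory.whiskerLeft_rightUnitor, Category.assoc, Iso.hom_inv_id_assoc,
    rightUnitor_naturality_assoc]
  rfl

variable [MonObj A] [IsMonHom τ]

/-- `coactMap` as a natural transformation on comodules. -/
def coactTrans : (Comod.forget (R := R) (H := H) ⋙ scalar R C) ⋙ tensorLeft A ⟶
    ((Comod.forget ⋙ tensorLeft (hopfModule R H)) ⋙ scalar R C) ⋙ tensorLeft A :=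
  Functor.whiskerLeft _ (tensorLeftMap τ ≫ tensorLeftAssoc A _) ≫
    (Functor.associator _ _ _).inv ≫
    Functor.whiskerRight ((Functor.associator _ _ _).hom ≫
      Functor.whiskerLeft _ (tensorLeftComparison (scalar R C) (hopfModule R H)) ≫
      (Functor.associator _ _ _).inv) _

lemma coactTrans_app (M : Comod R H) :
    (coactTrans τ).app M = coactMap τ (Comod.forget.obj M) := by
  simp [coactTrans, coactMap, tensorLeftMap, tensorLeftAssoc, tensorLeftComparison]

instance : NatTrans.IsMonoidal (coactTrans τ) := by
  unfold coactTrans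
  infer_instance

variable (R H A) in
/-- The coaction of comodules as a natural transformation. -/
def comodTrans : (Comod.forget (R := R) (H := H) ⋙ scalar R C) ⋙ tensorLeft A ⟶
    ((Comod.forget ⋙ tensorLeft (hopfModule R H)) ⋙ scalar R C) ⋙ tensorLeft A :=
  Functor.whiskerRight (Functor.whiskerRight coactionTrans _) _

instance : NatTrans.IsMonoidal (comodTrans R H A) := by
  unfold comodTrans
  infer_instance

end CoactMap

end UnivTorsor

namespace UnivTorsor

/-! ### Comparison of equalizers. -/

noncomputable section Fork

variable {C : Type*} [Category* C]

/-- Isomorphic pairs have isomorphic equalizers. The condition `w₂` lists the arrows in the order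
opposite to `w`, because in the split fork of a comodule the arrow of the coaction precedes that of
the comultiplication. -/
lemma isIso_of_isLimit_fork {E P P' : C} {s t : P ⟶ P'} {ι : E ⟶ P} {w : ι ≫ s = ι ≫ t}
    (h : IsLimit (Fork.ofι ι w)) {Q P₂ P₂' : C} {s₂ t₂ : P₂ ⟶ P₂'} {c : Q ⟶ P₂}
    {w₂ : c ≫ t₂ = c ≫ s₂} (h₂ : IsLimit (Fork.ofι c w₂)) (k : P ⟶ P₂) (hk : IsIso k)
    (k' : P' ⟶ P₂') (hk' : IsIso k') (hs : s ≫ k' = k ≫ s₂) (ht : t ≫ k' = k ≫ t₂) (β : E ⟶ Q)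
    (hβ : β ≫ c = ι ≫ k) :
    IsIso β := by
  obtain ⟨l, hl⟩ := Fork.IsLimit.lift' h (c ≫ inv k) (by
    rw [← cancel_mono k', Category.assoc, Category.assoc, Category.assoc, Category.assoc, hs, ht,
      IsIso.inv_hom_id_assoc, IsIso.inv_hom_id_assoc, w₂])
  replace hl : l ≫ ι = c ≫ inv k := hl
  refine ⟨l, Fork.IsLimit.hom_ext h ?_, Fork.IsLimit.hom_ext h₂ ?_⟩
  · change (β ≫ l) ≫ ι = 𝟙 _ ≫ ι
    rw [Category.assoc, hl, reassoc_of% hβ, IsIso.hom_inv_id, Category.comp_id, Category.id_comp]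
  · change (l ≫ β) ≫ c = 𝟙 _ ≫ c
    rw [Category.assoc, hβ, reassoc_of% hl, IsIso.inv_hom_id, Category.comp_id, Category.id_comp]

end Fork

/-! ### Descent along a torsor. -/

noncomputable section TorsorDescent

open Functor.LaxMonoidal Functor.OplaxMonoidal Functor.Monoidal

variable {R H : Type u} [CommRing R] [CommRing H] [HopfAlgebra R H]
variable {C : Type w} [Category.{u} C] [Preadditive C] [Linear R C]
  [MonoidalCategory C] [SymmetricCategory C] [HasColimits C]
  [MonoidalPreadditive C] [MonoidalLinear R C] [MonoidalClosed C]

/-- The map `H ⊗ X ⟶ H ⊗ (H ⊗ X)` given by the comultiplication. -/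
def comulMap (X : ModuleCat.{u} R) : hopfModule R H ⊗ X ⟶ hopfModule R H ⊗ (hopfModule R H ⊗ X) :=
  Comod.forget.map (Comod.cofree.obj X).coaction

lemma tensorEl_comulMap {X : ModuleCat.{u} R} (x : X) :
    tensorEl (H := H) x ≫ comulMap X =
      ModuleCat.ofHom (Coalgebra.comul (R := R) (A := H)) ≫ hopfModule R H ◁ tensorEl x := by
  have h : Comod.mulMiddle (R := R) H H X ∘ₗ (TensorProduct.mk R H X 1).lTensor (H ⊗[R] H) =
      (TensorProduct.assoc R H H X).toLinearMap := by
    ext a b c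
    simp
  have h' : (TensorProduct.assoc R H H X).toLinearMap ∘ₗ (TensorProduct.mk R (H ⊗[R] H) X).flip x =
      ((TensorProduct.mk R H X).flip x).lTensor H := by
    ext a b
    simp
  ext1
  refine LinearMap.ext fun a => ?_
  refine (LinearMap.congr_fun h (Coalgebra.comul (R := R) (A := H) a ⊗ₜ x)).trans ?_
  exact LinearMap.congr_fun h' (Coalgebra.comul (R := R) (A := H) a)

variable {A : C} {τ : A ⟶ A ⊗ (scalar R C).obj (hopfModule R H)}

/-- This is coassociativity with the tensorator moved to the left. It says that `τ` equalizes the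
descent pair of the regular comodule. -/
lemma coactMap_hopfModule
    (h : τ ≫ τ ▷ (scalar R C).obj (ModuleCat.of R H) =
      τ ≫ A ◁ ((scalar R C).map (ModuleCat.ofHom (Coalgebra.comul (R := R) (A := H))) ≫
        δ (scalar R C) (ModuleCat.of R H) (ModuleCat.of R H)) ≫ (α_ _ _ _).inv) :
    τ ≫ coactMap τ (hopfModule R H) =
      τ ≫ A ◁ (scalar R C).map (ModuleCat.ofHom (Coalgebra.comul (R := R) (A := H))) := by
  rw [coactMap, reassoc_of% h]
  simp only [MonoidalCategory.whiskerLeft_comp, Category.assoc, Iso.inv_hom_id_assoc]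
  rw [← MonoidalCategory.whiskerLeft_comp A (δ _ _ _), δ_μ, MonoidalCategory.whiskerLeft_id]
  exact congrArg _ (Category.comp_id _)

lemma coactMap_coactMap
    (h : τ ≫ coactMap τ (hopfModule R H) =
      τ ≫ A ◁ (scalar R C).map (ModuleCat.ofHom (Coalgebra.comul (R := R) (A := H))))
    (X : ModuleCat.{u} R) :
    coactMap τ X ≫ coactMap τ (hopfModule R H ⊗ X) =
      coactMap τ X ≫ A ◁ (scalar R C).map (comulMap X) :=
  external_ext fun x => by
    rw [reassoc_of% (el_coactMap τ x), reassoc_of% (el_coactMap τ x), coactMap_naturality,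
      reassoc_of% h, ← MonoidalCategory.whiskerLeft_comp, ← MonoidalCategory.whiskerLeft_comp,
      ← Functor.map_comp, ← Functor.map_comp, tensorEl_comulMap]

variable [MonObj A]

/-- Up to associators and the tensorator, this is the torsor isomorphism tensored with `𝟙 ⊙ X`. -/
lemma isIso_extend_coactMap [IsIso (extend A τ)] (X : ModuleCat.{u} R) :
    IsIso (extend A (coactMap τ X)) := by
  have h : extend A (coactMap τ X) = (α_ _ _ _).inv ≫ extend A τ ▷ (scalar R C).obj X ≫
      (α_ _ _ _).hom ≫ A ◁ μ (scalar R C) _ _ := by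
    rw [coactMap, ← Category.assoc, ← extend_whiskerLeft]
    simp [extend]
  rw [h]
  infer_instance

section Descent

variable [IsIso (extend A τ)] [PreservesFiniteLimits (tensorLeft A)]
  (hcoassoc : τ ≫ coactMap τ (hopfModule R H) =
    τ ≫ A ◁ (scalar R C).map (ModuleCat.ofHom (Coalgebra.comul (R := R) (A := H))))

include hcoassoc in
-- This is the heart of descent. By flatness, `A ⊗ E` is the equalizer of `A ⊗ (A ⊙ M) ⇉ A ⊗ (A ⊙ (H
-- ⊗ M))`. The torsor isomorphism carries that pair to `A ⊙ -` of the pair `H ⊗ M ⇉ H ⊗ (H ⊗ M)`,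
-- whose equalizer `M` is split and so preserved by every functor. Hence `A ⊗ E ≅ A ⊙ M`.
lemma isIso_extend_of_isLimit (M : Comod R H) {E : C}
    {ι : E ⟶ A ⊗ (scalar R C).obj (Comod.forget.obj M)}
    {w : ι ≫ coactMap τ (Comod.forget.obj M) =
      ι ≫ A ◁ (scalar R C).map (coactionTrans.app M)}
    (h : IsLimit (Fork.ofι ι w)) : IsIso (extend A ι) := by
  have h₁ := isLimitForkMapOfIsLimit (tensorLeft A) _ h
  have h₂ := ((Comod.forgetSplit M).map (scalar R C ⋙ tensorLeft A)).isEqualizer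
  have hs : A ◁ coactMap τ (Comod.forget.obj M) ≫
        extend A (coactMap τ (hopfModule R H ⊗ Comod.forget.obj M)) =
      extend A (coactMap τ (Comod.forget.obj M)) ≫
        A ◁ (scalar R C).map (comulMap (Comod.forget.obj M)) := by
    rw [whiskerLeft_extend, extend_whiskerLeft, coactMap_coactMap hcoassoc]
  have ht : A ◁ A ◁ (scalar R C).map (coactionTrans.app M) ≫
        extend A (coactMap τ (hopfModule R H ⊗ Comod.forget.obj M)) =
      extend A (coactMap τ (Comod.forget.obj M)) ≫
        A ◁ (scalar R C).map (hopfModule R H ◁ coactionTrans.app M) := by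
    rw [whiskerLeft_extend, extend_whiskerLeft]
    exact congrArg (extend A) (coactMap_naturality τ (coactionTrans.app M))
  have hβ : extend A ι ≫ A ◁ (scalar R C).map (coactionTrans.app M) =
      A ◁ ι ≫ extend A (coactMap τ (Comod.forget.obj M)) := by
    rw [extend_whiskerLeft, whiskerLeft_extend, w]
  exact isIso_of_isLimit_fork h₁ h₂ (extend A (coactMap τ (Comod.forget.obj M)))
    (isIso_extend_coactMap _) (extend A (coactMap τ (hopfModule R H ⊗ Comod.forget.obj M)))
    (isIso_extend_coactMap _) hs ht _ hβ

end Descent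

end TorsorDescent

end UnivTorsor

namespace UnivTorsor

/-! ### The tensor functor attached to a torsor. -/

noncomputable section DescentFunctor

open Functor.LaxMonoidal Functor.OplaxMonoidal Functor.Monoidal

variable {R H : Type u} [CommRing R] [CommRing H] [HopfAlgebra R H]
variable {C : Type w} [Category.{u} C] [Preadditive C] [Linear R C]
  [MonoidalCategory C] [SymmetricCategory C] [HasColimits C]
  [MonoidalPreadditive C] [MonoidalLinear R C] [MonoidalClosed C] [HasEqualizers C]

variable (A : CoactedAlgebra R H C) [IsMonHom A.τ]

/-- The functor that sends a comodule `M` to the equalizer of the two morphisms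
`A ⊙ M ⟶ A ⊙ (H ⊗ M)` given by `τ` and by the coaction. -/
abbrev descentFunctor : Comod R H ⥤ C :=
  equalizerFunctor (coactTrans A.τ) (comodTrans R H A.X)

/-- The inclusion of the descent functor in `M ↦ A ⊙ M`. -/
abbrev descentInclusion :
    descentFunctor A ⟶ (Comod.forget (R := R) (H := H) ⋙ scalar R C) ⋙ tensorLeft A.X :=
  equalizerInclusion (coactTrans A.τ) (comodTrans R H A.X)

lemma descentInclusion_condition (M : Comod R H) :
    (descentInclusion A).app M ≫ coactMap A.τ (Comod.forget.obj M) =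
      (descentInclusion A).app M ≫ A.X ◁ (scalar R C).map (coactionTrans.app M) := by
  have h := equalizerInclusion_condition (coactTrans A.τ) (comodTrans R H A.X) M
  rw [coactTrans_app] at h
  exact h

/-- The descent functor is defined by an equalizer. -/
def descentIsLimit (M : Comod R H) :
    IsLimit (Fork.ofι ((descentInclusion A).app M) (descentInclusion_condition A M)) :=
  Fork.IsLimit.mk' _ fun s => by
    have hs : s.ι ≫ (coactTrans A.τ).app M = s.ι ≫ (comodTrans R H A.X).app M := by
      rw [coactTrans_app]
      exact s.condition
    exact ⟨equalizer.lift s.ι hs, equalizer.lift_ι _ _,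
      fun {m} hm => (cancel_mono ((descentInclusion A).app M)).mp
        (hm.trans (equalizer.lift_ι s.ι hs).symm)⟩

variable {A} (hA : IsTorsor R H C A)

include hA in
lemma IsTorsor.isIso_extend (M : Comod R H) : IsIso (extend A.X ((descentInclusion A).app M)) := by
  have := hA.flat
  have : IsIso (extend A.X A.τ) := hA.isIso
  exact isIso_extend_of_isLimit (coactMap_hopfModule hA.coassoc) M (descentIsLimit A M)

include hA in
-- Followed by `A ⊗ -`, the descent functor becomes isomorphic to `M ↦ A ⊗ (A ⊙ M)` with one factor
-- removed, that is to `M ↦ A ⊙ M`, a composite of left adjoints. Adjoint lifting along the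
-- comonadic functor `A ⊗ -` applies because comodules over a flat Hopf algebra have equalizers.
lemma IsTorsor.isLeftAdjoint_descentFunctor [Module.Flat R H] :
    (descentFunctor A).IsLeftAdjoint := by
  have := hA.flat
  have := hA.conservative
  let e : (Comod.forget (R := R) (H := H) ⋙ scalar R C) ⋙ tensorLeft A.X ≅
      descentFunctor A ⋙ tensorLeft A.X :=
    (NatIso.ofComponents (fun M => @asIso _ _ _ _ _ (hA.isIso_extend M)) fun {M N} f => by
      change A.X ◁ (descentFunctor A).map f ≫ extend A.X _ =
        extend A.X _ ≫ A.X ◁ (scalar R C).map (Comod.forget.map f)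
      rw [whiskerLeft_extend, extend_whiskerLeft, (descentInclusion A).naturality]
      rfl).symm
  have : (Comod.forget (R := R) (H := H)).IsLeftAdjoint := ⟨_, ⟨Comod.forgetAdj⟩⟩
  have : (scalar R C).IsLeftAdjoint := ⟨_, ⟨scalarAdj⟩⟩
  have : (tensorLeft A.X).IsLeftAdjoint := ⟨_, ⟨ihom.adjunction A.X⟩⟩
  have : ((Comod.forget (R := R) (H := H) ⋙ scalar R C) ⋙ tensorLeft A.X).IsLeftAdjoint :=
    inferInstance
  -- Comonadicity is faithful flatness: `A ⊗ -` preserves equalizers and reflects isomorphisms.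
  let : ComonadicLeftAdjoint (tensorLeft A.X) :=
    have : Comonad.PreservesLimitOfIsCoreflexivePair (tensorLeft A.X) :=
      ⟨fun _ _ _ => inferInstance⟩
    Comonad.comonadicOfHasPreservesCoreflexiveEqualizersOfReflectsIsomorphisms
      (ihom.adjunction A.X)
  have : (descentFunctor A ⋙ tensorLeft A.X).IsLeftAdjoint :=
    ((Adjunction.ofIsLeftAdjoint ((Comod.forget (R := R) (H := H) ⋙ scalar R C) ⋙
      tensorLeft A.X)).ofNatIsoLeft e).isLeftAdjoint
  exact isLeftAdjoint_triangle_lift_comonadic (tensorLeft A.X)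

/-- The descent functor of a torsor is strong monoidal. -/
@[reducible]
def IsTorsor.monoidalDescentFunctor : (descentFunctor A).Monoidal :=
  have := hA.conservative
  have := hA.isIso_extend
  have := isIso_ε_of_isIso_extend A.X (descentInclusion A)
  have := isIso_μ_of_isIso_extend A.X (descentInclusion A)
  Functor.Monoidal.ofLaxMonoidal _

/-- The tensor functor given by a torsor. -/
def IsTorsor.tensorFunctor [Module.Flat R H] : TensorFunctor R (Comod R H) C :=
  let _ : (descentFunctor A).Monoidal := hA.monoidalDescentFunctor
  have := hA.isLeftAdjoint_descentFunctor
  { functor := descentFunctor A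
    braided :=
      { braided := (inferInstance : (descentFunctor A).LaxBraided).braided } }

end DescentFunctor

end UnivTorsor

namespace UnivTorsor

/-! ### Unit maps and the tensorator of free modules. -/

noncomputable section UnitSwap

variable {C : Type*} [Category* C] [MonoidalCategory C] [SymmetricCategory C] (A : C) [MonObj A]

lemma whiskerLeft_unitMap_swap (X Y : C) :
    X ◁ unitMap A Y ≫ (swapIso X A Y).hom = unitMap A (X ⊗ Y) := by
  simp only [unitMap, swapIso, Iso.trans_hom, Iso.symm_hom, whiskerRightIso_hom,
    MonoidalCategory.whiskerLeft_comp, Category.assoc]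
  rw [associator_inv_naturality_middle_assoc, ← comp_whiskerRight_assoc,
    BraidedCategory.braiding_naturality_right]
  simp

lemma tensorHom_unitMap_μ {X X' : C} (f : X ⟶ A ⊗ X') (Y : C) :
    (f ⊗ₘ unitMap A Y) ≫ Functor.LaxMonoidal.μ (tensorLeft A) X' Y =
      f ▷ Y ≫ (α_ A X' Y).hom := by
  rw [tensorLeft_μ_eq, whiskerLeft_unitMap_swap, extend_unitMap, Category.comp_id]

end UnitSwap

section

variable {C : Type*} [Category* C] [MonoidalCategory C] (A : C) [MonObj A]

/-- If both legs of a triangle become isomorphisms of free modules, so does `A ◁ θ`. This detects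
isomorphisms both in the reconstruction of a torsor and between torsors. -/
lemma isIso_of_comp_extend [(tensorLeft A).ReflectsIsomorphisms] {X Y Q : C} {θ : X ⟶ Y}
    {f : Y ⟶ A ⊗ Q} {g : X ⟶ A ⊗ Q} (h : θ ≫ f = g) (hf : IsIso (extend A f))
    (hg : IsIso (extend A g)) : IsIso θ := by
  have h1 : A ◁ θ ≫ extend A f = extend A g := by rw [whiskerLeft_extend, h]
  have : IsIso (A ◁ θ ≫ extend A f) := by rwa [h1]
  have : IsIso (A ◁ θ) := IsIso.of_isIso_comp_right _ (extend A f)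
  have : IsIso ((tensorLeft A).map θ) := this
  exact isIso_of_reflects_iso _ (tensorLeft A)

end

/-! ### The functor `M ↦ A ⊙ M` on comodules and its value at the regular comodule. -/

noncomputable section FreeAlgebra

open Functor.LaxMonoidal Functor.OplaxMonoidal Functor.Monoidal

variable {R H : Type u} [CommRing R] [CommRing H] [HopfAlgebra R H]
variable {C : Type w} [Category.{u} C] [Preadditive C] [Linear R C]
  [MonoidalCategory C] [SymmetricCategory C] [HasColimits C]
  [MonoidalPreadditive C] [MonoidalLinear R C] [MonoidalClosed C] (A : C) [MonObj A]

variable (R H) in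
/-- The functor `M ↦ A ⊙ M` on comodules. -/
abbrev freeFunctor : Comod R H ⥤ C := (Comod.forget ⋙ scalar R C) ⋙ tensorLeft A

lemma freeFunctor_ε : ε (freeFunctor R H A) = unitMap A (𝟙_ C) ≫ A ◁ ε (scalar R C) := by
  have h : ε (Comod.forget (R := R) (H := H) ⋙ scalar R C) = ε (scalar R C) :=
    (congrArg _ ((scalar R C).map_id _)).trans (Category.comp_id _)
  rw [← h]
  rfl

lemma freeFunctor_μ (M N : Comod R H) : μ (freeFunctor R H A) M N =
    μ (tensorLeft A) ((scalar R C).obj (Comod.forget.obj M))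
      ((scalar R C).obj (Comod.forget.obj N)) ≫
      A ◁ μ (scalar R C) (Comod.forget.obj M) (Comod.forget.obj N) := by
  have h : μ (Comod.forget (R := R) (H := H) ⋙ scalar R C) M N =
      μ (scalar R C) (Comod.forget.obj M) (Comod.forget.obj N) :=
    (congrArg _ ((scalar R C).map_id _)).trans (Category.comp_id _)
  rw [← h]
  rfl

lemma freeFunctor_ε_comp {M : Comod R H} (f : 𝟙_ (Comod R H) ⟶ M) :
    ε (freeFunctor R H A) ≫ (freeFunctor R H A).map f =
      unitMap A (𝟙_ C) ≫ A ◁ (ε (scalar R C) ≫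
        (scalar R C).map (X := 𝟙_ (ModuleCat.{u} R)) (Comod.forget.map f)) := by
  rw [MonoidalCategory.whiskerLeft_comp]
  exact (congrArg (· ≫ (freeFunctor R H A).map f) (freeFunctor_ε (H := H) A)).trans
    (Category.assoc _ _ _)

lemma freeFunctor_μ_comp {M N L : Comod R H} (f : M ⊗ N ⟶ L) :
    μ (freeFunctor R H A) M N ≫ (freeFunctor R H A).map f =
      μ (tensorLeft A) ((scalar R C).obj (Comod.forget.obj M))
        ((scalar R C).obj (Comod.forget.obj N)) ≫ A ◁ (μ (scalar R C) _ _ ≫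
          (scalar R C).map (X := Comod.forget.obj M ⊗ Comod.forget.obj N) (Comod.forget.map f)) := by
  rw [MonoidalCategory.whiskerLeft_comp]
  exact (congrArg (· ≫ (freeFunctor R H A).map f) (freeFunctor_μ A M N)).trans
    (Category.assoc _ _ _)

lemma freeFunctor_one : ε (freeFunctor R H A) ≫
    (freeFunctor R H A).map (MonObj.one (X := Comod.regular (R := R) (H := H))) =
      MonObj.one (X := A ⊗ (scalar R C).obj (ModuleCat.of R H)) := by
  refine (freeFunctor_ε_comp A _).trans ?_
  change ((λ_ (𝟙_ C)).inv ≫ MonObj.one ▷ 𝟙_ C) ≫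
    A ◁ (MonObj.one (X := (scalar R C).obj (ModuleCat.of R H))) =
      (λ_ (𝟙_ C)).inv ≫ (MonObj.one ⊗ₘ MonObj.one (X := (scalar R C).obj (ModuleCat.of R H)))
  rw [MonoidalCategory.tensorHom_def, Category.assoc]

lemma freeFunctor_mul : μ (freeFunctor R H A) Comod.regular Comod.regular ≫
    (freeFunctor R H A).map (MonObj.mul (X := Comod.regular (R := R) (H := H))) =
      MonObj.mul (X := A ⊗ (scalar R C).obj (ModuleCat.of R H)) := by
  refine (freeFunctor_μ_comp A _).trans ?_
  change (tensorμ A ((scalar R C).obj (ModuleCat.of R H)) A ((scalar R C).obj (ModuleCat.of R H)) ≫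
      MonObj.mul ▷ ((scalar R C).obj (ModuleCat.of R H) ⊗ (scalar R C).obj (ModuleCat.of R H))) ≫
        A ◁ (MonObj.mul (X := (scalar R C).obj (ModuleCat.of R H))) =
    tensorμ A _ A _ ≫ (MonObj.mul ⊗ₘ MonObj.mul (X := (scalar R C).obj (ModuleCat.of R H)))
  rw [MonoidalCategory.tensorHom_def, Category.assoc]

/-- The component of `ι` at the regular comodule is a monomorphism of algebras, so `θ` is
multiplicative as soon as its composite `τ` is. -/
lemma isMonHom_of_comp_freeFunctor {E : Comod R H ⥤ C} [E.LaxMonoidal]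
    (ι : E ⟶ freeFunctor R H A) [NatTrans.IsMonoidal ι] [Mono (ι.app Comod.regular)]
    (τ : A ⟶ A ⊗ (scalar R C).obj (ModuleCat.of R H)) [IsMonHom τ]
    (θ : A ⟶ E.obj Comod.regular) (h : θ ≫ ι.app Comod.regular = τ) :
    letI := E.monObjObj Comod.regular
    IsMonHom θ := by
  let _ := E.monObjObj Comod.regular
  constructor
  · rw [← cancel_mono (ι.app Comod.regular), Category.assoc, h]
    refine (IsMonHom.one_hom τ).trans ((freeFunctor_one A).symm.trans ?_)
    change _ = (ε E ≫ E.map MonObj.one) ≫ _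
    rw [Category.assoc, ι.naturality, ← Category.assoc, NatTrans.IsMonoidal.unit (τ := ι)]
  · have h1 : ((θ ⊗ₘ θ) ≫ μ E Comod.regular Comod.regular ≫ E.map MonObj.mul) ≫
        ι.app Comod.regular = (τ ⊗ₘ τ) ≫ μ (freeFunctor R H A) Comod.regular Comod.regular ≫
          (freeFunctor R H A).map MonObj.mul := by
      subst h
      rw [Category.assoc, Category.assoc, ι.naturality, ← Category.assoc (μ E _ _),
        NatTrans.IsMonoidal.tensor (τ := ι), Category.assoc, tensorHom_comp_tensorHom_assoc]
      rfl
    rw [← cancel_mono (ι.app Comod.regular), Category.assoc, h]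
    exact (IsMonHom.mul_hom τ).trans
      ((congrArg ((τ ⊗ₘ τ) ≫ ·) (freeFunctor_mul A).symm).trans h1.symm)

lemma tensorHom_unitMap_freeFunctor_μ {M N : Comod R H} {X : C}
    (f : X ⟶ A ⊗ (scalar R C).obj (Comod.forget.obj M)) :
    (f ⊗ₘ unitMap A ((scalar R C).obj (Comod.forget.obj N))) ≫ μ (freeFunctor R H A) M N =
      f ▷ _ ≫ (α_ _ _ _).hom ≫
        A ◁ μ (scalar R C) (Comod.forget.obj M) (Comod.forget.obj N) := by
  rw [freeFunctor_μ]
  exact (Category.assoc _ _ _).symm.trans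
    ((congrArg (· ≫ _) (tensorHom_unitMap_μ A f _)).trans (Category.assoc _ _ _))

/-- Trivial comodules are generated by morphisms from the unit, and on the unit a monoidal `ι` is
forced to be the unit of `A`. -/
lemma comparison_comp_freeFunctor (F : TensorFunctor R (Comod R H) C)
    (ι : F.functor ⟶ freeFunctor R H A) [NatTrans.IsMonoidal ι] (X : ModuleCat.{u} R) :
    comparison F X ≫ ι.app (Comod.trivial.obj X) = unitMap A ((scalar R C).obj X) :=
  scalar_ext fun x => by
    have h : ε (scalar R C) ≫ (scalar R C).map (X := 𝟙_ (ModuleCat.{u} R))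
        (Comod.forget.map (trivialEl (H := H) x)) = el C x :=
      (el_scalar_map (C := C) _ _).trans (congrArg (el C) (one_smul R x))
    rw [el_comparison_assoc, ι.naturality, ← Category.assoc, NatTrans.IsMonoidal.unit (τ := ι)]
    exact (freeFunctor_ε_comp A _).trans ((congrArg (unitMap A (𝟙_ C) ≫ A ◁ ·) h).trans
      (unitMap_naturality A (el C x)).symm)

end FreeAlgebra

section

variable {R H : Type u} [CommRing R] [CommRing H] [HopfAlgebra R H]
  {C : Type w} [Category.{u} C] [Preadditive C] [Linear R C]
  [MonoidalCategory C] [SymmetricCategory C] [HasColimits C]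

lemma CoactedAlgebra.isIso_of_isIso_hom {A B : CoactedAlgebra R H C} (f : A ⟶ B)
    (h : IsIso f.hom) : IsIso f := by
  have : IsMonHom (asIso f.hom).hom := f.isMonHom
  let g : B ⟶ A :=
    { hom := (asIso f.hom).inv
      isMonHom := inferInstance
      comm := by
        rw [← cancel_epi f.hom, ← Category.assoc, ← f.comm, Category.assoc, ← comp_whiskerRight]
        simp }
  exact ⟨g, CoactedAlgebra.Hom.ext (IsIso.hom_inv_id f.hom),
    CoactedAlgebra.Hom.ext (IsIso.inv_hom_id f.hom)⟩

end

/-! ### Recovery of a torsor from its tensor functor. -/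

noncomputable section Reconstruction

open Functor.LaxMonoidal Functor.OplaxMonoidal Functor.Monoidal

variable {R H : Type u} [CommRing R] [CommRing H] [HopfAlgebra R H]
variable {C : Type w} [Category.{u} C] [Preadditive C] [Linear R C]
  [MonoidalCategory C] [SymmetricCategory C] [HasColimits C]
  [MonoidalPreadditive C] [MonoidalLinear R C] [MonoidalClosed C] [HasEqualizers C]
  [Module.Flat R H] {A : CoactedAlgebra R H C} [IsMonHom A.τ] (hA : IsTorsor R H C A)

namespace IsTorsor

include hA in
lemma exists_lift_τ : ∃ θ : A.X ⟶ (descentFunctor A).obj Comod.regular,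
    θ ≫ (descentInclusion A).app Comod.regular = A.τ :=
  let ⟨l, hl⟩ := Fork.IsLimit.lift' (descentIsLimit A Comod.regular) A.τ
    (coactMap_hopfModule hA.coassoc)
  ⟨l, hl⟩

/-- The inclusion as a transformation of the tensor functor given by a torsor. -/
def inclusion : (hA.tensorFunctor).functor ⟶ freeFunctor R H A.X := descentInclusion A

instance : NatTrans.IsMonoidal hA.inclusion :=
  inferInstanceAs (NatTrans.IsMonoidal (descentInclusion A))

instance (M : Comod R H) : Mono (hA.inclusion.app M) :=
  inferInstanceAs (Mono ((descentInclusion A).app M))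

/-- The isomorphism of a torsor with the value of its tensor functor at the regular comodule. -/
def toEval : A.X ⟶ hA.tensorFunctor.functor.obj Comod.regular := hA.exists_lift_τ.choose

lemma toEval_inclusion : hA.toEval ≫ hA.inclusion.app Comod.regular = A.τ :=
  hA.exists_lift_τ.choose_spec

/-- Both `τ` and the inclusion of the equalizer extend to isomorphisms onto `A ⊗ (A ⊙ H)`'s
counterpart over one factor `A`, namely `A ⊙ H`. -/
lemma isIso_toEval : IsIso hA.toEval :=
  have := hA.conservative
  isIso_of_comp_extend A.X (Q := (scalar R C).obj (ModuleCat.of R H)) hA.toEval_inclusion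
    (hA.isIso_extend Comod.regular) hA.isIso

/-- After composition with isomorphisms and the monic inclusion into `A ⊙ (H ⊗ H)`, both sides are
the two sides of coassociativity of `τ`. -/
lemma toEval_comm : A.τ ≫ hA.toEval ▷ (scalar R C).obj (ModuleCat.of R H) =
    hA.toEval ≫ hA.tensorFunctor.functor.map Comod.regularCoaction ≫
      δ hA.tensorFunctor.functor _ _ ≫
        _ ◁ (comparisonIso hA.tensorFunctor (ModuleCat.of R H)).inv := by
  rw [← cancel_mono (_ ◁ (comparisonIso hA.tensorFunctor (ModuleCat.of R H)).hom)]
  simp only [Category.assoc, ← MonoidalCategory.whiskerLeft_comp, Iso.inv_hom_id,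
    MonoidalCategory.whiskerLeft_id, Category.comp_id]
  rw [← cancel_mono (μ hA.tensorFunctor.functor _ _)]
  simp only [Category.assoc, δ_μ, Category.comp_id]
  rw [← cancel_mono (hA.inclusion.app _)]
  simp only [Category.assoc]
  rw [hA.inclusion.naturality, reassoc_of% hA.toEval_inclusion,
    NatTrans.IsMonoidal.tensor (τ := hA.inclusion)]
  have h1 := comparison_comp_freeFunctor A.X hA.tensorFunctor hA.inclusion (ModuleCat.of R H)
  rw [← MonoidalCategory.tensorHom_def_assoc, tensorHom_comp_tensorHom_assoc, toEval_inclusion]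
  -- The second tensor factor is the unit map of `A`, so multiplying the two copies of `A` leaves
  -- `coactMap A.τ`.
  change A.τ ≫ (A.τ ⊗ₘ comparison _ _ ≫ _) ≫ _ = _
  rw [h1]
  refine (congrArg _ (tensorHom_unitMap_freeFunctor_μ A.X (M := Comod.regular)
    (N := Comod.trivial.obj (ModuleCat.of R H)) A.τ)).trans ?_
  exact coactMap_hopfModule hA.coassoc

/-- The morphism from a torsor to the value of its tensor functor at the regular comodule. -/
def toEvalHom : A ⟶ (evalRegular R H C).obj hA.tensorFunctor where
  hom := hA.toEval
  isMonHom := isMonHom_of_comp_freeFunctor A.X hA.inclusion A.τ _ hA.toEval_inclusion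
  comm := hA.toEval_comm

instance : IsIso hA.toEvalHom := CoactedAlgebra.isIso_of_isIso_hom _ hA.isIso_toEval

end IsTorsor

end Reconstruction

end UnivTorsor

namespace UnivTorsor

/-! ### The coaction as a monoidal transformation to cofree comodules. -/

noncomputable section CofreeMonoidal

open Functor.LaxMonoidal

variable {R H : Type u} [CommRing R] [CommRing H] [HopfAlgebra R H]

namespace Comod

instance : (trivial (R := R) (H := H)).LaxMonoidal where
  ε := 𝟙 (𝟙_ (Comod R H))
  μ X Y := ⟨LinearMap.id, by
    refine TensorProduct.ext' fun (x : X) (y : Y) => ?_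
    change (1 : H) ⊗ₜ[R] (x ⊗ₜ[R] y) =
      (LinearMap.id).lTensor H (((1 : H) * 1) ⊗ₜ[R] (x ⊗ₜ[R] y))
    simp⟩
  μ_natural_left f X := rfl
  μ_natural_right X f := rfl
  associativity X Y Z := by
    ext1
    exact TensorProduct.ext_threefold fun x y z => rfl
  left_unitality X := by
    ext1
    exact TensorProduct.ext' fun x y => rfl
  right_unitality X := by
    ext1
    exact TensorProduct.ext' fun x y => rfl

variable (R H) in
/-- The functor that sends a comodule to the cofree comodule on its underlying module. -/
abbrev cofreeForget : Comod R H ⥤ Comod R H := (forget ⋙ trivial) ⋙ tensorLeft regular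

variable (R H) in
/-- The coaction as a natural transformation of functors to comodules. -/
def coactionNat : 𝟭 (Comod R H) ⟶ cofreeForget R H where
  app M := M.coaction
  naturality _ _ f := coaction_naturality f

instance : NatTrans.IsMonoidal (coactionNat R H) where
  unit := by
    ext1
    refine LinearMap.ext_ring ?_
    change (1 : H) ⊗ₜ[R] (1 : R) = (algebraMap R H 1) ⊗ₜ[R] (1 : R)
    rw [map_one]
  tensor M N := by
    have h : μ (cofreeForget R H) M N = μ (tensorLeft (regular (R := R) (H := H)))
      (trivial.obj (forget.obj M)) (trivial.obj (forget.obj N)) ≫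
        regular ◁ μ trivial (forget.obj M) (forget.obj N) := rfl
    have h' (g : (H ⊗[R] M.X) ⊗[R] (H ⊗[R] N.X) →ₗ[R] H ⊗[R] (M.X ⊗[R] N.X))
        (hg : ∀ a m b n, g ((a ⊗ₜ m) ⊗ₜ (b ⊗ₜ n)) = (a * b) ⊗ₜ (m ⊗ₜ n)) :
        mulMiddle H M.X N.X = g := by
      ext a m b n
      simp [hg]
    ext1
    refine TensorProduct.ext' fun (m : M.X) (n : N.X) => ?_
    exact LinearMap.congr_fun (h' (μ (cofreeForget R H) M N).hom fun a m b n => by rw [h]; rfl)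
      (M.coact m ⊗ₜ N.coact n)

/-- The morphism `h ↦ h ⊗ x`. -/
def cofreeEl {X : ModuleCat.{u} R} (x : X) :
    regular (R := R) (H := H) ⟶ regular ⊗ trivial.obj X :=
  (ρ_ regular).inv ≫ regular ◁ trivialEl x

lemma cofreeEl_coaction {X : ModuleCat.{u} R} (x : X) :
    cofreeEl (H := H) x ≫ (regular ⊗ trivial.obj X : Comod R H).coaction =
      regularCoaction ≫ regular ◁ trivial.map (tensorEl x) := by
  have h : forget.map (cofreeEl (H := H) x) = tensorEl x := by
    ext1
    refine LinearMap.ext fun a => ?_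
    change a ⊗ₜ[R] ((1 : R) • x) = a ⊗ₜ[R] x
    rw [one_smul]
  rw [coaction_naturality, h]
  rfl

end Comod

end CofreeMonoidal

/-! ### The embedding of `F M` in `F(H, δ) ⊙ M`. -/

noncomputable section CofreeComparison

open Functor.LaxMonoidal Functor.OplaxMonoidal Functor.Monoidal
open Comod

variable {R H : Type u} [CommRing R] [CommRing H] [HopfAlgebra R H]
variable {C : Type w} [Category.{u} C] [Preadditive C] [Linear R C]
  [MonoidalCategory C] [SymmetricCategory C] [HasColimits C]
  [MonoidalPreadditive C] [MonoidalLinear R C] [MonoidalClosed C]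
  (F : TensorFunctor R (Comod R H) C)

/-- `comparison` as a natural transformation. -/
def comparisonTrans : scalar R C ⟶ trivial ⋙ F.functor where
  app := comparison F
  naturality X Y f := scalar_ext fun x => by
    have h : trivialEl (H := H) (f.hom x) = trivialEl x ≫ trivial.map f := by
      ext1
      refine LinearMap.ext_ring ?_
      change (1 : R) • f.hom x = f.hom ((1 : R) • x)
      rw [one_smul, one_smul]
    rw [el_scalar_map_assoc, el_comparison, el_comparison_assoc, h, Functor.map_comp]
    rfl

instance : NatTrans.IsMonoidal (comparisonTrans F) where
  unit := by
    have h : trivialEl (H := H) (M := 𝟙_ (ModuleCat.{u} R)) (1 : R) = 𝟙 (𝟙_ (Comod R H)) := by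
      ext1
      exact LinearMap.ext_ring (one_smul R (1 : R))
    change el C (M := 𝟙_ (ModuleCat.{u} R)) (1 : R) ≫ comparison F _ =
      ε F.functor ≫ F.functor.map (𝟙 (𝟙_ (Comod R H)))
    rw [el_comparison, h]
    rfl
  tensor X Y := scalarTensor_ext fun x y => by
    have h : (λ_ (𝟙_ (Comod R H))).hom ≫ trivialEl (H := H) (M := X ⊗ Y) (x ⊗ₜ y) =
        (trivialEl x ⊗ₘ trivialEl y) ≫ μ trivial X Y := by
      ext1
      refine TensorProduct.ext' fun (r : R) (s : R) => ?_
      change (r • s) • (x ⊗ₜ[R] y) = (r • x) ⊗ₜ[R] (s • y)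
      rw [TensorProduct.smul_tmul_smul]
      rfl
    have h1 : μ (trivial ⋙ F.functor) X Y =
      μ F.functor (trivial.obj X) (trivial.obj Y) ≫ F.functor.map (μ trivial X Y) := rfl
    change _ ≫ scalarMu X Y ≫ comparison F _ =
      _ ≫ (comparison F X ⊗ₘ comparison F Y) ≫ μ (trivial ⋙ F.functor) X Y
    rw [el_scalarMu_assoc, el_comparison, tensorHom_comp_tensorHom_assoc, el_comparison,
      el_comparison, h1, ← tensorHom_comp_tensorHom_assoc, μ_natural_assoc, ← Functor.map_comp, ← h,
      Functor.map_comp]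
    simp [MonoidalCategory.tensorHom_def']

/-- The isomorphism `F (H, δ) ⊙ X ≅ F ((H, δ) ⊙ X)`. -/
def cofreeComparison (X : ModuleCat.{u} R) :
    F.functor.obj regular ⊗ (scalar R C).obj X ≅ F.functor.obj (regular ⊗ trivial.obj X) :=
  whiskerLeftIso _ (comparisonIso F X) ≪≫ μIso F.functor regular (trivial.obj X)

lemma cofreeComparison_hom (X : ModuleCat.{u} R) : (cofreeComparison F X).hom =
  _ ◁ comparison F X ≫ μ F.functor regular (trivial.obj X) := rfl

lemma cofreeComparison_naturality {X Y : ModuleCat.{u} R} (f : X ⟶ Y) :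
    _ ◁ (scalar R C).map f ≫ (cofreeComparison F Y).hom =
      (cofreeComparison F X).hom ≫ F.functor.map (regular ◁ trivial.map f) := by
  have h : (scalar R C).map f ≫ comparison F Y = comparison F X ≫ F.functor.map (trivial.map f) :=
    (comparisonTrans F).naturality f
  rw [cofreeComparison_hom, cofreeComparison_hom, ← MonoidalCategory.whiskerLeft_comp_assoc, h,
    MonoidalCategory.whiskerLeft_comp, Category.assoc, Category.assoc, ← μ_natural_right]

lemma el_cofreeComparison {X : ModuleCat.{u} R} (x : X) :
    _ ◁ el C x ≫ (cofreeComparison F X).hom = (ρ_ _).hom ≫ F.functor.map (cofreeEl x) := by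
  rw [cofreeComparison_hom, ← MonoidalCategory.whiskerLeft_comp_assoc, el_comparison, cofreeEl,
    MonoidalCategory.whiskerLeft_comp, Category.assoc, Functor.map_comp, map_rightUnitor_inv]
  simp

open scoped Obj in
/-- `cofreeComparison` as a natural transformation. -/
def cofreeComparisonTrans :
    freeFunctor R H (F.functor.obj (regular (R := R) (H := H))) ⟶ cofreeForget R H ⋙ F.functor :=
  Functor.whiskerRight (Functor.whiskerLeft forget (comparisonTrans F)) _ ≫
    Functor.whiskerRight (Functor.associator _ _ _).inv _ ≫ (Functor.associator _ _ _).hom ≫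
    Functor.whiskerLeft (forget ⋙ trivial) (tensorLeftComparison F.functor regular) ≫
    (Functor.associator _ _ _).inv

lemma cofreeComparisonTrans_app (M : Comod R H) :
    (cofreeComparisonTrans F).app M = (cofreeComparison F (forget.obj M)).hom := by
  simp [cofreeComparisonTrans, tensorLeftComparison, comparisonTrans, cofreeComparison_hom]

open scoped Obj in
instance : NatTrans.IsMonoidal (cofreeComparisonTrans F) := by
  unfold cofreeComparisonTrans
  infer_instance

/-- `cofreeComparisonTrans` as an isomorphism. -/
def cofreeComparisonIso :
    freeFunctor R H (F.functor.obj (regular (R := R) (H := H))) ≅ cofreeForget R H ⋙ F.functor :=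
  NatIso.ofComponents (fun M => cofreeComparison F (forget.obj M)) fun {M N} f => by
    have h := (cofreeComparisonTrans F).naturality f
    rw [cofreeComparisonTrans_app, cofreeComparisonTrans_app] at h
    exact h

lemma cofreeComparisonIso_hom : (cofreeComparisonIso F).hom = cofreeComparisonTrans F := by
  ext M
  exact (cofreeComparisonTrans_app F M).symm

open scoped Obj in
instance : NatTrans.IsMonoidal (cofreeComparisonIso F).hom := by
  rw [cofreeComparisonIso_hom]
  infer_instance

/-- The transformation `F M ⟶ F ((H, δ) ⊙ M) ≅ F (H, δ) ⊙ M`. -/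
def freeInclusion : F.functor ⟶ freeFunctor R H (F.functor.obj (regular (R := R) (H := H))) :=
  F.functor.leftUnitor.inv ≫ Functor.whiskerRight (coactionNat R H) F.functor ≫
    (cofreeComparisonIso F).inv

open scoped Obj in
instance : NatTrans.IsMonoidal (freeInclusion F) := by
  unfold freeInclusion
  infer_instance

/-- The components of `freeInclusion`. -/
def freeι (M : Comod R H) :
    F.functor.obj M ⟶ F.functor.obj regular ⊗ (scalar R C).obj (forget.obj M) :=
  F.functor.map M.coaction ≫ (cofreeComparison F (forget.obj M)).inv

lemma freeInclusion_app (M : Comod R H) : (freeInclusion F).app M = freeι F M :=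
  Category.id_comp _

lemma freeι_cofreeComparison (M : Comod R H) :
    freeι F M ≫ (cofreeComparison F (forget.obj M)).hom = F.functor.map M.coaction := by
  simp [freeι]

lemma freeι_naturality {M N : Comod R H} (f : M ⟶ N) :
    F.functor.map f ≫ freeι F N =
      freeι F M ≫ F.functor.obj regular ◁ (scalar R C).map (forget.map f) := by
  rw [← freeInclusion_app, ← freeInclusion_app]
  exact (freeInclusion F).naturality f

/-- The morphism `F (H, δ) ⟶ F (H, δ) ⊙ H` induced by `δ`. -/
def evalτ : F.functor.obj (regular (R := R) (H := H)) ⟶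
    F.functor.obj regular ⊗ (scalar R C).obj (hopfModule R H) :=
  ((evalRegular R H C).obj F).τ

/-- The coaction of the regular comodule is the comultiplication. The torsor axioms for `evalτ`
thereby become instances of properties of `freeι`. -/
lemma evalτ_eq_freeι : evalτ F = freeι F regular := by
  have h : evalτ F ≫ (cofreeComparison F (hopfModule R H)).hom =
      F.functor.map regularCoaction := by
    change (F.functor.map regularCoaction ≫ δ F.functor _ _ ≫
      F.functor.obj regular ◁ (comparisonIso F (ModuleCat.of R H)).inv) ≫
        _ ◁ (comparisonIso F (ModuleCat.of R H)).hom ≫ μ F.functor _ _ = _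
    simp
  exact (Iso.eq_comp_inv _).2 h

lemma evalτ_cofreeComparison :
    evalτ F ≫ (cofreeComparison F (hopfModule R H)).hom = F.functor.map regularCoaction := by
  rw [evalτ_eq_freeι]
  exact freeι_cofreeComparison F regular

/-- Under the identification of `F(H ⊙ X)` with `F(H, δ) ⊙ X`, the coaction of a cofree comodule
becomes `coactMap`; on each element `x` this is naturality of the coaction along `h ↦ h ⊗ x`. -/
lemma cofreeComparison_coaction (X : ModuleCat.{u} R) :
    (cofreeComparison F X).hom ≫ F.functor.map (regular ⊗ trivial.obj X : Comod R H).coaction =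
      coactMap (evalτ F) X ≫ (cofreeComparison F (hopfModule R H ⊗ X)).hom := by
  refine external_ext fun x => ?_
  refine ((reassoc_of% (el_cofreeComparison F x)) _).trans ?_
  refine Eq.trans ?_ ((reassoc_of% (el_coactMap (evalτ F) x)) _).symm
  refine Eq.trans ?_ (congrArg (fun t => (ρ_ (F.functor.obj regular)).hom ≫ evalτ F ≫ t)
    (cofreeComparison_naturality F (tensorEl x))).symm
  refine congrArg ((ρ_ (F.functor.obj regular)).hom ≫ ·)
    (Eq.trans ?_ ((reassoc_of% (evalτ_cofreeComparison F)) _).symm)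
  exact (F.functor.map_comp _ _).symm.trans
    ((congrArg F.functor.map (cofreeEl_coaction x)).trans (F.functor.map_comp _ _))

/-- This is the image under `F` of coassociativity of `M`, and places `F M` in the descent equalizer
of the torsor `F(H, δ)`. -/
lemma freeι_coactMap (M : Comod R H) :
    freeι F M ≫ coactMap (evalτ F) (forget.obj M) =
      freeι F M ≫ F.functor.obj regular ◁ (scalar R C).map (coactionTrans.app M) := by
  refine (cancel_mono (cofreeComparison F (hopfModule R H ⊗ forget.obj M)).hom).1 ?_
  have h := cofreeComparison_naturality F (coactionTrans.app M)
  have h1 := cofreeComparison_coaction F (forget.obj M)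
  refine (Category.assoc _ _ _).trans ((congrArg (freeι F M ≫ ·) h1.symm).trans ?_)
  refine Eq.trans ?_ ((congrArg (freeι F M ≫ ·) h).symm.trans (Category.assoc _ _ _).symm)
  refine ((reassoc_of% (freeι_cofreeComparison F M)) _).trans ?_
  refine Eq.trans ?_ ((reassoc_of% (freeι_cofreeComparison F M)) _).symm
  exact (F.functor.map_comp _ _).symm.trans
    ((congrArg F.functor.map (coaction_naturality M.coaction)).trans (F.functor.map_comp _ _))

end CofreeComparison

end UnivTorsor

namespace UnivTorsor

section

variable {D E : Type*} [Category* D] [Category* E]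

/-- Limit forks after application of a functor transport along natural isomorphisms. -/
def isLimitForkMapOfIso {G G' : D ⥤ E} (e : G ≅ G') {X Y Z : D} {f g : Y ⟶ Z} {i : X ⟶ Y}
    (w : i ≫ f = i ≫ g)
    (h : IsLimit (Fork.ofι (G.map i) (by simp only [← G.map_comp, w]) :
      Fork (G.map f) (G.map g))) :
    IsLimit (Fork.ofι (G'.map i) (by simp only [← G'.map_comp, w]) :
      Fork (G'.map f) (G'.map g)) :=
  isLimitMapConeForkEquiv G' w (IsLimit.mapConeEquiv e ((isLimitMapConeForkEquiv G w).symm h))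

end

/-! ### Tensor functors preserve the bar resolution of a comodule. -/

noncomputable section EvalDescent

open Functor.LaxMonoidal Functor.OplaxMonoidal Functor.Monoidal
open Comod

variable {R H : Type u} [CommRing R] [CommRing H] [HopfAlgebra R H]
variable {C : Type w} [Category.{u} C] [Preadditive C] [Linear R C]
  [MonoidalCategory C] [SymmetricCategory C] [HasColimits C]
  [MonoidalPreadditive C] [MonoidalLinear R C] [MonoidalClosed C]
  (F : TensorFunctor R (Comod R H) C)

/-- `F (H, δ) ⊗ F M` is the value of `F` at the cofree comodule on `M`. -/
def tensorEvalIso : (forget ⋙ cofree) ⋙ F.functor ≅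
    F.functor ⋙ tensorLeft (F.functor.obj (regular (R := R) (H := H))) :=
  Functor.isoWhiskerRight untwistIso.symm F.functor ≪≫
    (NatIso.ofComponents (fun M => μIso F.functor regular M)
      fun f => μ_natural_right F.functor regular f :
        F.functor ⋙ tensorLeft (F.functor.obj (regular (R := R) (H := H))) ≅
          tensorLeft regular ⋙ F.functor).symm

variable [HasEqualizers C] [AB5 C] (hH : IsAdamsHopfAlgebra R H)

/-- `F` preserves the bar resolution of a comodule by cofree comodules. -/
def mapCoactionIsLimit (M : Comod R H) : IsLimit (Fork.ofι (F.functor.map M.coaction)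
    ((F.functor.map_comp _ _).symm.trans ((congrArg F.functor.map
      (coaction_naturality M.coaction).symm).trans (F.functor.map_comp _ _))) :
    Fork (F.functor.map (cofree.map (forget.map M.coaction)))
      (F.functor.map (cofree.obj (forget.obj M)).coaction)) :=
  have := preservesFiniteLimits_regular hH F
  have := reflectsIsomorphisms_regular hH F
  -- A functor that preserves an existing equalizer and reflects isomorphisms also reflects that
  -- equalizer.
  have : ReflectsLimit (parallelPair (F.functor.map (cofree.map (forget.map M.coaction)))
      (F.functor.map (cofree.obj (forget.obj M)).coaction))
      (tensorLeft (F.functor.obj (regular (R := R) (H := H)))) :=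
    reflectsLimit_of_reflectsIsomorphisms _ _
  -- By untwisting, tensoring with `F(H, δ)` turns the fork into `F` of the cofree comodules on the
  -- underlying fork of modules, which is split.
  isLimitOfIsLimitForkMap (tensorLeft (F.functor.obj (regular (R := R) (H := H)))) _
    (isLimitForkMapOfIso (tensorEvalIso F) (coaction_naturality M.coaction).symm
      ((forgetSplit M).map (cofree ⋙ F.functor)).isEqualizer)

include hH in
lemma mono_freeι (M : Comod R H) : Mono (freeι F M) := by
  have : Mono (F.functor.map M.coaction) :=
    mono_of_isLimit_fork (mapCoactionIsLimit F hH M)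
  unfold freeι
  infer_instance

include hH in
-- With `mono_freeι` and `freeι_coactMap`, this identifies `F M` with the descent equalizer built
-- from `evalτ F`.
lemma exists_lift_freeι {M : Comod R H} {T : C}
    (t : T ⟶ F.functor.obj regular ⊗ (scalar R C).obj (forget.obj M))
    (ht : t ≫ coactMap (evalτ F) (forget.obj M) =
      t ≫ F.functor.obj regular ◁ (scalar R C).map (coactionTrans.app M)) :
    ∃ l : T ⟶ F.functor.obj M, l ≫ freeι F M = t := by
  have h1 := cofreeComparison_coaction F (forget.obj M)
  have h2 := cofreeComparison_naturality F (coactionTrans.app M)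
  obtain ⟨l, hl⟩ := Fork.IsLimit.lift' (mapCoactionIsLimit F hH M)
    (t ≫ (cofreeComparison F (forget.obj M)).hom) (by
      refine (Category.assoc _ _ _).trans ((congrArg (t ≫ ·) h2.symm).trans ?_)
      refine Eq.trans ?_ ((congrArg (t ≫ ·) h1.symm).trans (Category.assoc _ _ _).symm)
      refine (Category.assoc _ _ _).symm.trans (Eq.trans ?_ (Category.assoc _ _ _))
      exact congrArg (· ≫ (cofreeComparison F (hopfModule R H ⊗ forget.obj M)).hom) ht.symm)
  refine ⟨l, (cancel_mono (cofreeComparison F (forget.obj M)).hom).1 ?_⟩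
  rw [Category.assoc, freeι_cofreeComparison]
  exact hl

end EvalDescent

end UnivTorsor

namespace UnivTorsor

/-! ### The value at the regular comodule is a torsor. -/

noncomputable section EvalTorsor

open Functor.LaxMonoidal Functor.OplaxMonoidal Functor.Monoidal
open Comod
open scoped Obj

variable {R H : Type u} [CommRing R] [CommRing H] [HopfAlgebra R H]
variable {C : Type w} [Category.{u} C] [Preadditive C] [Linear R C]
  [MonoidalCategory C] [SymmetricCategory C] [HasColimits C]
  [MonoidalPreadditive C] [MonoidalLinear R C] [MonoidalClosed C]
  (F : TensorFunctor R (Comod R H) C)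

/-- The morphism is a component of the monoidal transformation `freeInclusion F` at an algebra, and
such components are morphisms of algebras. -/
instance isMonHom_evalτ : IsMonHom (evalτ F) where
  one_hom := by
    have h : ε F.functor ≫ F.functor.map MonObj.one ≫ (freeInclusion F).app regular =
        ε (freeFunctor R H (F.functor.obj regular)) ≫
          (freeFunctor R H (F.functor.obj regular)).map MonObj.one := by
      rw [(freeInclusion F).naturality, ← Category.assoc,
        NatTrans.IsMonoidal.unit (τ := freeInclusion F)]
    rw [evalτ_eq_freeι, ← freeInclusion_app]
    exact (Category.assoc _ _ _).trans
      (h.trans (freeFunctor_one (R := R) (H := H) (F.functor.obj regular)))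
  mul_hom := by
    have h : μ F.functor regular regular ≫ F.functor.map MonObj.mul ≫
        (freeInclusion F).app regular =
        ((freeInclusion F).app regular ⊗ₘ (freeInclusion F).app regular) ≫
          μ (freeFunctor R H (F.functor.obj regular)) regular regular ≫
          (freeFunctor R H (F.functor.obj regular)).map MonObj.mul := by
      rw [(freeInclusion F).naturality, ← Category.assoc,
        NatTrans.IsMonoidal.tensor (τ := freeInclusion F), Category.assoc]
    rw [evalτ_eq_freeι, ← freeInclusion_app]
    exact (Category.assoc _ _ _).trans (h.trans (congrArg (_ ≫ ·)
      (freeFunctor_mul (R := R) (H := H) (F.functor.obj regular))))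

lemma evalτ_coassoc : evalτ F ≫ evalτ F ▷ (scalar R C).obj (hopfModule R H) =
    evalτ F ≫ F.functor.obj regular ◁ ((scalar R C).map
      (ModuleCat.ofHom (Coalgebra.comul (R := R) (A := H))) ≫
        δ (scalar R C) (hopfModule R H) (hopfModule R H)) ≫ (α_ _ _ _).inv := by
  have h : evalτ F ≫ coactMap (evalτ F) (hopfModule R H) = evalτ F ≫ F.functor.obj regular ◁
      (scalar R C).map (ModuleCat.ofHom (Coalgebra.comul (R := R) (A := H))) := by
    have := freeι_coactMap F (regular (R := R) (H := H))
    rw [← evalτ_eq_freeι] at this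
    exact this
  rw [coactMap] at h
  rw [MonoidalCategory.whiskerLeft_comp, Category.assoc, ← reassoc_of% h,
    ← MonoidalCategory.whiskerLeft_comp_assoc, μ_δ]
  simp

lemma whiskerLeft_ε_cofreeComparison :
    F.functor.obj (regular (R := R) (H := H)) ◁ ε (scalar R C) ≫
      (cofreeComparison F (𝟙_ (ModuleCat.{u} R))).hom =
      (ρ_ _).hom ≫ F.functor.map (ρ_ (regular (R := R) (H := H))).inv := by
  have h : cofreeEl (H := H) (X := 𝟙_ (ModuleCat.{u} R)) (1 : R) = (ρ_ regular).inv := by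
    ext1
    refine LinearMap.ext fun a => ?_
    change a ⊗ₜ[R] ((1 : R) • (1 : R)) = a ⊗ₜ[R] (1 : R)
    rw [one_smul]
  rw [← h]
  exact el_cofreeComparison F (X := 𝟙_ (ModuleCat.{u} R)) (1 : R)

lemma evalτ_counit : evalτ F ≫ F.functor.obj regular ◁ ((scalar R C).map (Y := 𝟙_ (ModuleCat.{u} R))
      (ModuleCat.ofHom (Coalgebra.counit (R := R) (A := H))) ≫ η (scalar R C)) ≫
        (ρ_ (F.functor.obj regular)).hom = 𝟙 (F.functor.obj regular) := by
  let c : hopfModule R H ⟶ 𝟙_ (ModuleCat.{u} R) :=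
    ModuleCat.ofHom (Coalgebra.counit (R := R) (A := H))
  have h1 : regularCoaction ≫ regular ◁ trivial.map c ≫ (ρ_ (regular (R := R) (H := H))).hom =
      𝟙 _ := by
    ext1
    refine LinearMap.ext fun a => ?_
    have h' := LinearMap.congr_fun (Coalgebra.lTensor_counit_comp_comul (R := R) (A := H)) a
    exact (congrArg (TensorProduct.rid R H) h').trans
      ((TensorProduct.rid_tmul _ _).trans (one_smul R _))
  have h2 : F.functor.obj (regular (R := R) (H := H)) ◁ η (scalar R C) ≫ (ρ_ _).hom =
      (cofreeComparison F (𝟙_ (ModuleCat.{u} R))).hom ≫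
        F.functor.map (ρ_ (regular (R := R) (H := H))).hom := by
    rw [← cancel_epi (F.functor.obj (regular (R := R) (H := H)) ◁ ε (scalar R C)),
      ← MonoidalCategory.whiskerLeft_comp_assoc, ε_η]
    refine Eq.trans ?_ (congrArg (· ≫ F.functor.map (ρ_ (regular (R := R) (H := H))).hom)
      (whiskerLeft_ε_cofreeComparison F)).symm |>.trans (Category.assoc _ _ _)
    rw [Category.assoc, ← Functor.map_comp]
    simp
  rw [MonoidalCategory.whiskerLeft_comp, Category.assoc]
  refine (congrArg (fun t => evalτ F ≫ F.functor.obj regular ◁ (scalar R C).map c ≫ t) h2).trans ?_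
  refine (congrArg (evalτ F ≫ ·) ((reassoc_of% (cofreeComparison_naturality F c)) _)).trans ?_
  refine ((reassoc_of% (evalτ_cofreeComparison F)) _).trans ?_
  refine Eq.trans ?_ ((congrArg F.functor.map h1).trans (F.functor.map_id _))
  exact (congrArg (F.functor.map regularCoaction ≫ ·) (F.functor.map_comp _ _).symm).trans
    (F.functor.map_comp _ _).symm

/-- Up to canonical isomorphisms, the torsor morphism is `F` applied to the untwisting morphism `H ⊗
M ⟶ H ⊙ M`, hence invertible. -/
lemma extend_freeι (M : Comod R H) :
    extend (F.functor.obj regular) (freeι F M) ≫ (cofreeComparison F (forget.obj M)).hom =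
      μ F.functor regular M ≫ F.functor.map M.untwist := by
  have h : (MonObj.mul (X := F.functor.obj (regular (R := R) (H := H)))) =
    μ F.functor regular regular ≫ F.functor.map MonObj.mul := rfl
  have h2 := freeι_cofreeComparison F M
  rw [cofreeComparison_hom] at h2 ⊢
  rw [extend, h]
  simp only [Category.assoc, ← whisker_exchange_assoc, comp_whiskerRight, untwist]
  rw [μ_natural_left, ← associator_inv_naturality_right_assoc,
    ← Functor.LaxMonoidal.associativity_inv_assoc, ← MonoidalCategory.whiskerLeft_comp_assoc,
    ← MonoidalCategory.whiskerLeft_comp_assoc, Category.assoc, h2, μ_natural_right_assoc,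
    Functor.map_comp, Functor.map_comp]

lemma isIso_extend_freeι (M : Comod R H) :
    IsIso (extend (F.functor.obj regular) (freeι F M)) := by
  have : IsIso (extend (F.functor.obj regular) (freeι F M) ≫
      (cofreeComparison F (forget.obj M)).hom) := by
    rw [extend_freeι]
    infer_instance
  exact IsIso.of_isIso_comp_right _ (cofreeComparison F (forget.obj M)).hom

variable [HasEqualizers C] [AB5 C]

lemma isTorsor_evalRegular (hH : IsAdamsHopfAlgebra R H) :
    IsTorsor R H C ((evalRegular R H C).obj F) where
  flat := preservesFiniteLimits_regular hH F
  conservative := reflectsIsomorphisms_regular hH F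
  isMonHom := isMonHom_evalτ F
  coassoc := evalτ_coassoc F
  counit := evalτ_counit F
  isIso := by
    have h := isIso_extend_freeι F regular
    rw [← evalτ_eq_freeι] at h
    exact h

end EvalTorsor

end UnivTorsor

namespace UnivTorsor

/-! ### Full faithfulness of evaluation at the regular comodule. -/

noncomputable section EvalFullyFaithful

open Functor.LaxMonoidal Functor.OplaxMonoidal Functor.Monoidal
open Comod

variable {R H : Type u} [CommRing R] [CommRing H] [HopfAlgebra R H]
variable {C : Type w} [Category.{u} C] [Preadditive C] [Linear R C]
  [MonoidalCategory C] [SymmetricCategory C] [HasColimits C]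
  [MonoidalPreadditive C] [MonoidalLinear R C] [MonoidalClosed C]

lemma coactMap_whiskerRight {A B : C} {τ : A ⟶ A ⊗ (scalar R C).obj (hopfModule R H)}
    {σ : B ⟶ B ⊗ (scalar R C).obj (hopfModule R H)} {f : A ⟶ B}
    (h : τ ≫ f ▷ (scalar R C).obj (hopfModule R H) = f ≫ σ) (X : ModuleCat.{u} R) :
    coactMap τ X ≫ f ▷ (scalar R C).obj (hopfModule R H ⊗ X) =
      f ▷ (scalar R C).obj X ≫ coactMap σ X := by
  simp only [coactMap, Category.assoc]
  rw [← comp_whiskerRight_assoc, ← h, whisker_exchange]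
  simp

variable {F G : TensorFunctor R (Comod R H) C}

lemma cofreeComparison_comp (α : F ⟶ G) (X : ModuleCat.{u} R) :
    (cofreeComparison F X).hom ≫ α.hom.app _ =
      α.hom.app regular ▷ (scalar R C).obj X ≫ (cofreeComparison G X).hom := by
  have := α.isMonoidal
  rw [cofreeComparison_hom, cofreeComparison_hom, Category.assoc,
    NatTrans.IsMonoidal.tensor (τ := α.hom), ← comparison_naturality α,
    MonoidalCategory.tensorHom_def, MonoidalCategory.whiskerLeft_comp]
  simp only [Category.assoc, whisker_exchange_assoc]

/-- A monoidal transformation is controlled by its component at the regular comodule: since `freeι G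
M` is mono, this square determines `α.hom.app M`. -/
lemma comp_freeι (α : F ⟶ G) (M : Comod R H) : α.hom.app M ≫ freeι G M =
    freeι F M ≫ α.hom.app regular ▷ (scalar R C).obj (forget.obj M) := by
  rw [← cancel_mono (cofreeComparison G (forget.obj M)).hom, Category.assoc, Category.assoc,
    freeι_cofreeComparison, ← cofreeComparison_comp, reassoc_of% (freeι_cofreeComparison F M),
    α.hom.naturality]

variable [HasEqualizers C] [AB5 C] (hH : IsAdamsHopfAlgebra R H)

include hH in
lemma evalRegular_faithful : (evalRegular R H C).Faithful where
  map_injective {F G α β} h := by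
    have h' : α.hom.app regular = β.hom.app regular := congrArg CoactedAlgebra.Hom.hom h
    apply TensorFunctor.Hom.ext
    ext M
    have := mono_freeι G hH M
    rw [← cancel_mono (freeι G M), comp_freeι, comp_freeι, h']

section Full

variable (f : F.functor.obj (regular (R := R) (H := H)) ⟶ G.functor.obj regular)
  (hf : evalτ F ≫ f ▷ (scalar R C).obj (hopfModule R H) = f ≫ evalτ G)

include hH hf in
-- Compatibility of `f` with the two coactions carries the descent condition for `F` to the one for
-- `G`, so the morphism lifts to the equalizer `G M`.
lemma exists_comp_freeι (M : Comod R H) : ∃ l : F.functor.obj M ⟶ G.functor.obj M,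
    l ≫ freeι G M = freeι F M ≫ f ▷ (scalar R C).obj (forget.obj M) := by
  refine exists_lift_freeι G hH _ ?_
  rw [Category.assoc, ← coactMap_whiskerRight hf, reassoc_of% (freeι_coactMap F M)]
  refine Eq.trans ?_ (Category.assoc _ _ _).symm
  exact congrArg (freeι F M ≫ ·) (whisker_exchange f ((scalar R C).map (coactionTrans.app M)))

/-- The transformation induced by a morphism `F (H, δ) ⟶ G (H, δ)`. -/
def transOfHom : F.functor ⟶ G.functor where
  app M := (exists_comp_freeι hH f hf M).choose
  naturality M N g := by
    have := mono_freeι G hH N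
    rw [← cancel_mono (freeι G N), Category.assoc, Category.assoc, freeι_naturality,
      (exists_comp_freeι hH f hf N).choose_spec,
      reassoc_of% (exists_comp_freeι hH f hf M).choose_spec, reassoc_of% (freeι_naturality F g),
      whisker_exchange]

lemma transOfHom_app (M : Comod R H) : (transOfHom hH f hf).app M ≫ freeι G M =
    freeι F M ≫ f ▷ (scalar R C).obj (forget.obj M) :=
  (exists_comp_freeι hH f hf M).choose_spec

lemma transOfHom_regular : (transOfHom hH f hf).app regular = f := by
  have := mono_freeι G hH regular
  rw [← cancel_mono (freeι G regular), transOfHom_app]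
  rw [evalτ_eq_freeι, evalτ_eq_freeι] at hf
  exact hf

open scoped Obj in
-- Composed with the monic monoidal transformation `freeInclusion G`, the transformation becomes
-- `freeInclusion F` followed by base change along `f`, which is monoidal because `f` is a morphism
-- of algebras.
lemma transOfHom_isMonoidal [IsMonHom f] : NatTrans.IsMonoidal (transOfHom hH f hf) := by
  have : ∀ M, Mono ((freeInclusion G).app M) := fun M => by
    rw [freeInclusion_app]
    exact mono_freeι G hH M
  have h : transOfHom hH f hf ≫ freeInclusion G =
      freeInclusion F ≫ Functor.whiskerLeft (forget ⋙ scalar R C) (tensorLeftMap f) := by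
    ext M
    rw [NatTrans.comp_app, NatTrans.comp_app, freeInclusion_app, freeInclusion_app]
    exact transOfHom_app hH f hf M
  have : NatTrans.IsMonoidal (transOfHom hH f hf ≫ freeInclusion G) := by
    rw [h]
    infer_instance
  exact isMonoidal_of_mono_comp _ (freeInclusion G)

end Full

open scoped Obj in
include hH in
lemma evalRegular_full : (evalRegular R H C).Full where
  map_surjective {F G} φ :=
    have : IsMonHom (M := F.functor.obj (regular (R := R) (H := H)))
      (N := G.functor.obj regular) φ.hom := φ.isMonHom
    ⟨{ hom := transOfHom hH φ.hom φ.comm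
       isMonoidal := transOfHom_isMonoidal hH φ.hom φ.comm },
      CoactedAlgebra.Hom.ext (transOfHom_regular hH φ.hom φ.comm)⟩

end EvalFullyFaithful

/-! ### Morphisms of torsors are invertible. -/

section Groupoid

variable {R H : Type u} [CommRing R] [CommRing H] [HopfAlgebra R H]
variable {C : Type w} [Category.{u} C] [Preadditive C] [Linear R C]
  [MonoidalCategory C] [SymmetricCategory C] [HasColimits C]
  [MonoidalPreadditive C] [MonoidalLinear R C] [MonoidalClosed C]

/-- Base change of the torsor isomorphism of `A` along `f` gives an isomorphism `B ⊗ A ≅ B ⊙ H`. By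
equivariance it is `B ◁ f` followed by the torsor isomorphism of `B`, so `B ◁ f` is invertible, and
`B ⊗ -` reflects this. -/
lemma IsTorsor.isIso_hom {A B : CoactedAlgebra R H C} (hA : IsTorsor R H C A)
    (hB : IsTorsor R H C B) (f : A ⟶ B) : IsIso f := by
  have : IsIso (extend A.X A.τ) := hA.isIso
  have := hB.conservative
  exact CoactedAlgebra.isIso_of_isIso_hom f
    (isIso_of_comp_extend B.X f.comm.symm hB.isIso (isIso_extend_comp f.hom A.τ))

end Groupoid

end UnivTorsor

theorem mainTheorem7 {R : Type u} [CommRing R] {H : Type u} [CommRing H] [HopfAlgebra R H]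
    (hH : UnivTorsor.IsAdamsHopfAlgebra R H)
    (C : Type w) [Category.{u} C] [Preadditive C] [Linear R C]
    [MonoidalCategory C] [SymmetricCategory C] [MonoidalPreadditive C] [MonoidalLinear R C]
    [MonoidalClosed C] [HasColimits C] [HasEqualizers C] [AB5 C] :
    (∃ h : ∀ F, UnivTorsor.IsTorsor R H C ((UnivTorsor.evalRegular R H C).obj F),
      ((UnivTorsor.torsorProperty R H C).lift (UnivTorsor.evalRegular R H C) h).IsEquivalence) ∧
    IsGroupoid (UnivTorsor.Torsor R H C) := by
  have := hH.flat
  have h (F) := UnivTorsor.isTorsor_evalRegular (C := C) F hH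
  refine ⟨⟨h, ?_⟩, ⟨fun {A B} f => ?_⟩⟩
  · have h₁ := UnivTorsor.evalRegular_faithful (C := C) hH
    have h₂ := UnivTorsor.evalRegular_full (C := C) hH
    refine { faithful := ?_, full := ?_, essSurj := ⟨fun A => ?_⟩ }
    -- The lift followed by the fully faithful inclusion of torsors is `evalRegular` itself, from
    -- which faithfulness and fullness descend.
    · exact Functor.Faithful.of_comp_iso
        (G := (UnivTorsor.torsorProperty R H C).ι) (Iso.refl (UnivTorsor.evalRegular R H C))
    · exact Functor.Full.of_comp_faithful_iso
        (G := (UnivTorsor.torsorProperty R H C).ι) (Iso.refl (UnivTorsor.evalRegular R H C))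
    · have hA : UnivTorsor.IsTorsor R H C A.obj := A.property
      have := hA.isMonHom
      exact ⟨hA.tensorFunctor, ⟨((UnivTorsor.torsorProperty R H C).isoMk
        (asIso hA.toEvalHom)).symm⟩⟩
  · have := A.property.isIso_hom B.property f.hom
    exact ((UnivTorsor.torsorProperty R H C).isoMk (asIso f.hom)).isIso_hom
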